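/- Let $R\subset\mathbb R^n$ be an irreducible reduced (crystallographic) root system with simple roots $\alpha_1,\dots,\alpha_n$, positive roots $R_+$, Weyl group $W$ with longest element $w_0$, and $W$-invariant inner product $(\cdot,\cdot)$ normalized by $(\alpha,\alpha)=2$ for short roots. Put $\alpha^\vee=2\alpha/(\alpha,\alpha)$, $\nu_\alpha=(\alpha,\alpha)/2$; let $\omega_i$ (resp. $\omega_i^\vee$) be the bases dual to the $\alpha_j^\vee$ (resp. $\alpha_j$), $P=\bigoplus\mathbb Z\omega_i$, $P_-=\bigoplus\mathbb Z_{\le 0}\,\omega_i$, $\rho=\frac12\sum_{\alpha\in R_+}\alpha$, $\check\rho=\frac12\sum_{\alpha\in R_+}\alpha^\vee$. Two settings are considered. Untwisted: the affine roots are $[\alpha,j]$ ($\alpha\in R$, $j\in\mathbb Z$), $\alpha_0=[-\theta,1]$ with $\theta$ the maximal root, $\check\rho^{\epsilon}=\check\rho$, $\omega_r^{\epsilon}=\omega_r^\vee$. Twisted: the affine roots are $[\alpha,\nu_\alpha j]$, $\alpha_0=[-\vartheta,1]$ with $\vartheta$ the maximal short root, $\check\rho^{\epsilon}=\rho$, $\omega_r^{\epsilon}=\omega_r$.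 An affine root $[\alpha,k]$ is positive if $k>0$, or $k=0$ and $\alpha\in R_+$. On $\mathbb R^n\times\mathbb R$ let $w[z,\zeta]=[w(z),\zeta]$ for $w\in W$, $a[z,\zeta]=[z,\zeta-(z,a)]$ for $a\in\mathbb R^n$, and $s_{[\alpha,k]}[z,\zeta]=[z,\zeta]-(z,\alpha^\vee)[\alpha,k]$; write $s_i=s_{\alpha_i}$ for $0\le i\le n$ (with $\alpha_i=[\alpha_i,0]$ for $i>0$). The length $l(g)$ of a transformation $g$ is the number of positive affine roots that $g$ maps to negative ones. For dominant $a$ put $u_a=w_0w_0^a$, where $w_0^a$ is the longest element of the stabilizer of $a$ in $W$, and $\pi_a=a\,u_a^{-1}$. Let $O\subset\{0,\dots,n\}$ be the orbit of $0$ under the automorphisms of the completed Dynkin diagram with vertices $\alpha_0,\dots,\alpha_n$; put $\pi_0=\mathrm{id}$ and $\pi_r=\pi_{\omega_r^{\epsilon}}$ for $0\ne r\in O$. On Laurent polynomials in $X_b$ ($b\in P$, $X_bX_c=X_{b+c}$) whose coefficients are integral combinations of (possibly fractional) powers of $q$, put $X_{[b,\zeta]}=q^\zeta X_b$, $g(X_b)=X_{g(b)}$,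 and define linear operators $\mathbb T^\natural_i$, $0\le i\le n$, by $$\mathbb T^\natural_i(X_b)=\begin{cases}s_i(X_b)+X_b,&(b,\alpha_i)<0,\\ X_b,&(b,\alpha_i)=0,\\ 0,&(b,\alpha_i)>0,\end{cases}$$ where for $i=0$ the vector $\alpha_i$ in the inner product is replaced by $-\theta$ (untwisted) or $-\vartheta$ (twisted). **Theorem 3.1.** In either setting: (i) $u_{\check\rho^\epsilon}=w_0$; the element $\pi_\rho:=\pi_{\check\rho^\epsilon}$ satisfies $\pi_\rho=w_0(\check\rho^\epsilon)^{-1}=\check\rho^\epsilon w_0$ and $l(\pi_\rho)=2(\rho,\check\rho)-\#R_+$. (ii) $\pi_\rho$ has a reduced decomposition $\pi_\rho=\pi_r s_{i_l}\cdots s_{i_1}$ with $r\in O$, $l=l(\pi_\rho)$, and the operator $\mathfrak T:=\mathbb T^\natural_{\pi_\rho}=\pi_r\mathbb T^\natural_{i_l}\cdots\mathbb T^\natural_{i_1}$ does not depend on the choice of such a decomposition. (iii) For every $b\in P_-$, with $M_b=\sum_{c\in W(b)}X_c$, there are integers $e_c\ge 0$ ($c\in W(b)$) such that $$\mathbb E^\dagger_b:=q^{(\check\rho^\epsilon,b)}\,\mathfrak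 T(M_b)=\sum_{c\in W(b)}q^{-e_c}X_c,$$ and $e_c=0$ if and only if $c=b$. -/

import Mathlib

open scoped InnerProductSpace

noncomputable section

namespace ExtDag

/-- The two affine settings: `untwisted` (affine roots `[α, j]`) and `twisted`
(affine roots `[α, ν_α j]`). -/
inductive Setting
  | untwisted
  | twisted

variable {ι V N : Type*} [Fintype ι] [NormedAddCommGroup V] [InnerProductSpace ℝ V]
  [AddCommGroup N] [Module ℝ N]

/-! ### Laurent polynomials -/

/-- The coefficient ring: integral combinations of powers `q ^ ζ`. Real exponents `ζ` are allowed,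
since the elements `π_r` act with fractional powers of `q`; the ring `ℤ[q, q⁻¹]` is the subring
spanned by the powers with `ζ ∈ ℤ`. -/
abbrev Coeff : Type := AddMonoidAlgebra ℤ ℝ

/-- The power `q ^ ζ`. -/
def qPow (ζ : ℝ) : Coeff := AddMonoidAlgebra.single ζ 1

/-- Laurent polynomials in the `X_b` with coefficients in `Coeff`, where `X_b X_c = X_{b+c}`.
All `b ∈ V` are allowed as indices; the Laurent polynomials of the weight lattice `P` form the
subalgebra spanned by the `X_b` with `b ∈ P`. -/
abbrev Laurent (V : Type*) [NormedAddCommGroup V] : Type _ := AddMonoidAlgebra Coeff V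

/-- The monomial `X_b`. -/
def X (b : V) : Laurent V := AddMonoidAlgebra.single b 1

/-- `X_{[b, ζ]} = q ^ ζ X_b`. -/
def XAff (z : V × ℝ) : Laurent V := qPow z.2 • X z.1

/-- The `Coeff`-linear operator with prescribed values `X_b ↦ f b` on the monomials. -/
def ofMonomials (f : V → Laurent V) : Module.End Coeff (Laurent V) :=
  Finsupp.linearCombination Coeff f ∘ₗ
    (AddMonoidAlgebra.coeffLinearEquiv Coeff : Laurent V ≃ₗ[Coeff] (V →₀ Coeff)).toLinearMap

set_option linter.unusedSectionVars false in
theorem ofMonomials_X (f : V → Laurent V) (b : V) : ofMonomials f (X b) = f b := by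
  simp [ofMonomials, X]

/-! ### Affine transformations: the group generated inside `GL (V × ℝ)` -/

/-- `v^∨ = 2 v / (v, v)`. -/
def check (v : V) : V := (2 / ⟪v, v⟫_ℝ) • v

/-- `ν_v = (v, v) / 2`. -/
def nu (v : V) : ℝ := ⟪v, v⟫_ℝ / 2

/-- The group `GL (V × ℝ)` in which the affine Weyl groups are realized. -/
abbrev AffGL (V : Type*) [NormedAddCommGroup V] [InnerProductSpace ℝ V] : Type _ :=
  (V × ℝ) ≃ₗ[ℝ] (V × ℝ)

/-- The reflection `s_{[α, j]}`, which sends `[z, ζ]` to `[z, ζ] - (z, α^∨) [α, j]`. -/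
def affRefl (a : V × ℝ) : AffGL V :=
  LinearEquiv.ofInvolutive
    { toFun := fun z => z - ⟪z.1, check a.1⟫_ℝ • a
      map_add' := fun x y => by
        simp only [Prod.fst_add, inner_add_left, add_smul]; abel
      map_smul' := fun c x => by
        simp only [Prod.smul_fst, inner_smul_left, RingHom.id_apply, smul_sub, mul_smul,
          conj_trivial] } <| by
    intro z
    by_cases h : a.1 = 0
    · simp [check, h]
    · have h2 : ⟪a.1, check a.1⟫_ℝ = 2 := by
        have : ⟪a.1, a.1⟫_ℝ ≠ 0 := inner_self_ne_zero.mpr h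
        rw [check, inner_smul_right]; field_simp
      simp only [LinearMap.coe_mk, AddHom.coe_mk, Prod.fst_sub, Prod.smul_fst, inner_sub_left,
        inner_smul_left, h2, conj_trivial]
      module

theorem affRefl_apply (a z : V × ℝ) : affRefl a z = z - ⟪z.1, check a.1⟫_ℝ • a := rfl

/-- The translation `a`, which sends `[z, ζ]` to `[z, ζ - (z, a)]`. -/
def transl (a : V) : AffGL V where
  toFun z := (z.1, z.2 - ⟪z.1, a⟫_ℝ)
  invFun z := (z.1, z.2 + ⟪z.1, a⟫_ℝ)
  map_add' x y := by ext <;> simp [inner_add_left]; ring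
  map_smul' c x := by ext <;> simp [inner_smul_left]; ring
  left_inv z := by simp
  right_inv z := by simp

/-- The action of `g` on Laurent polynomials: `g (X_b) = X_{g (b)}`. -/
def act (g : AffGL V) : Module.End Coeff (Laurent V) := ofMonomials fun b => XAff (g (b, 0))

/-- The operator `𝕋♮` of an affine root `[α, j]`:
`X_b ↦ s_{[α, j]} (X_b) + X_b`, `X_b`, `0` for `(b, α) < 0`, `= 0`, `> 0` respectively. -/
def tNat (a : V × ℝ) : Module.End Coeff (Laurent V) := ofMonomials fun b =>
  if ⟪b, a.1⟫_ℝ < 0 then act (affRefl a) (X b) + X b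
  else if ⟪b, a.1⟫_ℝ = 0 then X b
  else 0

/-! ### The root system -/

/-- The inner product of `V` is the normalized Euclidean form of the root system `R`: it is
invariant under the reflections, and short roots have square length `2`. -/
structure IsNormalizedForm (R : RootPairing ι ℝ V N) : Prop where
  invariant : ∀ (i : ι) (x y : V), ⟪R.reflection i x, R.reflection i y⟫_ℝ = ⟪x, y⟫_ℝ
  two_le : ∀ i : ι, 2 ≤ ⟪R.root i, R.root i⟫_ℝ
  exists_eq_two : ∃ i : ι, ⟪R.root i, R.root i⟫_ℝ = 2

variable {R : RootPairing ι ℝ V N} (Δ : R.Base) (s : Setting)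

instance finite_weylGroup [R.IsRootSystem] : Finite R.weylGroup := by
  refine Finite.of_injective (fun w : R.weylGroup => (R.weylGroupToPerm w : ι → ι)) ?_
  intro w w' h
  apply Subtype.ext
  apply RootPairing.Equiv.weightHom_injective R
  apply LinearEquiv.toLinearMap_injective
  apply LinearMap.ext_on_range (v := R.root) (by simp)
  intro i
  have h1 := R.weylGroup_apply_root w i
  have h2 := R.weylGroup_apply_root w' i
  have h3 : R.weylGroupToPerm w i = R.weylGroupToPerm w' i := congrFun h i
  rw [h3, ← h2] at h1
  exact h1

theorem finite_orbit [R.IsRootSystem] (b : V) : (MulAction.orbit R.weylGroup b).Finite :=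
  Set.finite_range _

/-- `M_b`, the sum of `X_c` over the orbit `W(b)`. -/
def orbitSum (R : RootPairing ι ℝ V N) [R.IsRootSystem] (b : V) : Laurent V :=
  ∑ c ∈ (finite_orbit (R := R) b).toFinset, X c

/-- An element of the finite Weyl group as a transformation `[z, ζ] ↦ [w(z), ζ]`. -/
def ext (w : R.weylGroup) : AffGL V :=
  (RootPairing.Equiv.weightHom R w.1).prodCongr (LinearEquiv.refl ℝ ℝ)

/-- The cone `Q_+` of nonnegative integral combinations of simple roots. -/
def Qplus : AddSubmonoid V := AddSubmonoid.closure (R.root '' Δ.support)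

open Classical in
/-- `ρ`, the half-sum of positive roots. -/
def rho : V := (1 / 2 : ℝ) • ∑ i with Δ.IsPos i, R.root i

open Classical in
/-- `ρ^∨`, the half-sum of positive coroots. -/
def rhoCheck : V := (1 / 2 : ℝ) • ∑ i with Δ.IsPos i, check (R.root i)

open Classical in
/-- The fundamental coweights: the basis of `V` dual to the simple roots. -/
def fundCoweight [R.IsRootSystem] (r : Δ.support) : V :=
  LinearMap.BilinForm.dualBasis (innerₗ V)
    ⟨fun x hx => inner_self_eq_zero.mp (hx x), fun x hx => inner_self_eq_zero.mp (hx x)⟩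
    Δ.toWeightBasis r

open Classical in
theorem inner_fundCoweight [R.IsRootSystem] (r k : Δ.support) :
    ⟪fundCoweight Δ r, R.root k⟫_ℝ = if k = r then 1 else 0 := by
  have h := LinearMap.BilinForm.apply_dualBasis_left (B := innerₗ V)
    ⟨fun x hx => inner_self_eq_zero.mp (hx x), fun x hx => inner_self_eq_zero.mp (hx x)⟩
    Δ.toWeightBasis r k
  rw [Δ.toWeightBasis_apply] at h
  exact h

/-- The fundamental weights `ω_r = ν_r ω_r^∨`: the basis of `V` dual to the simple coroots. -/
def fundWeight [R.IsRootSystem] (r : Δ.support) : V := nu (R.root r) • fundCoweight Δ r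

open Classical in
theorem inner_fundWeight [R.IsRootSystem] (r k : Δ.support) :
    ⟪fundWeight Δ r, check (R.root k)⟫_ℝ = if k = r then 1 else 0 := by
  have h : ⟪R.root r, R.root r⟫_ℝ ≠ 0 := inner_self_ne_zero.mpr (R.ne_zero r)
  simp only [fundWeight, check, nu, inner_smul_left, inner_smul_right, inner_fundCoweight,
    conj_trivial]
  split_ifs with hk
  · subst hk; field_simp
  · simp

/-- The antidominant weights `P_-`: nonpositive integral combinations of fundamental weights. -/
def Pminus [R.IsRootSystem] : AddSubmonoid V :=
  AddSubmonoid.closure (Set.range fun r => -fundWeight Δ r)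

/-! ### The finite Weyl group -/

/-- The length of `w`: the number of positive roots which `w` makes negative. -/
def finLength (w : R.weylGroup) : ℕ :=
  Nat.card {i : ι // Δ.IsPos i ∧ ¬ Δ.IsPos (R.weylGroupToPerm w i)}

/-- The longest element of a subgroup `H` of the Weyl group. -/
def longest (H : Subgroup R.weylGroup) : R.weylGroup :=
  Classical.epsilon fun w => w ∈ H ∧ ∀ v ∈ H, finLength Δ v ≤ finLength Δ w

/-- `w_0`. -/
def w0 : R.weylGroup := longest Δ ⊤

/-- `u_a = w_0 w_0^a`, where `w_0^a` is the longest element of the stabilizer of `a`. -/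
def u (a : V) : R.weylGroup := w0 Δ * longest Δ (MulAction.stabilizer R.weylGroup a)

/-- `π_a = a (u_a)⁻¹`. -/
def piElt (a : V) : AffGL V := transl a * (ext (u Δ a))⁻¹

/-! ### The affine root system -/

/-- `ρ^∨` in the untwisted setting and `ρ` in the twisted setting. -/
def rhoEps : V :=
  match s with
  | .untwisted => rhoCheck Δ
  | .twisted => rho Δ

/-- The maximal root `θ` in the untwisted setting and the maximal short root `ϑ` in the
twisted setting. -/
def theta : V :=
  match s with
  | .untwisted => Classical.epsilon fun v =>
      v ∈ Set.range R.root ∧ ∀ j, v - R.root j ∈ Qplus Δ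
  | .twisted => Classical.epsilon fun v =>
      (v ∈ Set.range R.root ∧ ⟪v, v⟫_ℝ = 2) ∧
        ∀ j, ⟪R.root j, R.root j⟫_ℝ = 2 → v - R.root j ∈ Qplus Δ

/-- The simple affine roots: `α_0 = [-θ, 1]` or `[-ϑ, 1]` (index `none`) and `α_i = [α_i, 0]`. -/
def simpleAff : Option Δ.support → V × ℝ
  | none => (-theta Δ s, 1)
  | some i => (R.root i, 0)

/-- The positive affine roots: `[α, j]` (untwisted) or `[α, ν_α j]` (twisted), where `j ∈ ℤ` and
either `j > 0`, or `j = 0` and `α > 0`. -/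
def posAff : Set (V × ℝ) :=
  {x | ∃ (i : ι) (j : ℤ), (0 < j ∨ (j = 0 ∧ Δ.IsPos i)) ∧
    x = match s with
      | .untwisted => (R.root i, (j : ℝ))
      | .twisted => (R.root i, nu (R.root i) * j)}

/-- The length of `g`: the number of positive affine roots which `g` makes negative. -/
def affLength (g : AffGL V) : ℕ := {x | x ∈ posAff Δ s ∧ -(g x) ∈ posAff Δ s}.ncard

/-- The orbit `O` of the zeroth vertex under the automorphisms of the completed Dynkin diagram,
i.e. under the permutations of the vertices preserving the integers `(α_i, α_j^∨)`. -/
def diagramOrbit : Set (Option Δ.support) :=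
  {r | ∃ σ : Equiv.Perm (Option Δ.support), σ none = r ∧ ∀ i j,
    ⟪(simpleAff Δ s (σ i)).1, check (simpleAff Δ s (σ j)).1⟫_ℝ =
      ⟪(simpleAff Δ s i).1, check (simpleAff Δ s j).1⟫_ℝ}

/-- `π_0 = id`, and `π_r` is `π_a` for the fundamental coweight (untwisted) or the
fundamental weight (twisted) `a` with index `r`. -/
def piZero [R.IsRootSystem] : Option Δ.support → AffGL V
  | none => 1
  | some r =>
    match s with
    | .untwisted => piElt Δ (fundCoweight Δ r)
    | .twisted => piElt Δ (fundWeight Δ r)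

/-- `g = π_r s_{i_l} ⋯ s_{i_1}` is a reduced decomposition, where `L = [i_l, …, i_1]`:
`r ∈ O` and `l` is the length of `g`. -/
def IsReducedDecomp [R.IsRootSystem] (g : AffGL V) (r : Option Δ.support)
    (L : List (Option Δ.support)) : Prop :=
  r ∈ diagramOrbit Δ s ∧
    g = piZero Δ s r * (L.map fun i => affRefl (simpleAff Δ s i)).prod ∧
    L.length = affLength Δ s g

/-- The operator `π_r 𝕋♮_{i_l} ⋯ 𝕋♮_{i_1}`, where `L = [i_l, …, i_1]`. -/
def tWord [R.IsRootSystem] (r : Option Δ.support) (L : List (Option Δ.support)) :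
    Module.End Coeff (Laurent V) :=
  act (piZero Δ s r) * (L.map fun i => tNat (simpleAff Δ s i)).prod

/-- `𝕋♮_g`: the operator `tWord` of a reduced decomposition of `g`. -/
def tOf [R.IsRootSystem] (g : AffGL V) : Module.End Coeff (Laurent V) :=
  Classical.epsilon fun T => ∃ r L, IsReducedDecomp Δ s g r L ∧ T = tWord Δ s r L

/-- `π_ρ`, i.e. `π_a` for `a = ρ^∨` (untwisted) or `a = ρ` (twisted). -/
def piRho : AffGL V := piElt Δ (rhoEps Δ s)

/-- `𝔗 = 𝕋♮_{π_ρ}`. -/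
def frakT [R.IsRootSystem] : Module.End Coeff (Laurent V) := tOf Δ s (piRho Δ s)

/-- The extremal dag-polynomial: `q ^ (a, b) 𝔗(M_b)` with `a = ρ^∨` (untwisted) or
`a = ρ` (twisted). -/
def extremalDag [R.IsRootSystem] (b : V) : Laurent V :=
  qPow ⟪rhoEps Δ s, b⟫_ℝ • frakT Δ s (orbitSum R b)

end ExtDag

end

set_option linter.unusedSectionVars false

noncomputable section

namespace ExtDag

variable {ι V N : Type*} [Fintype ι] [NormedAddCommGroup V] [InnerProductSpace ℝ V]
  [AddCommGroup N] [Module ℝ N] {R : RootPairing ι ℝ V N}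

/-! ### Roots, coroots and the invariant form -/

/-! Passing to the transpose turns operators on Laurent polynomials into maps of points. Let `ev` at
[c, ζ] be q^{-ζ} times the coefficient of X_c. The operator 𝕋♮ of an affine root a is then the
transpose of the folding `phi a`, which reflects a point with positive pairing across the wall of a
and fixes all others (`ev_tNat`). A word in the operators acts as a composite Φ of foldings. Hence,
for c in W(b), the coefficient of X_c in 𝔗(M_b) is a single power q^{-ζ}, where Φ([c, 0]) = [c', ζ]
and c' lies again in W(b).

Elements of the extended group are stripped of simple affine reflections until the length is zero;
what remains is some π_r (`exists_eq_piZero`). Conversely π_r has length zero for r in O, because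
such r are minuscule (`inner_rt_theta_omegaEps`). Independence of the reduced decomposition is
Matsumoto's argument, run on the values of Φ (`IsValue.unique`) and resting on the braid relations
for foldings (`alt_phi_comm`).

For the exponents, Φ(z) is reached from g⁻¹(z) by successive reflections in inversions of g that are
positive at the current point (`reflTransGen_step_phiWord`). The inversions of π_ρ have finite part
-α with α positive, and their levels lie strictly between 0 and (α, ρ^ε). This strictness makes ζ +
(c', ρ^ε) increase at every step (`eq_or_lt_of_reflTransGen`). The path starts at [w_0 c, (c, ρ^ε)],
where this quantity is 0, so ζ ≥ -(c', ρ^ε) ≥ (b, ρ^ε). Equality leaves room for no step and forces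
w_0 c = w_0 b; conversely, no step can leave the dominant vector w_0 b.

Both settings are handled together: `rt` is α or α^∨, and levels are counted in units of `lv`, which
is 1 or ν_α. -/

theorem check_smul (c : ℝ) (v : V) : check (c • v) = c⁻¹ • check v := by
  rcases eq_or_ne c 0 with rfl | hc
  · simp [check]
  · simp only [check, inner_smul_left, inner_smul_right, conj_trivial, smul_smul]
    congr 1
    rcases eq_or_ne ‖v‖ 0 with h | h
    · simp [h]
    · simp only [real_inner_self_eq_norm_sq]; field_simp

theorem check_check (v : V) : check (check v) = v := by
  rcases eq_or_ne v 0 with rfl | hv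
  · simp [check]
  · have : ⟪v, v⟫_ℝ ≠ 0 := inner_self_ne_zero.mpr hv
    rw [show check v = (2 / ⟪v, v⟫_ℝ) • v from rfl, check_smul, check, smul_smul]
    convert! one_smul ℝ v
    field_simp

theorem inner_self_check {v : V} (hv : v ≠ 0) : ⟪v, check v⟫_ℝ = 2 := by
  have : ⟪v, v⟫_ℝ ≠ 0 := inner_self_ne_zero.mpr hv
  rw [check, inner_smul_right]; field_simp

theorem check_neg (v : V) : check (-v) = -check v := by
  simp [check]

/-- The normalized form as an invariant form of the root pairing. -/
def IsNormalizedForm.invariantForm (hR : IsNormalizedForm R) : R.InvariantForm where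
  form := innerₗ V
  symm := ⟨fun x y => by simp [real_inner_comm]⟩
  ne_zero i := by simpa using R.ne_zero i
  isOrthogonal_reflection i x y := hR.invariant i x y

theorem inner_root_root_pos (R : RootPairing ι ℝ V N) (i : ι) : 0 < ⟪R.root i, R.root i⟫_ℝ :=
  real_inner_self_pos.mpr (R.ne_zero i)

/-- The reflection negates its own root, so invariance of the form on the pair (x, α) determines the
coroot. From here on every abstract pairing is an inner product. -/
theorem coroot'_eq_inner (hR : IsNormalizedForm R) (x : V) (i : ι) :
    R.coroot' i x = ⟪x, check (R.root i)⟫_ℝ := by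
  have h := hR.invariant i x (R.root i)
  rw [R.reflection_apply_self, R.reflection_apply] at h
  have h2 := (inner_root_root_pos R i).ne'
  simp only [inner_neg_right, inner_sub_left, inner_smul_left, conj_trivial] at h
  rw [check, inner_smul_right]
  field_simp
  linarith

theorem reflection_apply_inner (hR : IsNormalizedForm R) (x : V) (i : ι) :
    R.reflection i x = x - ⟪x, check (R.root i)⟫_ℝ • R.root i := by
  rw [R.reflection_apply, coroot'_eq_inner hR]

theorem pairing_eq_inner (hR : IsNormalizedForm R) (i j : ι) :
    R.pairing i j = ⟪R.root i, check (R.root j)⟫_ℝ := by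
  rw [← coroot'_eq_inner hR, R.root_coroot'_eq_pairing]

theorem exists_int_inner_check [R.IsCrystallographic] (hR : IsNormalizedForm R) (i j : ι) :
    ∃ n : ℤ, ⟪R.root i, check (R.root j)⟫_ℝ = n := by
  obtain ⟨n, hn⟩ := R.exists_value (S := ℤ) i j
  exact ⟨n, by rw [← pairing_eq_inner hR, ← hn]; simp⟩

theorem inner_weyl (hR : IsNormalizedForm R) (w : R.weylGroup) (x y : V) :
    ⟪w • x, w • y⟫_ℝ = ⟪x, y⟫_ℝ :=
  RootPairing.InvariantForm.apply_weylGroup_smul (P := R) (B := hR.invariantForm) w x y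

theorem inner_weyl_left (hR : IsNormalizedForm R) (w : R.weylGroup) (x y : V) :
    ⟪w • x, y⟫_ℝ = ⟪x, w⁻¹ • y⟫_ℝ := by
  rw [← inner_weyl hR w x, smul_inv_smul]

theorem inner_weyl_right (hR : IsNormalizedForm R) (w : R.weylGroup) (x y : V) :
    ⟪x, w • y⟫_ℝ = ⟪w⁻¹ • x, y⟫_ℝ := by
  rw [← inner_weyl hR w _ y, smul_inv_smul]

theorem check_weyl (hR : IsNormalizedForm R) (w : R.weylGroup) (x : V) :
    check (w • x) = w • check x := by
  rw [check, check, inner_weyl hR]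
  exact (smul_comm w.1 _ x).symm

/-- The reflection in the `i`-th root as an element of the Weyl group. -/
abbrev refl (R : RootPairing ι ℝ V N) (i : ι) : R.weylGroup := RootPairing.weylGroup.ofIdx R i

theorem refl_smul (hR : IsNormalizedForm R) (i : ι) (x : V) :
    refl R i • x = x - ⟪x, check (R.root i)⟫_ℝ • R.root i :=
  reflection_apply_inner hR x i

/-- The action of the Weyl group on the indices of the roots. -/
abbrev perm (w : R.weylGroup) (i : ι) : ι := R.weylGroupToPerm w i

theorem root_perm (w : R.weylGroup) (i : ι) : R.root (perm w i) = w • R.root i :=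
  (R.weylGroup_apply_root w i).symm

theorem perm_mul (w v : R.weylGroup) (i : ι) : perm (w * v) i = perm w (perm v i) := by
  simp [perm]

theorem perm_one (i : ι) : perm (1 : R.weylGroup) i = i := by
  simp [perm]

theorem perm_inv_perm (w : R.weylGroup) (i : ι) : perm w⁻¹ (perm w i) = i := by
  rw [← perm_mul, inv_mul_cancel, perm_one]

theorem perm_perm_inv (w : R.weylGroup) (i : ι) : perm w (perm w⁻¹ i) = i := by
  rw [← perm_mul, mul_inv_cancel, perm_one]

theorem perm_refl (i j : ι) : perm (refl R i) j = R.reflectionPerm i j := rfl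

theorem refl_mul_self (i : ι) : refl R i * refl R i = 1 := by
  apply Subtype.ext
  change RootPairing.Equiv.reflection R i * RootPairing.Equiv.reflection R i = 1
  rw [mul_eq_one_iff_inv_eq, RootPairing.Equiv.reflection_inv]

theorem refl_inv (i : ι) : (refl R i)⁻¹ = refl R i :=
  inv_eq_of_mul_eq_one_left (refl_mul_self i)

theorem weyl_ext [R.IsRootSystem] {w v : R.weylGroup} (h : ∀ x : V, w • x = v • x) : w = v := by
  apply Subtype.ext
  apply RootPairing.Equiv.weightHom_injective R
  ext x
  exact h x

theorem conj_refl [R.IsRootSystem] (hR : IsNormalizedForm R) (w : R.weylGroup) (i : ι) :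
    w * refl R i * w⁻¹ = refl R (perm w i) := by
  apply weyl_ext
  intro x
  rw [mul_smul, mul_smul, refl_smul hR, refl_smul hR, root_perm, check_weyl hR,
    inner_weyl_right hR, smul_sub, smul_inv_smul]
  congr 1
  exact smul_comm w.1 _ _

/-- The index of the negative of a root. -/
abbrev negIdx (R : RootPairing ι ℝ V N) (i : ι) : ι := R.reflectionPerm i i

theorem root_negIdx (i : ι) : R.root (negIdx R i) = -R.root i := by
  rw [negIdx, R.root_reflectionPerm, R.reflection_apply_self]

theorem negIdx_negIdx (i : ι) : negIdx R (negIdx R i) = i :=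
  R.root.injective (by rw [root_negIdx, root_negIdx, neg_neg])

theorem perm_negIdx (w : R.weylGroup) (i : ι) : perm w (negIdx R i) = negIdx R (perm w i) :=
  R.root.injective (by rw [root_perm, root_negIdx, root_negIdx, root_perm, smul_neg])

theorem refl_negIdx [R.IsRootSystem] (hR : IsNormalizedForm R) (i : ι) :
    refl R (negIdx R i) = refl R i := by
  apply weyl_ext
  intro x
  rw [refl_smul hR, refl_smul hR, root_negIdx, check_neg, inner_neg_right, neg_smul_neg]

/-! ### Positive roots and dominant vectors. -/

variable (Δ : R.Base)

theorem isPos_negIdx (i : ι) : Δ.IsPos (negIdx R i) ↔ ¬ Δ.IsPos i :=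
  RootPairing.Base.IsPos.neg_iff_not Δ i

theorem isPos_support (r : Δ.support) : Δ.IsPos r :=
  RootPairing.Base.isPos_of_mem_support r.2

theorem exists_nat_coeff {i : ι} (hi : Δ.IsPos i) :
    ∃ f : ι → ℕ, R.root i = ∑ j ∈ Δ.support, f j • R.root j := by
  obtain ⟨f, -, h | h⟩ := Δ.exists_root_eq_sum_nat_or_neg i
  · exact ⟨f, h⟩
  · exfalso
    have h' : R.root i = ∑ j ∈ Δ.support, (-(f j : ℤ)) • R.root j := by
      rw [h]; simp
    rw [RootPairing.Base.isPos_iff, RootPairing.Base.height_eq_sum h'] at hi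
    have : 0 ≤ ∑ j ∈ Δ.support, (f j : ℤ) := Finset.sum_nonneg fun _ _ => by positivity
    simp only [Finset.sum_neg_distrib] at hi
    linarith

theorem root_mem_Qplus {i : ι} (hi : Δ.IsPos i) : R.root i ∈ Qplus Δ := by
  obtain ⟨f, hf⟩ := exists_nat_coeff Δ hi
  rw [hf]
  exact AddSubmonoid.sum_mem _ fun j hj =>
    nsmul_mem (AddSubmonoid.subset_closure ⟨j, hj, rfl⟩ : R.root j ∈ Qplus Δ) _

/-- `x` is dominant. -/
def Dominant (x : V) : Prop := ∀ r : Δ.support, 0 ≤ ⟪R.root r, x⟫_ℝ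

/-- `x` is strictly dominant. -/
def StrictlyDominant (x : V) : Prop := ∀ r : Δ.support, 0 < ⟪R.root r, x⟫_ℝ

variable {Δ}

theorem StrictlyDominant.dominant {x : V} (hx : StrictlyDominant Δ x) : Dominant Δ x :=
  fun r => (hx r).le

theorem Dominant.inner_nonneg {x y : V} (hx : Dominant Δ x) (hy : y ∈ Qplus Δ) :
    0 ≤ ⟪y, x⟫_ℝ := by
  induction hy using AddSubmonoid.closure_induction with
  | mem y h => obtain ⟨j, hj, rfl⟩ := h; exact hx ⟨j, hj⟩
  | zero => simp
  | add y z _ _ h1 h2 => rw [inner_add_left]; positivity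

theorem Dominant.inner_root_nonneg {x : V} (hx : Dominant Δ x) {i : ι} (hi : Δ.IsPos i) :
    0 ≤ ⟪R.root i, x⟫_ℝ :=
  hx.inner_nonneg (root_mem_Qplus Δ hi)

theorem StrictlyDominant.inner_root_pos {x : V} (hx : StrictlyDominant Δ x) {i : ι}
    (hi : Δ.IsPos i) : 0 < ⟪R.root i, x⟫_ℝ := by
  obtain ⟨f, hf⟩ := exists_nat_coeff Δ hi
  have h0 : ∃ j ∈ Δ.support, f j ≠ 0 := by
    by_contra! h
    exact R.ne_zero i (by rw [hf]; exact Finset.sum_eq_zero fun j hj => by simp [h j hj])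
  obtain ⟨j, hj, hj0⟩ := h0
  rw [hf, sum_inner]
  refine Finset.sum_pos' (fun k hk => ?_) ⟨j, hj, ?_⟩
  · rw [← Nat.cast_smul_eq_nsmul ℝ, inner_smul_left]
    exact mul_nonneg (by simp) (hx ⟨k, hk⟩).le
  · rw [← Nat.cast_smul_eq_nsmul ℝ, inner_smul_left]
    exact mul_pos (by simpa using Nat.pos_of_ne_zero hj0) (hx ⟨j, hj⟩)

theorem StrictlyDominant.isPos_iff {x : V} (hx : StrictlyDominant Δ x) (i : ι) :
    Δ.IsPos i ↔ 0 < ⟪R.root i, x⟫_ℝ := by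
  refine ⟨fun h => hx.inner_root_pos h, fun h => ?_⟩
  by_contra h'
  rw [← isPos_negIdx] at h'
  have := hx.inner_root_pos h'
  rw [root_negIdx, inner_neg_left] at this
  linarith

end ExtDag

namespace ExtDag

variable {ι V N : Type*} [Fintype ι] [NormedAddCommGroup V] [InnerProductSpace ℝ V]
  [AddCommGroup N] [Module ℝ N] {R : RootPairing ι ℝ V N} {Δ : R.Base}

/-! ### The finite Weyl group -/

theorem weyl_smul_comm (w : R.weylGroup) (c : ℝ) (x : V) : w • c • x = c • w • x :=
  smul_comm w.1 c x

section

variable [R.IsRootSystem] [R.IsCrystallographic] [R.IsReduced] (hR : IsNormalizedForm R)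

include hR

theorem isPos_perm_refl {r : Δ.support} {i : ι} (hi : Δ.IsPos i) (h : i ≠ r) :
    Δ.IsPos (perm (refl R r) i) :=
  hi.reflectionPerm r.2 h

/-- Every root is obtained from simple ones by simple reflections and sign changes, and conjugation
carries this over to reflections. -/
theorem exists_list_refl (w : R.weylGroup) :
    ∃ L : List Δ.support, w = (L.map fun r : Δ.support => refl R (r : ι)).prod := by
  have key : ∀ i : ι, ∃ L : List Δ.support, refl R i = (L.map fun r : Δ.support => refl R (r : ι)).prod := by
    intro i
    refine RootPairing.Base.induction_reflect (b := Δ) i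
      (p := fun i => ∃ L : List Δ.support,
        refl R i = (L.map fun r : Δ.support => refl R (r : ι)).prod)
      (fun i h => ?_) (fun i hi => ⟨[⟨i, hi⟩], by simp⟩) ?_
    · rwa [show R.reflectionPerm i i = negIdx R i from rfl, refl_negIdx hR]
    · rintro i j ⟨L, hL⟩ hj
      refine ⟨⟨j, hj⟩ :: (L ++ [⟨j, hj⟩]), ?_⟩
      have := conj_refl hR (refl R j) i
      rw [refl_inv] at this
      rw [← perm_refl, ← this, hL]
      simp [mul_assoc]
  obtain ⟨w, hw⟩ := w
  induction hw using RootPairing.weylGroup.induction with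
  | mem i => exact key i
  | one => exact ⟨[], rfl⟩
  | mul x y hx hy h1 h2 =>
    obtain ⟨L1, h1⟩ := h1
    obtain ⟨L2, h2⟩ := h2
    refine ⟨L1 ++ L2, ?_⟩
    rw [List.map_append, List.prod_append, ← h1, ← h2]
    rfl

/-- Exchange condition. Follow the simple root through the word, from the right, to the letter that
first makes it negative. A simple reflection does this only to its own root, so conjugation lets
this letter be deleted. -/
theorem exists_shorter_list (L : List Δ.support) (r : Δ.support)
    (h : ¬ Δ.IsPos (perm (L.map fun r : Δ.support => refl R (r : ι)).prod r)) :
    ∃ L' : List Δ.support, L'.length + 1 = L.length ∧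
      (L'.map fun r : Δ.support => refl R (r : ι)).prod = (L.map fun r : Δ.support => refl R (r : ι)).prod * refl R r := by
  induction L with
  | nil => simp only [List.map_nil, List.prod_nil, perm_one] at h; exact absurd (isPos_support Δ r) h
  | cons i L ih =>
    simp only [List.map_cons, List.prod_cons] at h ⊢
    by_cases h' : Δ.IsPos (perm (L.map fun r : Δ.support => refl R (r : ι)).prod r)
    · refine ⟨L, rfl, ?_⟩
      rw [perm_mul] at h
      have : perm (L.map fun r : Δ.support => refl R (r : ι)).prod r = i := by
        by_contra hne
        exact h (isPos_perm_refl hR h' hne)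
      rw [← this, ← conj_refl hR]
      simp [mul_assoc, refl_mul_self]
    · obtain ⟨L', h1, h2⟩ := ih h'
      exact ⟨i :: L', by simp [h1], by rw [List.map_cons, List.prod_cons, h2, mul_assoc]⟩

/-- Descent on the length of a word: the word without its last letter r makes the simple root r
negative, so the exchange condition gives a shorter word for the same element. -/
theorem weyl_eq_one {w : R.weylGroup} (h : ∀ r : Δ.support, Δ.IsPos (perm w r)) : w = 1 := by
  obtain ⟨L, hL⟩ := exists_list_refl (Δ := Δ) hR w
  induction hn : L.length using Nat.strong_induction_on generalizing L with
  | _ n ih =>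
    rcases List.eq_nil_or_concat' L with rfl | ⟨L1, r, rfl⟩
    · simpa using hL
    · have hw : w = (L1.map fun r : Δ.support => refl R (r : ι)).prod * refl R r := by simpa using hL
      have h1 : (L1.map fun r : Δ.support => refl R (r : ι)).prod = w * refl R r := by
        rw [hw, mul_assoc, refl_mul_self, mul_one]
      have h2 : ¬ Δ.IsPos (perm (L1.map fun r : Δ.support => refl R (r : ι)).prod r) := by
        rw [h1, perm_mul, perm_refl, show R.reflectionPerm (r : ι) r = negIdx R (r : ι) from rfl,
          perm_negIdx, isPos_negIdx, not_not]
        exact h r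
      obtain ⟨L', h3, h4⟩ := exists_shorter_list hR L1 r h2
      rw [← hw] at h4
      exact ih L'.length (by simp at hn; omega) L' h4.symm rfl

/-- The simple reflection permutes the positive roots other than its own; it therefore carries the
old inversions to new ones, and its own root is added. -/
theorem finLength_mul_refl {w : R.weylGroup} {r : Δ.support} (h : Δ.IsPos (perm w r)) :
    finLength Δ (w * refl R r) = finLength Δ w + 1 := by
  classical
  have hneg : ∀ v : R.weylGroup, perm (v * refl R r) r = negIdx R (perm v r) := fun v => by
    rw [perm_mul, perm_refl, show R.reflectionPerm (r : ι) r = negIdx R (r : ι) from rfl,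
      perm_negIdx]
  have hinj : Function.Injective (perm (refl R (r : ι))) := (R.weylGroupToPerm _).injective
  have hrr : ∀ i, perm (refl R (r : ι)) (perm (refl R (r : ι)) i) = i := fun i => by
    rw [← perm_mul, refl_mul_self, perm_one]
  have hset : ({i | Δ.IsPos i ∧ ¬ Δ.IsPos (perm (w * refl R r) i)} : Set ι) =
      insert (r : ι) (perm (refl R (r : ι)) '' {i | Δ.IsPos i ∧ ¬ Δ.IsPos (perm w i)}) := by
    ext i
    simp only [Set.mem_insert_iff, Set.mem_image, Set.mem_ofPred_eq]
    constructor
    · rintro ⟨h1, h2⟩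
      by_cases hi : i = r
      · exact Or.inl hi
      · refine Or.inr ⟨perm (refl R r) i, ⟨isPos_perm_refl hR h1 hi, ?_⟩, hrr i⟩
        rwa [← perm_mul]
    · rintro (rfl | ⟨j, ⟨h1, h2⟩, rfl⟩)
      · refine ⟨isPos_support Δ r, ?_⟩
        rw [hneg, isPos_negIdx, not_not]; exact h
      · have hj : j ≠ r := by rintro rfl; exact h2 h
        refine ⟨isPos_perm_refl hR h1 hj, ?_⟩
        rwa [perm_mul, hrr]
  have hnm : (r : ι) ∉ perm (refl R (r : ι)) '' {i | Δ.IsPos i ∧ ¬ Δ.IsPos (perm w i)} := by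
    rintro ⟨j, ⟨h1, h2⟩, h3⟩
    have hj : j ≠ r := by rintro rfl; exact h2 h
    have : j = negIdx R (r : ι) := by
      rw [← hrr j, h3]; rfl
    rw [this, isPos_negIdx] at h1
    exact h1 (isPos_support Δ r)
  change Set.ncard {i | Δ.IsPos i ∧ ¬ Δ.IsPos (perm (w * refl R r) i)} =
    Set.ncard {i | Δ.IsPos i ∧ ¬ Δ.IsPos (perm w i)} + 1
  rw [hset, Set.ncard_insert_of_notMem hnm (Set.toFinite _), Set.ncard_image_of_injective _ hinj]

/-- Induction over the Weyl group along right multiplication by ascending simple reflections. -/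
theorem weyl_induction {p : R.weylGroup → Prop} (h1 : p 1)
    (h2 : ∀ (w : R.weylGroup) (r : Δ.support), Δ.IsPos (perm w r) → p w → p (w * refl R r))
    (w : R.weylGroup) : p w := by
  induction hn : finLength Δ w using Nat.strong_induction_on generalizing w with
  | _ n ih =>
    by_cases h : ∀ r : Δ.support, Δ.IsPos (perm w r)
    · rwa [weyl_eq_one hR h]
    · push Not at h
      obtain ⟨r, hr⟩ := h
      have h3 : Δ.IsPos (perm (w * refl R r) r) := by
        rw [perm_mul, perm_refl, show R.reflectionPerm (r : ι) r = negIdx R (r : ι) from rfl,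
          perm_negIdx, isPos_negIdx]
        exact hr
      have h4 := finLength_mul_refl hR h3
      have h5 : w * refl R (r : ι) * refl R (r : ι) = w := by rw [mul_assoc, refl_mul_self, mul_one]
      rw [h5] at h4
      rw [← h5]
      exact h2 _ r h3 (ih _ (by omega) _ rfl)

theorem Dominant.inner_check_nonneg {x : V} (hx : Dominant Δ x) (r : Δ.support) :
    0 ≤ ⟪x, check (R.root r)⟫_ℝ := by
  rw [check, inner_smul_right, real_inner_comm (R.root r) x]
  exact mul_nonneg (div_nonneg (by norm_num) (inner_root_root_pos R _).le) (hx r)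

/-- Each ascending step subtracts from the vector a nonnegative multiple of a positive root. -/
theorem Dominant.inner_smul_le {x y : V} (hx : Dominant Δ x) (hy : Dominant Δ y)
    (w : R.weylGroup) : ⟪w • x, y⟫_ℝ ≤ ⟪x, y⟫_ℝ := by
  induction w using weyl_induction (Δ := Δ) hR with
  | h1 => simp
  | h2 w r hr ih =>
    rw [mul_smul, refl_smul hR, smul_sub, inner_sub_left, weyl_smul_comm, ← root_perm, inner_smul_left, conj_trivial]
    have := mul_nonneg (hx.inner_check_nonneg hR r) (hy.inner_root_nonneg hr)
    linarith

/-- The multiples subtracted in `Dominant.inner_smul_le` must all vanish, since a strictly dominant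
vector is positive on every positive root. -/
theorem Dominant.smul_eq_of_inner_eq {x y : V} (hx : Dominant Δ x) (hy : StrictlyDominant Δ y)
    (w : R.weylGroup) (h : ⟪w • x, y⟫_ℝ = ⟪x, y⟫_ℝ) : w • x = x := by
  induction w using weyl_induction (Δ := Δ) hR with
  | h1 => simp
  | h2 w r hr ih =>
    have h3 : (w * refl R (r : ι)) • x =
        w • x - ⟪x, check (R.root r)⟫_ℝ • R.root (perm w r) := by
      rw [mul_smul, refl_smul hR, smul_sub, root_perm, weyl_smul_comm]
    rw [h3, inner_sub_left, inner_smul_left, conj_trivial] at h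
    have h4 := hx.inner_check_nonneg hR r
    have h5 := hy.inner_root_pos hr
    have h6 := hx.inner_smul_le hR hy.dominant w
    have h7 : ⟪x, check (R.root r)⟫_ℝ = 0 := by
      by_contra hne
      have := mul_pos (lt_of_le_of_ne h4 (Ne.symm hne)) h5
      linarith
    rw [h7, zero_mul, sub_zero] at h
    rw [h3, h7, zero_smul, sub_zero, ih h]

/-! ### Longest elements. -/

theorem longest_spec (H : Subgroup R.weylGroup) :
    longest Δ H ∈ H ∧ ∀ v ∈ H, finLength Δ v ≤ finLength Δ (longest Δ H) := by
  refine Classical.epsilon_spec (p := fun w : R.weylGroup => w ∈ H ∧ ∀ v ∈ H, finLength Δ v ≤ finLength Δ w) ?_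
  obtain ⟨w, hw, h⟩ := Set.exists_max_image (H : Set R.weylGroup) (finLength Δ) (Set.toFinite _)
    ⟨1, H.one_mem⟩
  exact ⟨w, hw, h⟩

/-- The longest element of the stabilizer of a dominant `a` makes negative all positive roots
orthogonal to `a`. -/
theorem not_isPos_longest {a : V} (ha : Dominant Δ a) {i : ι} (hi : Δ.IsPos i)
    (h : ⟪R.root i, a⟫_ℝ = 0) :
    ¬ Δ.IsPos (perm (longest Δ (MulAction.stabilizer R.weylGroup a)) i) := by
  set H := MulAction.stabilizer R.weylGroup a
  obtain ⟨h1, h2⟩ := longest_spec hR (Δ := Δ) H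
  set w := longest Δ H
  -- Otherwise multiplying by the simple reflection r would give a longer element of the stabilizer.
  have key : ∀ r : Δ.support, ⟪R.root r, a⟫_ℝ = 0 → ¬ Δ.IsPos (perm w r) := by
    intro r hr hp
    have h3 : w * refl R (r : ι) ∈ H := by
      refine H.mul_mem h1 ?_
      rw [MulAction.mem_stabilizer_iff, refl_smul hR, check, inner_smul_right, real_inner_comm (R.root r) a, hr]
      simp
    have := h2 _ h3
    rw [finLength_mul_refl hR hp] at this
    omega
  obtain ⟨f, hf⟩ := exists_nat_coeff Δ hi
  -- Since a is dominant, a positive root orthogonal to it involves only simple roots orthogonal to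
  -- it.
  have hz : ∀ j ∈ Δ.support, (f j : ℝ) * ⟪R.root j, a⟫_ℝ = 0 := by
    rw [hf, sum_inner] at h
    simp only [← Nat.cast_smul_eq_nsmul ℝ, inner_smul_left, conj_trivial] at h
    exact (Finset.sum_eq_zero_iff_of_nonneg fun j hj =>
      mul_nonneg (Nat.cast_nonneg _) (ha ⟨j, hj⟩)).mp h
  intro hp
  have hmem := root_mem_Qplus Δ hp
  have hneg : -R.root (perm w i) ∈ Qplus Δ := by
    rw [root_perm, hf, Finset.smul_sum, ← Finset.sum_neg_distrib]
    refine AddSubmonoid.sum_mem _ fun j hj => ?_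
    rcases mul_eq_zero.mp (hz j hj) with h0 | h0
    · have : f j = 0 := by exact_mod_cast h0
      simp [this]
    · have := key ⟨j, hj⟩ h0
      rw [← isPos_negIdx] at this
      have := root_mem_Qplus Δ this
      rw [root_negIdx, root_perm] at this
      rw [← Nat.cast_smul_eq_nsmul ℝ, weyl_smul_comm, ← smul_neg, Nat.cast_smul_eq_nsmul ℝ]
      exact nsmul_mem this _
  have hx : ∃ x : V, StrictlyDominant Δ x := by
    classical
    refine ⟨∑ r, fundCoweight Δ r, fun r => ?_⟩
    rw [inner_sum]
    simp only [real_inner_comm, inner_fundCoweight]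
    simp
  obtain ⟨x, hx⟩ := hx
  have e1 := hx.inner_root_pos hp
  have e2 := hx.dominant.inner_nonneg hneg
  rw [inner_neg_left] at e2
  linarith

theorem not_isPos_w0 {i : ι} (hi : Δ.IsPos i) : ¬ Δ.IsPos (perm (w0 Δ) i) := by
  have h : MulAction.stabilizer R.weylGroup (0 : V) = ⊤ := by
    ext w; simp
  rw [w0, ← h]
  exact not_isPos_longest hR (fun r => by simp) hi (by simp)

theorem isPos_w0_iff (i : ι) : Δ.IsPos (perm (w0 Δ) i) ↔ ¬ Δ.IsPos i := by
  refine ⟨fun h h' => not_isPos_w0 hR h' h, fun h => ?_⟩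
  rw [← isPos_negIdx] at h
  have := not_isPos_w0 hR h
  rwa [perm_negIdx, isPos_negIdx, not_not] at this

theorem eq_of_isPos_iff {w v : R.weylGroup}
    (h : ∀ i, Δ.IsPos (perm w i) ↔ Δ.IsPos (perm v i)) : w = v := by
  have : w * v⁻¹ = 1 := weyl_eq_one hR (Δ := Δ) fun r => by
    rw [perm_mul, h, perm_perm_inv]; exact isPos_support Δ r
  exact mul_inv_eq_one.mp this

theorem w0_mul_self : w0 Δ * w0 Δ = 1 := by
  refine eq_of_isPos_iff (Δ := Δ) hR fun i => ?_
  rw [perm_mul, isPos_w0_iff hR, isPos_w0_iff hR, perm_one, not_not]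

theorem w0_inv : (w0 Δ)⁻¹ = w0 Δ := inv_eq_of_mul_eq_one_left (w0_mul_self hR)

theorem eq_w0 {w : R.weylGroup} (h : ∀ i, Δ.IsPos i → ¬ Δ.IsPos (perm w i)) : w = w0 Δ := by
  refine eq_of_isPos_iff (Δ := Δ) hR fun i => ?_
  rw [isPos_w0_iff hR]
  refine ⟨fun h1 h2 => h i h2 h1, fun h1 => ?_⟩
  rw [← isPos_negIdx] at h1
  have := h _ h1
  rwa [perm_negIdx, isPos_negIdx, not_not] at this

/-- The longest element of the stabilizer of a dominant element is an involution. -/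
theorem longest_stabilizer_mul_self {a : V} (ha : Dominant Δ a) :
    longest Δ (MulAction.stabilizer R.weylGroup a) *
      longest Δ (MulAction.stabilizer R.weylGroup a) = 1 := by
  have h1 := (longest_spec hR (Δ := Δ) (MulAction.stabilizer R.weylGroup a)).1
  have hn := fun i => not_isPos_longest hR ha (i := i)
  set w := longest Δ (MulAction.stabilizer R.weylGroup a)
  have hw : w • a = a := h1
  have hinv : ∀ i, ⟪R.root (perm w i), a⟫_ℝ = ⟪R.root i, a⟫_ℝ := fun i => by
    rw [root_perm]; conv_lhs => rw [← hw, inner_weyl hR]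
  have hpos : ∀ i, 0 < ⟪R.root i, a⟫_ℝ → Δ.IsPos i := fun i hi => by
    by_contra h
    rw [← isPos_negIdx] at h
    have := ha.inner_root_nonneg h
    rw [root_negIdx, inner_neg_left] at this
    linarith
  refine weyl_eq_one hR (Δ := Δ) fun r => ?_
  rw [perm_mul]
  rcases (ha r).eq_or_lt with h | h
  · have h2 := hn r (isPos_support Δ r) h.symm
    rw [← isPos_negIdx] at h2
    have h3 := hn _ h2 (by rw [root_negIdx, inner_neg_left, hinv, ← h, neg_zero])
    rwa [perm_negIdx, isPos_negIdx, not_not] at h3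
  · exact hpos _ (by rwa [hinv, hinv])

end

end ExtDag

namespace ExtDag

variable {ι V N : Type*} [Fintype ι] [NormedAddCommGroup V] [InnerProductSpace ℝ V]
  [AddCommGroup N] [Module ℝ N] {R : RootPairing ι ℝ V N} {Δ : R.Base} {s : Setting}

/-! ### Normalized roots -/

/-- The unit of the levels of the affine roots with a given finite part: `1` in the untwisted and
`ν_α` in the twisted setting. -/
def lv (R : RootPairing ι ℝ V N) (s : Setting) (i : ι) : ℝ :=
  match s with
  | .untwisted => 1
  | .twisted => nu (R.root i)

/-- The normalized root: `α` in the untwisted and `α^∨` in the twisted setting. -/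
def rt (R : RootPairing ι ℝ V N) (s : Setting) (i : ι) : V := (lv R s i)⁻¹ • R.root i

theorem lv_pos (i : ι) : 0 < lv R s i := by
  cases s
  · exact one_pos
  · exact div_pos (inner_root_root_pos R i) two_pos

theorem root_eq (i : ι) : R.root i = lv R s i • rt R s i := by
  rw [rt, smul_inv_smul₀ (lv_pos i).ne']

theorem rt_untwisted (i : ι) : rt R .untwisted i = R.root i := by simp [rt, lv]

theorem rt_twisted (i : ι) : rt R .twisted i = check (R.root i) := by
  simp [rt, lv, nu, check]

theorem rt_ne_zero (i : ι) : rt R s i ≠ 0 :=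
  smul_ne_zero (inv_ne_zero (lv_pos i).ne') (R.ne_zero i)

theorem rt_injective : Function.Injective (rt R s) := by
  intro i j h
  apply R.root.injective
  cases s
  · rwa [rt_untwisted, rt_untwisted] at h
  · rw [rt_twisted, rt_twisted] at h
    rw [← check_check (R.root i), h, check_check]

theorem check_root (i : ι) : check (R.root i) = (lv R s i)⁻¹ • check (rt R s i) := by
  rw [root_eq (s := s) i, check_smul]

theorem check_rt (i : ι) : check (rt R s i) = lv R s i • check (R.root i) := by
  rw [check_root (s := s), smul_inv_smul₀ (lv_pos i).ne']

theorem rt_negIdx (i : ι) : rt R s (negIdx R i) = -rt R s i := by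
  have : lv R s (negIdx R i) = lv R s i := by
    cases s
    · rfl
    · simp only [lv, nu, root_negIdx, inner_neg_neg]
  rw [rt, this, root_negIdx, smul_neg, rt]

theorem lv_negIdx (i : ι) : lv R s (negIdx R i) = lv R s i := by
  cases s
  · rfl
  · simp only [lv, nu, root_negIdx, inner_neg_neg]

theorem lv_perm (hR : IsNormalizedForm R) (w : R.weylGroup) (i : ι) :
    lv R s (perm w i) = lv R s i := by
  cases s
  · rfl
  · simp only [lv, nu, root_perm, inner_weyl hR]

theorem rt_perm (hR : IsNormalizedForm R) (w : R.weylGroup) (i : ι) :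
    rt R s (perm w i) = w • rt R s i := by
  rw [rt, lv_perm hR, root_perm, rt, weyl_smul_comm]

theorem refl_smul_rt (hR : IsNormalizedForm R) (i : ι) (x : V) :
    refl R i • x = x - ⟪x, check (rt R s i)⟫_ℝ • rt R s i := by
  rw [refl_smul hR, root_eq (s := s) i, check_smul, inner_smul_right, smul_smul]
  congr 2
  field_simp [(lv_pos (R := R) (s := s) i).ne']

theorem inner_rt_pos_iff (i : ι) (x : V) : 0 < ⟪rt R s i, x⟫_ℝ ↔ 0 < ⟪R.root i, x⟫_ℝ := by
  rw [root_eq (s := s) i, inner_smul_left, conj_trivial, mul_pos_iff_of_pos_left (lv_pos i)]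

theorem exists_int_inner_rt_check [R.IsCrystallographic] (hR : IsNormalizedForm R) (i j : ι) :
    ∃ n : ℤ, ⟪rt R s i, check (rt R s j)⟫_ℝ = n := by
  cases s
  · rw [rt_untwisted, rt_untwisted]; exact exists_int_inner_check hR i j
  · rw [rt_twisted, rt_twisted, check_check, real_inner_comm]; exact exists_int_inner_check hR j i

section

variable [R.IsRootSystem] [R.IsCrystallographic] [R.IsReduced] (hR : IsNormalizedForm R)

include hR

/-- Integrality spreads along simple reflections because the normalized roots also have integral
Cartan numbers. -/
theorem exists_int_inner_rt {x : V} (hx : ∀ r : Δ.support, ∃ n : ℤ, ⟪rt R s r, x⟫_ℝ = n) (i : ι) :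
    ∃ n : ℤ, ⟪rt R s i, x⟫_ℝ = n := by
  refine RootPairing.Base.induction_reflect (b := Δ) i
      (p := fun i => ∃ n : ℤ, ⟪rt R s i, x⟫_ℝ = n) ?_ (fun i hi => hx ⟨i, hi⟩) ?_
  · rintro i ⟨n, hn⟩
    refine ⟨-n, ?_⟩
    rw [show R.reflectionPerm i i = negIdx R i from rfl, rt_negIdx, inner_neg_left, hn]
    simp
  · rintro i j ⟨n, hn⟩ hj
    obtain ⟨m, hm⟩ := hx ⟨j, hj⟩
    obtain ⟨k, hk⟩ := exists_int_inner_rt_check (s := s) hR i j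
    refine ⟨n - k * m, ?_⟩
    rw [← perm_refl, rt_perm hR, refl_smul_rt (s := s) hR, inner_sub_left, inner_smul_left, hn,
      hk, hm]
    simp

/-! ### The vector ρ^ε and dominant roots. -/

theorem rhoEps_eq [DecidablePred Δ.IsPos] :
    rhoEps Δ s = (1 / 2 : ℝ) • ∑ i with Δ.IsPos i, check (rt R s i) := by
  cases s
  · simp only [rhoEps, rhoCheck, rt_untwisted]; congr!
  · simp only [rhoEps, rho, rt_twisted, check_check]; congr!

/-- Only the summand of the simple root itself changes sign; the other positive roots are permuted.
-/
theorem refl_smul_rhoEps (r : Δ.support) :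
    refl R (r : ι) • rhoEps Δ s = rhoEps Δ s - check (rt R s r) := by
  classical
  have hr : (r : ι) ∈ Finset.univ.filter Δ.IsPos := by simp [isPos_support]
  have hrr : ∀ i, perm (refl R (r : ι)) (perm (refl R (r : ι)) i) = i := fun i => by
    rw [← perm_mul, refl_mul_self, perm_one]
  rw [rhoEps_eq hR, weyl_smul_comm, Finset.smul_sum, ← Finset.add_sum_erase _ _ hr,
    ← Finset.add_sum_erase _ _ hr]
  have h1 : ∀ i, refl R (r : ι) • check (rt R s i) = check (rt R s (perm (refl R (r : ι)) i)) :=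
    fun i => by rw [rt_perm hR, check_weyl hR]
  have h2 : ∑ i ∈ (Finset.univ.filter Δ.IsPos).erase (r : ι), refl R (r : ι) • check (rt R s i) =
      ∑ i ∈ (Finset.univ.filter Δ.IsPos).erase (r : ι), check (rt R s i) := by
    refine Finset.sum_nbij' (perm (refl R (r : ι))) (perm (refl R (r : ι))) ?_ ?_
      (fun i _ => hrr i) (fun i _ => hrr i) (fun i _ => h1 i)
    all_goals
      intro i hi
      simp only [Finset.mem_erase, Finset.mem_filter, Finset.mem_univ, true_and] at hi ⊢
      refine ⟨fun h => ?_, isPos_perm_refl hR hi.2 hi.1⟩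
      have : i = negIdx R (r : ι) := by rw [← hrr i, h]; rfl
      rw [this, isPos_negIdx] at hi
      exact hi.2 (isPos_support Δ r)
  rw [h2, h1, perm_refl, show R.reflectionPerm (r : ι) r = negIdx R (r : ι) from rfl, rt_negIdx,
    check_neg]
  module

theorem inner_rt_rhoEps (r : Δ.support) : ⟪rt R s r, rhoEps Δ s⟫_ℝ = 1 := by
  have h1 : ⟪rt R s r, refl R (r : ι) • rhoEps Δ s⟫_ℝ = -⟪rt R s r, rhoEps Δ s⟫_ℝ := by
    rw [inner_weyl_right hR, refl_inv, ← rt_perm hR, perm_refl,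
      show R.reflectionPerm (r : ι) r = negIdx R (r : ι) from rfl, rt_negIdx, inner_neg_left]
  rw [refl_smul_rhoEps hR, inner_sub_right, inner_self_check (rt_ne_zero _)] at h1
  linarith

theorem strictlyDominant_rhoEps : StrictlyDominant Δ (rhoEps Δ s) := fun r => by
  rw [← inner_rt_pos_iff (s := s), inner_rt_rhoEps hR]; exact one_pos

theorem exists_int_inner_rt_rhoEps (i : ι) : ∃ n : ℤ, ⟪rt R s i, rhoEps Δ s⟫_ℝ = n :=
  exists_int_inner_rt hR (fun r => ⟨1, by rw [inner_rt_rhoEps hR]; simp⟩) i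

/-- The map -w_0 permutes the positive roots. -/
theorem w0_smul_rhoEps : w0 Δ • rhoEps Δ s = -rhoEps Δ s := by
  classical
  rw [rhoEps_eq hR, weyl_smul_comm, Finset.smul_sum, ← smul_neg, ← Finset.sum_neg_distrib]
  congr 1
  have hw : ∀ i, perm (w0 Δ) (perm (w0 Δ) i) = i := fun i => by
    rw [← perm_mul, w0_mul_self hR, perm_one]
  have key : ∀ i, negIdx R (perm (w0 Δ) (negIdx R (perm (w0 Δ) i))) = i := fun i => by
    rw [perm_negIdx, hw, negIdx_negIdx]
  refine Finset.sum_nbij' (fun i => negIdx R (perm (w0 Δ) i)) (fun i => negIdx R (perm (w0 Δ) i))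
    ?_ ?_ (fun i _ => key i) (fun i _ => key i) (fun i _ => ?_)
  · intro i hi
    simp only [Finset.mem_filter, Finset.mem_univ, true_and] at hi ⊢
    rw [isPos_negIdx, isPos_w0_iff hR, not_not]; exact hi
  · intro i hi
    simp only [Finset.mem_filter, Finset.mem_univ, true_and] at hi ⊢
    rw [isPos_negIdx, isPos_w0_iff hR, not_not]; exact hi
  · rw [rt_negIdx, check_neg, neg_neg, rt_perm hR, check_weyl hR]

theorem eq_zero_or_inner_pos_of_mem_Qplus {x y : V} (hx : StrictlyDominant Δ x)
    (hy : y ∈ Qplus Δ) : y = 0 ∨ 0 < ⟪y, x⟫_ℝ := by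
  induction hy using AddSubmonoid.closure_induction with
  | mem y h => obtain ⟨j, hj, rfl⟩ := h; exact Or.inr (hx ⟨j, hj⟩)
  | zero => simp
  | add y z _ _ h1 h2 =>
    rw [inner_add_left]
    rcases h1 with rfl | h1 <;> rcases h2 with rfl | h2
    · simp
    · right; simpa using h2
    · right; simpa using h1
    · right; positivity

/-- Antisymmetry of the root order; it makes the maximal root unique, so that the chosen `theta` can
be identified. -/
theorem eq_of_sub_mem_Qplus {y z : V} (h1 : y - z ∈ Qplus Δ) (h2 : z - y ∈ Qplus Δ) : y = z := by
  have hx := strictlyDominant_rhoEps (Δ := Δ) (s := .untwisted) hR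
  rcases eq_zero_or_inner_pos_of_mem_Qplus hR hx h1 with h | h
  · exact sub_eq_zero.mp h
  rcases eq_zero_or_inner_pos_of_mem_Qplus hR hx h2 with h' | h'
  · exact (sub_eq_zero.mp h').symm
  · rw [← neg_sub, inner_neg_left] at h'; linarith

/-- Every root lies below a dominant root of its Weyl orbit. -/
theorem exists_dominant_perm (i : ι) :
    ∃ w : R.weylGroup, Dominant Δ (R.root (perm w i)) ∧
      R.root (perm w i) - R.root i ∈ Qplus Δ := by
  -- Among the conjugates lying above the root, take one of greatest height. A negative pairing with
  -- a simple root would let a reflection raise it further.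
  obtain ⟨w, hw, hmax⟩ := Set.exists_max_image
    {w : R.weylGroup | R.root (perm w i) - R.root i ∈ Qplus Δ}
    (fun w => ⟪R.root (perm w i), rhoEps Δ .untwisted⟫_ℝ) (Set.toFinite _)
    ⟨1, by simp [perm_one, (Qplus Δ).zero_mem]⟩
  refine ⟨w, fun r => ?_, hw⟩
  by_contra! hneg
  obtain ⟨n, hn⟩ := exists_int_inner_check hR (perm w i) r
  have hn0 : n < 0 := by
    have : (n : ℝ) < 0 := by
      rw [← hn, check, inner_smul_right, real_inner_comm (R.root (r : ι)) (R.root (perm w i))]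
      exact mul_neg_of_pos_of_neg (div_pos two_pos (inner_root_root_pos R _)) hneg
    exact_mod_cast this
  have h1 : R.root (perm (refl R (r : ι) * w) i) = R.root (perm w i) - (n : ℝ) • R.root r := by
    rw [perm_mul, root_perm, refl_smul hR, hn]
  obtain ⟨m, rfl⟩ : ∃ m : ℕ, n = -(m : ℤ) := ⟨n.natAbs, by omega⟩
  have h2 : R.root (perm (refl R (r : ι) * w) i) = R.root (perm w i) + m • R.root r := by
    rw [h1, ← Nat.cast_smul_eq_nsmul ℝ]; push_cast; module
  have h3 := hmax (refl R (r : ι) * w) (by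
    change _ ∈ Qplus Δ
    rw [h2, add_sub_right_comm]
    exact add_mem hw (nsmul_mem (root_mem_Qplus Δ (isPos_support Δ r)) m))
  have h4 := strictlyDominant_rhoEps (Δ := Δ) (s := .untwisted) hR r
  have h5 : (0 : ℝ) < m := by
    have : 0 < (m : ℤ) := by omega
    exact_mod_cast this
  simp only [h2, ← Nat.cast_smul_eq_nsmul ℝ, inner_add_left, inner_smul_left, conj_trivial] at h3
  have := mul_pos h5 h4
  linarith

end

end ExtDag

namespace ExtDag

variable {ι V N : Type*} [Fintype ι] [NormedAddCommGroup V] [InnerProductSpace ℝ V]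
  [AddCommGroup N] [Module ℝ N] {R : RootPairing ι ℝ V N} {Δ : R.Base} {s : Setting}

/-! ### The maximal root -/

/-- `root t` is dominant and its normalization has maximal length. -/
structure IsLongDominant (Δ : R.Base) (s : Setting) (t : ι) : Prop where
  dominant : Dominant Δ (R.root t)
  long : ∀ j, ⟪rt R s j, rt R s j⟫_ℝ ≤ ⟪rt R s t, rt R s t⟫_ℝ

theorem IsLongDominant.inner_rt_nonneg {t : ι} (ht : IsLongDominant Δ s t) {i : ι}
    (hi : Δ.IsPos i) : 0 ≤ ⟪rt R s i, check (rt R s t)⟫_ℝ := by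
  rw [check_rt, check, rt, inner_smul_left, inner_smul_right, inner_smul_right]
  have h1 := (lv_pos (R := R) (s := s) i).le
  have h2 := (lv_pos (R := R) (s := s) t).le
  have h3 := (inner_root_root_pos R t).le
  have h4 := ht.dominant.inner_root_nonneg hi
  simp only [conj_trivial]
  positivity

section

variable [R.IsRootSystem] [R.IsCrystallographic] [R.IsReduced] (hR : IsNormalizedForm R)

include hR

/-- The squared lengths of the sum and the difference of the two normalized roots are positive; as
the second root is longest, this confines the Cartan integer strictly between -2 and 2. -/
theorem IsLongDominant.abs_inner_le_one {t : ι} (ht : IsLongDominant Δ s t) {j : ι} (h1 : j ≠ t)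
    (h2 : j ≠ negIdx R t) : |⟪rt R s j, check (rt R s t)⟫_ℝ| ≤ 1 := by
  obtain ⟨n, hn⟩ := exists_int_inner_rt_check (s := s) hR j t
  have hT : 0 < ⟪rt R s t, rt R s t⟫_ℝ := real_inner_self_pos.mpr (rt_ne_zero t)
  have hL := ht.long j
  have hn' : 2 * ⟪rt R s j, rt R s t⟫_ℝ = n * ⟪rt R s t, rt R s t⟫_ℝ := by
    rw [← hn, check, inner_smul_right]; field_simp
  have e1 : 0 < ⟪rt R s j - rt R s t, rt R s j - rt R s t⟫_ℝ :=
    real_inner_self_pos.mpr (sub_ne_zero.mpr fun h => h1 (rt_injective h))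
  have e2 : 0 < ⟪rt R s j + rt R s t, rt R s j + rt R s t⟫_ℝ :=
    real_inner_self_pos.mpr fun h => h2 (rt_injective (by
      rw [rt_negIdx]; exact eq_neg_of_add_eq_zero_left h))
  have hc := real_inner_comm (rt R s t) (rt R s j)
  simp only [inner_sub_left, inner_sub_right, inner_add_left, inner_add_right, hc] at e1 e2
  rw [hn]
  have a1 : (n : ℝ) < 2 := by nlinarith
  have a2 : (-2 : ℝ) < n := by nlinarith
  have b1 : n < 2 := by exact_mod_cast a1
  have b2 : -2 < n := by exact_mod_cast a2
  rw [abs_le]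
  constructor
  · have : -1 ≤ n := by omega
    exact_mod_cast this
  · have : n ≤ 1 := by omega
    exact_mod_cast this

variable [R.IsIrreducible]

/-- By irreducibility the orbit of one root spans V, so some conjugate is not orthogonal to the
other root. Reflecting in the latter makes the product positive, and dominance bounds it by the
product of the two roots themselves. -/
theorem Dominant.inner_root_root_pos {p q : ι} (hp : Dominant Δ (R.root p))
    (hq : Dominant Δ (R.root q)) : 0 < ⟪R.root p, R.root q⟫_ℝ := by
  obtain ⟨w, hw⟩ : ∃ w : R.weylGroup, ⟪w • R.root p, R.root q⟫_ℝ ≠ 0 := by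
    by_contra! h
    have h1 : Submodule.span ℝ (MulAction.orbit R.weylGroup (R.root p)) ≤
        LinearMap.ker (innerₗ V (R.root q)) := by
      rw [Submodule.span_le]
      rintro - ⟨w, rfl⟩
      change ⟪R.root q, w • R.root p⟫_ℝ = 0
      rw [real_inner_comm]; exact h w
    rw [R.span_orbit_eq_top] at h1
    exact R.ne_zero q (inner_self_eq_zero.mp (h1 (Submodule.mem_top (x := R.root q))))
  rcases lt_or_gt_of_ne hw with h | h
  · have h1 := hp.inner_smul_le hR hq (refl R q * w)
    rw [mul_smul, inner_weyl_left hR, refl_inv, ← root_perm (refl R q), perm_refl,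
      show R.reflectionPerm q q = negIdx R q from rfl, root_negIdx, inner_neg_right] at h1
    linarith
  · exact h.trans_le (hp.inner_smul_le hR hq w)

/-- A dominant root lies below the long dominant root. -/
theorem IsLongDominant.eq_or_exists_sub_eq {t : ι} (ht : IsLongDominant Δ s t) {j : ι}
    (hj : Dominant Δ (R.root j)) :
    j = t ∨ ∃ w : R.weylGroup, Δ.IsPos (perm w j) ∧ rt R s t - rt R s j = rt R s (perm w j) := by
  rw [or_iff_not_imp_left]
  intro hjt
  have h0 : 0 < ⟪rt R s j, check (rt R s t)⟫_ℝ := by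
    rw [inner_rt_pos_iff, check_rt, check, inner_smul_right, inner_smul_right]
    have := hj.inner_root_root_pos hR ht.dominant
    have := inner_root_root_pos R t
    have := lv_pos (R := R) (s := s) t
    positivity
  have hjn : j ≠ negIdx R t := by
    rintro rfl
    rw [rt_negIdx, inner_neg_left, inner_self_check (rt_ne_zero _)] at h0
    linarith
  have h1 : ⟪rt R s j, check (rt R s t)⟫_ℝ = 1 := by
    have h2 := ht.abs_inner_le_one hR hjt hjn
    obtain ⟨n, hn⟩ := exists_int_inner_rt_check (s := s) hR j t
    rw [hn] at h0 h2 ⊢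
    have h3 : 0 < n := by exact_mod_cast h0
    have h4 : (n : ℝ) ≤ 1 := (abs_le.mp h2).2
    have h5 : n ≤ 1 := by exact_mod_cast h4
    have : n = 1 := by omega
    simp [this]
  have h2 : rt R s (perm (refl R t) j) = rt R s j - rt R s t := by
    rw [rt_perm hR, refl_smul_rt (s := s) hR, h1, one_smul]
  have h3 : ¬ Δ.IsPos (perm (refl R t) j) := by
    intro h
    have := ht.inner_rt_nonneg h
    rw [h2, inner_sub_left, h1, inner_self_check (rt_ne_zero _)] at this
    linarith
  -- The reflection in t gives the negative root `rt j - rt t`; the reflection in that root then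
  -- changes its sign.
  refine ⟨refl R (perm (refl R t) j) * refl R t, ?_, ?_⟩
  · rw [perm_mul, perm_refl _ (perm (refl R t) j)]
    exact (isPos_negIdx Δ _).mpr h3
  · rw [perm_mul, perm_refl _ (perm (refl R t) j)]
    change _ = rt R s (negIdx R _)
    rw [rt_negIdx, h2, neg_sub]

/-- Pass from a root to a dominant conjugate above it, which has the same `lv`, and from there to
`t`; both differences are nonnegative on dominant vectors. -/
theorem IsLongDominant.inner_rt_le {t : ι} (ht : IsLongDominant Δ s t) {x : V}
    (hx : Dominant Δ x) (i : ι) : ⟪rt R s i, x⟫_ℝ ≤ ⟪rt R s t, x⟫_ℝ := by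
  obtain ⟨w, h1, h2⟩ := exists_dominant_perm (Δ := Δ) hR i
  have h3 : ⟪rt R s i, x⟫_ℝ ≤ ⟪rt R s (perm w i), x⟫_ℝ := by
    have := hx.inner_nonneg h2
    rw [root_eq (s := s) i, root_eq (s := s) (perm w i), lv_perm hR, ← smul_sub, inner_smul_left,
      conj_trivial] at this
    have := (mul_nonneg_iff_of_pos_left (lv_pos i)).mp this
    rw [inner_sub_left] at this
    linarith
  refine h3.trans ?_
  rcases ht.eq_or_exists_sub_eq hR h1 with h | ⟨v, h4, h5⟩
  · rw [h]
  · have : 0 ≤ ⟪rt R s (perm v (perm w i)), x⟫_ℝ := by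
      rw [rt, inner_smul_left]
      have := (lv_pos (R := R) (s := s) (perm v (perm w i))).le
      have := hx.inner_root_nonneg h4
      simp only [conj_trivial]
      positivity
    rw [← h5, inner_sub_left] at this
    linarith

/-- If `t` is long dominant, `root t` is above all roots with `lv = lv t`
whose normalization equals itself up to that unit. -/
theorem IsLongDominant.sub_mem_Qplus {t : ι} (ht : IsLongDominant Δ s t) {i : ι}
    (h : lv R s i = lv R s t) : R.root t - R.root i ∈ Qplus Δ := by
  obtain ⟨w, h1, h2⟩ := exists_dominant_perm (Δ := Δ) hR i
  have h3 : R.root t - R.root (perm w i) ∈ Qplus Δ := by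
    rcases ht.eq_or_exists_sub_eq hR h1 with h' | ⟨v, h4, h5⟩
    · rw [h', sub_self]; exact zero_mem _
    · have := root_mem_Qplus Δ h4
      rwa [root_eq (s := s) (perm v (perm w i)), ← h5, lv_perm hR, lv_perm hR, smul_sub, h,
        ← root_eq, ← h, ← lv_perm hR w i, ← root_eq] at this
  have := add_mem h3 h2
  rwa [sub_add_sub_cancel] at this

/-- The root `root t` is the maximal (short) root, and it is long dominant. -/
structure IsTheta (Δ : R.Base) (s : Setting) (t : ι) : Prop extends IsLongDominant Δ s t where
  theta_eq : theta Δ s = R.root t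
  lv_eq : lv R s t = 1

omit [R.IsIrreducible] in
theorem exists_isLongDominant {P : ι → Prop} (hP : ∃ i, P i)
    (hlong : ∀ i, P i → ∀ j, ⟪rt R s j, rt R s j⟫_ℝ ≤ ⟪rt R s i, rt R s i⟫_ℝ)
    (hw : ∀ (w : R.weylGroup) i, P i → P (perm w i)) : ∃ t, P t ∧ IsLongDominant Δ s t := by
  obtain ⟨i, hi⟩ := hP
  obtain ⟨w, h1, -⟩ := exists_dominant_perm (Δ := Δ) hR i
  exact ⟨perm w i, hw w i hi, h1, hlong _ (hw w i hi)⟩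

theorem exists_isTheta : ∃ t, IsTheta Δ s t := by
  cases s with
  | untwisted =>
    have hne : Nonempty ι := ⟨hR.exists_eq_two.choose⟩
    obtain ⟨t, -, ht⟩ := exists_isLongDominant (Δ := Δ) (s := .untwisted) hR
      (P := fun i => ∀ j, ⟪rt R .untwisted j, rt R .untwisted j⟫_ℝ ≤
        ⟪rt R .untwisted i, rt R .untwisted i⟫_ℝ)
      (by
        obtain ⟨i, -, hi⟩ := Set.exists_max_image Set.univ
          (fun i => ⟪rt R .untwisted i, rt R .untwisted i⟫_ℝ) (Set.toFinite _)
          ⟨hne.some, trivial⟩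
        exact ⟨i, fun j => hi j trivial⟩)
      (fun i h => h) (fun w i h j => by rw [rt_perm hR, inner_weyl hR]; exact h j)
    have hspec : R.root t ∈ Set.range R.root ∧ ∀ j, R.root t - R.root j ∈ Qplus Δ :=
      ⟨⟨t, rfl⟩, fun j => ht.sub_mem_Qplus hR rfl⟩
    obtain ⟨⟨t', h1⟩, h2⟩ := Classical.epsilon_spec
      (p := fun v => v ∈ Set.range R.root ∧ ∀ j, v - R.root j ∈ Qplus Δ) ⟨_, hspec⟩
    refine ⟨t, ht, ?_, rfl⟩
    refine eq_of_sub_mem_Qplus (Δ := Δ) hR (h2 t) ?_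
    change R.root t - Classical.epsilon _ ∈ _
    rw [← h1]
    exact hspec.2 t'
  | twisted =>
    have hlv : ∀ i, ⟪R.root i, R.root i⟫_ℝ = 2 → lv R .twisted i = 1 := fun i h => by
      rw [lv, nu, h, div_self two_ne_zero]
    obtain ⟨t, ht2, ht⟩ := exists_isLongDominant (Δ := Δ) (s := .twisted) hR
      (P := fun i => ⟪R.root i, R.root i⟫_ℝ = 2) hR.exists_eq_two
      (fun i h j => by
        have h1 := hR.two_le j
        -- Passing to coroots inverts lengths, so the short roots have the longest normalizations.
        have e : ∀ k, ⟪rt R .twisted k, rt R .twisted k⟫_ℝ = 4 / ⟪R.root k, R.root k⟫_ℝ := by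
          intro k
          have := (inner_root_root_pos R k).ne'
          rw [rt_twisted, check, inner_smul_left, inner_smul_right, conj_trivial]
          field_simp; norm_num
        rw [e, e, h]
        exact div_le_div_of_nonneg_left (by norm_num) (by norm_num) h1)
      (fun w i h => by rw [root_perm, inner_weyl hR, h])
    have hspec : (R.root t ∈ Set.range R.root ∧ ⟪R.root t, R.root t⟫_ℝ = 2) ∧
        ∀ j, ⟪R.root j, R.root j⟫_ℝ = 2 → R.root t - R.root j ∈ Qplus Δ :=
      ⟨⟨⟨t, rfl⟩, ht2⟩, fun j hj => ht.sub_mem_Qplus hR (by rw [hlv _ hj, hlv _ ht2])⟩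
    obtain ⟨⟨⟨t', h1⟩, h3⟩, h2⟩ := Classical.epsilon_spec
      (p := fun v => (v ∈ Set.range R.root ∧ ⟪v, v⟫_ℝ = 2) ∧
        ∀ j, ⟪R.root j, R.root j⟫_ℝ = 2 → v - R.root j ∈ Qplus Δ) ⟨_, hspec⟩
    refine ⟨t, ht, ?_, hlv _ ht2⟩
    refine eq_of_sub_mem_Qplus (Δ := Δ) hR (h2 t ht2) ?_
    change R.root t - Classical.epsilon _ ∈ _
    rw [← h1] at h3 ⊢
    exact hspec.2 t' h3

/-- The numbers `ν_α` are integers. -/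
theorem exists_int_lv (i : ι) : ∃ n : ℤ, lv R s i = n := by
  cases s with
  | untwisted => exact ⟨1, by simp [lv]⟩
  | twisted =>
    obtain ⟨j, hj⟩ := hR.exists_eq_two
    -- Irreducibility provides a short root that is not orthogonal to the given one.
    obtain ⟨k, hk, hik⟩ := R.exists_form_eq_form_and_form_ne_zero hR.invariantForm i j
    change ⟪R.root k, R.root k⟫_ℝ = ⟪R.root j, R.root j⟫_ℝ at hk
    change ⟪R.root i, R.root k⟫_ℝ ≠ 0 at hik
    rw [hj] at hk
    obtain ⟨n, hn⟩ := exists_int_inner_check hR i k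
    obtain ⟨m, hm⟩ := exists_int_inner_check hR k i
    have hi := inner_root_root_pos R i
    have hi2 := hR.two_le i
    rw [check, inner_smul_right, hk, div_self two_ne_zero, one_mul] at hn
    rw [check, inner_smul_right, real_inner_comm (R.root i) (R.root k), hn] at hm
    have hm' : 2 * (n : ℝ) = m * ⟪R.root i, R.root i⟫_ℝ := by
      rw [← hm]; field_simp
    have hcs := real_inner_mul_inner_self_le (R.root i) (R.root k)
    rw [hn, hk] at hcs
    rw [hn] at hik
    have hm0 : m ≠ 0 := by
      rintro rfl
      simp at hm'
      exact hik (by exact_mod_cast hm')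
    have hsq : (m : ℝ) * m ≤ 4 := by
      have : (m : ℝ) * m * ⟪R.root i, R.root i⟫_ℝ ≤ 8 := by
        have h1 : (m : ℝ) * m * ⟪R.root i, R.root i⟫_ℝ * ⟪R.root i, R.root i⟫_ℝ ≤
            8 * ⟪R.root i, R.root i⟫_ℝ := by
          have : (m : ℝ) * m * ⟪R.root i, R.root i⟫_ℝ * ⟪R.root i, R.root i⟫_ℝ =
            (2 * (n : ℝ)) * (2 * n) := by rw [hm']; ring
          rw [this]; nlinarith
        exact le_of_mul_le_mul_right h1 hi
      nlinarith [mul_self_nonneg (m : ℝ)]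
    have hmz : m * m ≤ 4 := by exact_mod_cast hsq
    have hmr : m = 1 ∨ m = -1 ∨ m = 2 ∨ m = -2 := by
      have : m ≤ 2 := by nlinarith
      have : -2 ≤ m := by nlinarith
      omega
    change ∃ n : ℤ, ⟪R.root i, R.root i⟫_ℝ / 2 = n
    -- For m = ±1 the relation 2n = m (α, α) gives ν_α = ±n; for m = ±2 Cauchy–Schwarz forces (α, α)
    -- = 2.
    rcases hmr with rfl | rfl | rfl | rfl
    · exact ⟨n, by push_cast at hm'; linarith⟩
    · exact ⟨-n, by push_cast at hm' ⊢; linarith⟩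
    all_goals
      refine ⟨1, ?_⟩
      push_cast at hm' ⊢
      nlinarith

end

end ExtDag

namespace ExtDag

variable {ι V N : Type*} [Fintype ι] [NormedAddCommGroup V] [InnerProductSpace ℝ V]
  [AddCommGroup N] [Module ℝ N] {R : RootPairing ι ℝ V N} {Δ : R.Base} {s : Setting}

/-! ### Affine roots and the extended affine Weyl group -/

/-- The affine root `[α, j]` (untwisted) or `[α, ν_α j]` (twisted). -/
def affVec (R : RootPairing ι ℝ V N) (s : Setting) (i : ι) (j : ℤ) : V × ℝ :=
  (R.root i, lv R s i * j)

theorem mem_posAff_iff {x : V × ℝ} :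
    x ∈ posAff Δ s ↔ ∃ i j, (0 < j ∨ j = 0 ∧ Δ.IsPos i) ∧ x = affVec R s i j := by
  cases s <;> simp [posAff, affVec, lv]

theorem affVec_inj {i i' : ι} {j j' : ℤ} : affVec R s i j = affVec R s i' j' ↔ i = i' ∧ j = j' := by
  refine ⟨fun h => ?_, by rintro ⟨rfl, rfl⟩; rfl⟩
  simp only [affVec, Prod.mk.injEq] at h
  obtain rfl := R.root.injective h.1
  exact ⟨rfl, by exact_mod_cast mul_left_cancel₀ (lv_pos i).ne' h.2⟩

theorem affVec_mem_posAff {i : ι} {j : ℤ} :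
    affVec R s i j ∈ posAff Δ s ↔ 0 < j ∨ j = 0 ∧ Δ.IsPos i := by
  rw [mem_posAff_iff]
  refine ⟨?_, fun h => ⟨i, j, h, rfl⟩⟩
  rintro ⟨i', j', h, h'⟩
  obtain ⟨rfl, rfl⟩ := affVec_inj.mp h'
  exact h

theorem neg_affVec (i : ι) (j : ℤ) : -affVec R s i j = affVec R s (negIdx R i) (-j) := by
  simp only [affVec, root_negIdx, lv_negIdx, Prod.neg_mk]
  push_cast
  rw [mul_neg]

theorem neg_affVec_mem_posAff {i : ι} {j : ℤ} :
    -affVec R s i j ∈ posAff Δ s ↔ affVec R s i j ∉ posAff Δ s := by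
  rw [neg_affVec, affVec_mem_posAff, affVec_mem_posAff, isPos_negIdx]
  by_cases h : Δ.IsPos i <;> simp only [h, not_true, not_false_iff, and_true,
    and_false, or_false] <;> omega

theorem neg_notMem_posAff {x : V × ℝ} (hx : x ∈ posAff Δ s) : -x ∉ posAff Δ s := by
  obtain ⟨i, j, h, rfl⟩ := mem_posAff_iff.mp hx
  rw [neg_affVec_mem_posAff, not_not]; exact hx

theorem transl_mul_ext_apply (a : V) (w : R.weylGroup) (z : V × ℝ) :
    (transl a * ext w) z = (w • z.1, z.2 - ⟪w • z.1, a⟫_ℝ) := rfl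

theorem ext_apply (w : R.weylGroup) (z : V × ℝ) : ext w z = (w • z.1, z.2) := rfl

theorem transl_apply (a : V) (z : V × ℝ) : transl a z = (z.1, z.2 - ⟪z.1, a⟫_ℝ) := rfl

theorem ext_mul (w v : R.weylGroup) : ext (w * v) = ext w * ext v := by
  apply LinearEquiv.ext
  intro z
  change _ = ext w (ext v z)
  rw [ext_apply, ext_apply, ext_apply, mul_smul]

theorem ext_one : ext (1 : R.weylGroup) = 1 := by
  apply LinearEquiv.ext
  intro z
  rw [ext_apply, one_smul]; rfl

theorem ext_inv (w : R.weylGroup) : (ext w)⁻¹ = ext w⁻¹ :=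
  inv_eq_of_mul_eq_one_left (by rw [← ext_mul, inv_mul_cancel, ext_one])

theorem transl_zero : transl (0 : V) = 1 := by
  apply LinearEquiv.ext
  intro z
  rw [transl_apply, inner_zero_right, sub_zero]; rfl

/-- `a` is integral on the normalized roots. -/
def IsCoweight (R : RootPairing ι ℝ V N) (s : Setting) (a : V) : Prop :=
  ∀ i, ∃ n : ℤ, ⟪rt R s i, a⟫_ℝ = n

theorem transl_mul_ext_mul (hR : IsNormalizedForm R) (a b : V) (w v : R.weylGroup) :
    transl a * ext w * (transl b * ext v) = transl (a + w • b) * ext (w * v) := by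
  apply LinearEquiv.ext
  intro z
  change (transl a * ext w) ((transl b * ext v) z) = _
  simp only [transl_mul_ext_apply, mul_smul, inner_add_right, inner_weyl hR]
  ext
  · rfl
  · simp only; ring

/-- The extended affine Weyl group. -/
def extGroup (hR : IsNormalizedForm R) (s : Setting) : Subgroup (AffGL V) where
  carrier := {g | ∃ a w, IsCoweight R s a ∧ g = transl a * ext (R := R) w}
  mul_mem' := by
    rintro _ _ ⟨a, w, ha, rfl⟩ ⟨b, v, hb, rfl⟩
    refine ⟨a + w • b, w * v, fun i => ?_, transl_mul_ext_mul hR a b w v⟩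
    obtain ⟨n, hn⟩ := ha i
    obtain ⟨m, hm⟩ := hb (perm w⁻¹ i)
    refine ⟨n + m, ?_⟩
    rw [inner_add_right, inner_weyl_right hR, ← rt_perm hR, hn, hm]
    simp
  one_mem' := ⟨0, 1, fun i => ⟨0, by simp⟩, by rw [transl_zero, ext_one, mul_one]⟩
  inv_mem' := by
    rintro _ ⟨a, w, ha, rfl⟩
    refine ⟨-(w⁻¹ • a), w⁻¹, fun i => ?_, ?_⟩
    · obtain ⟨n, hn⟩ := ha (perm w i)
      refine ⟨-n, ?_⟩
      rw [inner_neg_right, inner_weyl_right hR, inv_inv, ← rt_perm hR, hn]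
      simp
    · refine inv_eq_of_mul_eq_one_left ?_
      rw [transl_mul_ext_mul hR, inv_mul_cancel, ext_one, neg_add_cancel, transl_zero, mul_one]

section

variable (hR : IsNormalizedForm R)

include hR

/-- Levels are measured in units of `lv`, which w preserves; in both settings the integer level is
therefore just shifted. -/
theorem transl_mul_ext_affVec {a : V} (w : R.weylGroup) {i : ι} {n : ℤ} (j : ℤ)
    (h : ⟪rt R s (perm w i), a⟫_ℝ = n) :
    (transl a * ext w) (affVec R s i j) = affVec R s (perm w i) (j - n) := by
  rw [transl_mul_ext_apply]
  simp only [affVec, ← root_perm, lv_perm hR]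
  rw [root_eq (s := s) (perm w i), inner_smul_left, conj_trivial, h, lv_perm hR]
  push_cast
  rw [mul_sub]

theorem affRefl_affVec (i : ι) (j : ℤ) :
    affRefl (affVec R s i j) = transl (-(j : ℝ) • check (rt R s i)) * ext (refl R i) := by
  apply LinearEquiv.ext
  intro z
  rw [affRefl_apply, transl_mul_ext_apply]
  ext
  · simp only [affVec, Prod.fst_sub, Prod.smul_fst, refl_smul hR]
  · have hz : ⟪refl R i • z.1, check (R.root i)⟫_ℝ = -⟪z.1, check (R.root i)⟫_ℝ := by
      rw [inner_weyl_left hR, refl_inv, ← check_weyl hR, ← root_perm, perm_refl,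
        show R.reflectionPerm i i = negIdx R i from rfl, root_negIdx, check_neg, inner_neg_right]
    simp only [affVec, Prod.snd_sub, Prod.smul_snd, inner_smul_right, smul_eq_mul, check_rt, hz]
    ring

variable [R.IsCrystallographic]

theorem affRefl_mem_extGroup (i : ι) (j : ℤ) : affRefl (affVec R s i j) ∈ extGroup hR s := by
  refine ⟨_, _, fun k => ?_, affRefl_affVec hR i j⟩
  obtain ⟨n, hn⟩ := exists_int_inner_rt_check (s := s) hR k i
  refine ⟨-j * n, ?_⟩
  rw [inner_smul_right, hn]
  push_cast
  ring

theorem apply_mem_or_neg_mem {g : AffGL V} (hg : g ∈ extGroup hR s) {x : V × ℝ}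
    (hx : x ∈ posAff Δ s) : g x ∈ posAff Δ s ∨ -(g x) ∈ posAff Δ s := by
  obtain ⟨a, w, ha, rfl⟩ := hg
  obtain ⟨i, j, h, rfl⟩ := mem_posAff_iff.mp hx
  obtain ⟨n, hn⟩ := ha (perm w i)
  rw [transl_mul_ext_affVec hR w j hn, neg_affVec_mem_posAff]
  exact em _

omit hR [R.IsCrystallographic] in
/-- The inversion set of `g`. -/
abbrev invSet (Δ : R.Base) (s : Setting) (g : AffGL V) : Set (V × ℝ) :=
  {x | x ∈ posAff Δ s ∧ -(g x) ∈ posAff Δ s}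

theorem finite_invSet {g : AffGL V} (hg : g ∈ extGroup hR s) : (invSet Δ s g).Finite := by
  obtain ⟨a, w, ha, rfl⟩ := hg
  choose n hn using fun i => ha (perm w i)
  -- For a fixed finite part the level drops by n, so only levels between 0 and n can become
  -- negative.
  refine Set.Finite.subset (Set.finite_iUnion fun i =>
    (Set.finite_Icc (0 : ℤ) (n i)).image fun j => affVec R s i j) ?_
  rintro x ⟨h1, h2⟩
  obtain ⟨i, j, h, rfl⟩ := mem_posAff_iff.mp h1
  rw [transl_mul_ext_affVec hR w j (hn i), neg_affVec_mem_posAff, affVec_mem_posAff] at h2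
  refine Set.mem_iUnion.mpr ⟨i, j, ⟨?_, ?_⟩, rfl⟩ <;> omega

/-! ### Simple affine reflections and lengths. -/

variable [R.IsRootSystem] [R.IsReduced] [R.IsIrreducible] {t : ι} (ht : IsTheta Δ s t)

omit hR [R.IsCrystallographic] [R.IsRootSystem] [R.IsReduced] [R.IsIrreducible] in
theorem IsLongDominant.isPos (ht : IsLongDominant Δ s t) : Δ.IsPos t := by
  by_contra h
  rw [← isPos_negIdx] at h
  have := ht.dominant.inner_root_nonneg h
  rw [root_negIdx, inner_neg_left] at this
  linarith [inner_root_root_pos R t]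

omit hR [R.IsCrystallographic] [R.IsRootSystem] [R.IsReduced] [R.IsIrreducible] in
/-- The index of the finite part of a simple affine root. -/
def simpleIdx (Δ : R.Base) (t : ι) : Option Δ.support → ι
  | none => negIdx R t
  | some r => r

omit hR [R.IsCrystallographic] [R.IsRootSystem] [R.IsReduced] [R.IsIrreducible] in
/-- The level of a simple affine root. -/
def simpleLevel : Option Δ.support → ℤ
  | none => 1
  | some _ => 0

omit hR [R.IsCrystallographic] [R.IsRootSystem] [R.IsReduced] [R.IsIrreducible] in
include ht in
theorem simpleAff_eq (k : Option Δ.support) :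
    simpleAff Δ s k = affVec R s (simpleIdx Δ t k) (simpleLevel k) := by
  cases k with
  | none => simp [simpleAff, affVec, simpleIdx, simpleLevel, ht.theta_eq, lv_negIdx,
      ht.lv_eq]
  | some r => simp [simpleAff, affVec, simpleIdx, simpleLevel]

omit hR [R.IsCrystallographic] [R.IsRootSystem] [R.IsReduced] [R.IsIrreducible] in
include ht in
theorem simpleAff_mem_posAff (k : Option Δ.support) : simpleAff Δ s k ∈ posAff Δ s := by
  rw [simpleAff_eq ht, affVec_mem_posAff]
  cases k with
  | none => exact Or.inl one_pos
  | some r => exact Or.inr ⟨rfl, isPos_support Δ r⟩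

omit hR [R.IsCrystallographic] [R.IsRootSystem] [R.IsReduced] [R.IsIrreducible] in
include ht in
theorem simpleAff_injective : Function.Injective (simpleAff Δ s) := by
  intro k l h
  rw [simpleAff_eq ht, simpleAff_eq ht, affVec_inj] at h
  cases k <;> cases l <;> simp_all [simpleIdx, simpleLevel]

omit hR in
/-- The simple affine reflection with index `k`. -/
abbrev saff (Δ : R.Base) (s : Setting) (k : Option Δ.support) : AffGL V :=
  affRefl (simpleAff Δ s k)

omit hR [R.IsCrystallographic] [R.IsRootSystem] [R.IsReduced] [R.IsIrreducible] in
theorem affRefl_affRefl (a x : V × ℝ) : affRefl a (affRefl a x) = x :=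
  (affRefl a).symm_apply_apply x

omit hR [R.IsCrystallographic] [R.IsRootSystem] [R.IsReduced] [R.IsIrreducible] in
theorem affRefl_mul_self (a : V × ℝ) : affRefl a * affRefl a = 1 :=
  LinearEquiv.ext fun x => affRefl_affRefl a x

omit hR [R.IsCrystallographic] [R.IsRootSystem] [R.IsReduced] [R.IsIrreducible] in
theorem affRefl_self {a : V × ℝ} (ha : a.1 ≠ 0) : affRefl a a = -a := by
  rw [affRefl_apply, inner_self_check ha]; module

omit hR [R.IsCrystallographic] [R.IsRootSystem] [R.IsReduced] [R.IsIrreducible] in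
theorem fst_ne_zero_of_mem_posAff {a : V × ℝ} (ha : a ∈ posAff Δ s) : a.1 ≠ 0 := by
  obtain ⟨i, j, -, rfl⟩ := mem_posAff_iff.mp ha
  exact R.ne_zero i

include ht

theorem saff_mem_extGroup (k : Option Δ.support) : saff Δ s k ∈ extGroup hR s := by
  rw [saff, simpleAff_eq ht]; exact affRefl_mem_extGroup hR _ _

/-- A simple affine reflection permutes the positive affine roots other than the simple one. -/
theorem saff_apply_mem_posAff {k : Option Δ.support} {x : V × ℝ} (hx : x ∈ posAff Δ s)
    (hk : x ≠ simpleAff Δ s k) : saff Δ s k x ∈ posAff Δ s := by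
  obtain ⟨i, j, h, rfl⟩ := mem_posAff_iff.mp hx
  rw [simpleAff_eq ht, Ne, affVec_inj] at hk
  rw [saff, simpleAff_eq ht, affRefl_affVec hR]
  cases k with
  | some r =>
    simp only [simpleIdx, simpleLevel] at hk ⊢
    rw [transl_mul_ext_affVec hR (n := 0) _ _ (by simp), affVec_mem_posAff, sub_zero]
    rcases h with h | ⟨rfl, h⟩
    · exact Or.inl h
    · exact Or.inr ⟨rfl, isPos_perm_refl hR h (by tauto)⟩
  | none =>
    simp only [simpleIdx, simpleLevel] at hk ⊢
    obtain ⟨c, hc⟩ := exists_int_inner_rt_check (s := s) hR i t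
    have hrt : rt R s (perm (refl R t) i) = rt R s i - (c : ℝ) • rt R s t := by
      rw [rt_perm hR, refl_smul_rt (s := s) hR, hc]
    have hc' : ⟪rt R s (perm (refl R t) i), check (rt R s t)⟫_ℝ = -c := by
      rw [hrt, inner_sub_left, inner_smul_left, hc, inner_self_check (rt_ne_zero _), conj_trivial]
      ring
    rw [refl_negIdx hR, transl_mul_ext_affVec hR (n := -c) _ _
      (by rw [rt_negIdx, check_neg]; simp [hc']), affVec_mem_posAff, sub_neg_eq_add]
    have hpos : ∀ k, 0 < ⟪rt R s k, check (rt R s t)⟫_ℝ → Δ.IsPos k := by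
      intro k hk
      by_contra hn
      rw [← isPos_negIdx] at hn
      have := ht.inner_rt_nonneg hn
      rw [rt_negIdx, inner_neg_left] at this
      linarith
    by_cases h1 : i = t
    · subst h1
      rw [inner_self_check (rt_ne_zero _)] at hc
      have : c = 2 := by exact_mod_cast hc.symm
      left; omega
    by_cases h2 : i = negIdx R t
    · subst h2
      rw [rt_negIdx, inner_neg_left, inner_self_check (rt_ne_zero _)] at hc
      have : c = -2 := by exact_mod_cast hc.symm
      have hn : ¬ Δ.IsPos (negIdx R t) := by rw [isPos_negIdx, not_not]; exact ht.isPos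
      have : perm (refl R t) (negIdx R t) = t := by
        rw [perm_negIdx, perm_refl]; exact negIdx_negIdx t
      rw [this]
      -- Level 1 over the negative of the maximal root is the excluded simple root itself, so the
      -- level is at least 2 and drops to at least 0.
      have hj : j ≠ 1 := fun e => hk ⟨rfl, e⟩
      have h' := h.resolve_right fun h => hn h.2
      rcases lt_or_ge 0 (j + c) with h'' | h''
      · exact Or.inl h''
      · exact Or.inr ⟨by omega, ht.isPos⟩
    -- For all remaining roots the level changes by at most one; if it drops to 0, then c = -1 and
    -- the reflected root pairs positively with the dominant root, hence is positive.
    have hc1 := ht.abs_inner_le_one hR h1 h2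
    rw [hc, abs_le] at hc1
    have hc2 : -1 ≤ c := by exact_mod_cast hc1.1
    rcases h with h | ⟨rfl, h⟩
    · rcases lt_or_ge 0 (j + c) with h' | h'
      · exact Or.inl h'
      · have : c = -1 := by omega
        refine Or.inr ⟨by omega, hpos _ ?_⟩
        rw [hc', this]; norm_num
    · have := ht.inner_rt_nonneg h
      rw [hc] at this
      have hc0 : 0 ≤ c := by exact_mod_cast this
      rcases hc0.eq_or_lt with h0 | h0
      · refine Or.inr ⟨by omega, ?_⟩
        rw [← h0, Int.cast_zero, zero_smul, sub_zero] at hrt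
        rwa [rt_injective hrt]
      · left; omega

theorem invSet_mul_saff {g : AffGL V} {k : Option Δ.support}
    (h : g (simpleAff Δ s k) ∈ posAff Δ s) :
    invSet Δ s (g * saff Δ s k) = insert (simpleAff Δ s k) (saff Δ s k '' invSet Δ s g) := by
  have ha := simpleAff_mem_posAff ht k
  have hself : saff Δ s k (simpleAff Δ s k) = -simpleAff Δ s k :=
    affRefl_self (fst_ne_zero_of_mem_posAff ha)
  ext x
  simp only [Set.mem_insert_iff, Set.mem_image, Set.mem_ofPred_eq]
  constructor
  · rintro ⟨h1, h2⟩
    by_cases hx : x = simpleAff Δ s k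
    · exact Or.inl hx
    · exact Or.inr ⟨saff Δ s k x, ⟨saff_apply_mem_posAff hR ht h1 hx, h2⟩, affRefl_affRefl _ _⟩
  · rintro (rfl | ⟨y, ⟨h1, h2⟩, rfl⟩)
    · refine ⟨ha, ?_⟩
      change -(g (saff Δ s k _)) ∈ _
      rwa [hself, map_neg, neg_neg]
    · have hy : y ≠ simpleAff Δ s k := by rintro rfl; exact neg_notMem_posAff h h2
      refine ⟨saff_apply_mem_posAff hR ht h1 hy, ?_⟩
      change -(g (saff Δ s k (saff Δ s k y))) ∈ _
      rwa [affRefl_affRefl]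

theorem affLength_mul_saff {g : AffGL V} (hg : g ∈ extGroup hR s) {k : Option Δ.support}
    (h : g (simpleAff Δ s k) ∈ posAff Δ s) :
    affLength Δ s (g * saff Δ s k) = affLength Δ s g + 1 := by
  have ha := simpleAff_mem_posAff ht k
  have hself : saff Δ s k (simpleAff Δ s k) = -simpleAff Δ s k :=
    affRefl_self (fst_ne_zero_of_mem_posAff ha)
  change (invSet Δ s (g * saff Δ s k)).ncard = (invSet Δ s g).ncard + 1
  rw [invSet_mul_saff hR ht h, Set.ncard_insert_of_notMem _ ((finite_invSet hR hg).image _),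
    Set.ncard_image_of_injective _ (saff Δ s k).injective]
  rintro ⟨y, ⟨h1, -⟩, hy⟩
  have : y = -simpleAff Δ s k := by rw [← hself, ← hy, affRefl_affRefl]
  rw [this] at h1
  exact neg_notMem_posAff ha h1

theorem affLength_mul_saff_of_neg {g : AffGL V} (hg : g ∈ extGroup hR s) {k : Option Δ.support}
    (h : -(g (simpleAff Δ s k)) ∈ posAff Δ s) :
    affLength Δ s (g * saff Δ s k) + 1 = affLength Δ s g := by
  have ha := simpleAff_mem_posAff ht k
  have hself : saff Δ s k (simpleAff Δ s k) = -simpleAff Δ s k :=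
    affRefl_self (fst_ne_zero_of_mem_posAff ha)
  rw [← affLength_mul_saff hR ht (mul_mem hg (saff_mem_extGroup hR ht k)), mul_assoc,
    affRefl_mul_self, mul_one]
  change g (saff Δ s k _) ∈ _
  rwa [hself, map_neg]

theorem affLength_mul_saff_le {g : AffGL V} (hg : g ∈ extGroup hR s) (k : Option Δ.support) :
    affLength Δ s (g * saff Δ s k) ≤ affLength Δ s g + 1 := by
  rcases apply_mem_or_neg_mem hR hg (simpleAff_mem_posAff ht k) with h | h
  · rw [affLength_mul_saff hR ht hg h]
  · have := affLength_mul_saff_of_neg hR ht hg h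
    omega

/-- Positivity of an affine root in terms of a linear functional. -/
theorem affVec_mem_posAff_iff_inner (i : ι) (j : ℤ) : affVec R s i j ∈ posAff Δ s ↔
    0 < ⟪rt R s i, rhoEps Δ s⟫_ℝ + (⟪rt R s t, rhoEps Δ s⟫_ℝ + 1) * j := by
  have hd := strictlyDominant_rhoEps (Δ := Δ) (s := s) hR
  have h1 := ht.inner_rt_le hR hd.dominant i
  have h2 := ht.inner_rt_le hR hd.dominant (negIdx R i)
  rw [rt_negIdx, inner_neg_left] at h2
  -- H exceeds the absolute height of every normalized root, so a nonzero level alone decides the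
  -- sign.
  set H := ⟪rt R s t, rhoEps Δ s⟫_ℝ + 1
  rw [affVec_mem_posAff, hd.isPos_iff, ← inner_rt_pos_iff (s := s)]
  have hH : 0 < H := by
    have := (inner_rt_pos_iff (s := s) t (rhoEps Δ s)).mpr (hd.inner_root_pos ht.isPos)
    linarith
  rcases lt_trichotomy j 0 with h | rfl | h
  · have : (j : ℝ) ≤ -1 := by exact_mod_cast (by omega : j ≤ -1)
    constructor
    · omega
    · intro; nlinarith
  · simp
  · have : (1 : ℝ) ≤ j := by exact_mod_cast h
    refine ⟨fun _ => by nlinarith, fun _ => Or.inl h⟩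

/-- An element which keeps the simple affine roots positive keeps all affine roots positive. -/
theorem apply_mem_posAff_of_simple {g : AffGL V} (hg : g ∈ extGroup hR s)
    (h : ∀ k, g (simpleAff Δ s k) ∈ posAff Δ s) {x : V × ℝ} (hx : x ∈ posAff Δ s) :
    g x ∈ posAff Δ s := by
  obtain ⟨a, w, ha, rfl⟩ := hg
  have hd := strictlyDominant_rhoEps (Δ := Δ) (s := s) hR
  set H := ⟪rt R s t, rhoEps Δ s⟫_ℝ + 1 with hH
  have hH0 : 0 < H := by
    have := (inner_rt_pos_iff (s := s) t (rhoEps Δ s)).mpr (hd.inner_root_pos ht.isPos)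
    linarith
  -- The positivity functional pulled back along g. The hypothesis on simple roots says that x' / H
  -- lies in the open fundamental alcove, which determines the sign of every affine root.
  set x' := w⁻¹ • (rhoEps Δ s - H • a) with hx'
  have key : ∀ i j, (transl a * ext w) (affVec R s i j) ∈ posAff Δ s ↔
      0 < ⟪rt R s i, x'⟫_ℝ + H * j := by
    intro i j
    obtain ⟨n, hn⟩ := ha (perm w i)
    rw [transl_mul_ext_affVec hR w j hn, affVec_mem_posAff_iff_inner hR ht, ← hH, hx',
      inner_weyl_right hR, inv_inv, ← rt_perm hR, inner_sub_right, inner_smul_right, hn]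
    push_cast
    rw [show ∀ A : ℝ, A + H * ((j : ℝ) - n) = A - H * n + H * j from fun A => by ring]
  have hx'd : StrictlyDominant Δ x' := fun r => by
    have := h (some r)
    rw [simpleAff_eq ht, key] at this
    rw [← inner_rt_pos_iff (s := s)]
    simpa [simpleIdx, simpleLevel] using this
  have h0 := h none
  rw [simpleAff_eq ht, key] at h0
  simp only [simpleIdx, simpleLevel, rt_negIdx, inner_neg_left, Int.cast_one, mul_one] at h0
  obtain ⟨i, j, hij, rfl⟩ := mem_posAff_iff.mp hx
  rw [key]
  rcases hij with hj | ⟨rfl, hi⟩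
  · have h2 := ht.inner_rt_le hR hx'd.dominant (negIdx R i)
    rw [rt_negIdx, inner_neg_left] at h2
    have : (1 : ℝ) ≤ j := by exact_mod_cast hj
    nlinarith
  · have := (inner_rt_pos_iff (s := s) i x').mpr (hx'd.inner_root_pos hi)
    simpa using this

theorem exists_neg_simple {g : AffGL V} (hg : g ∈ extGroup hR s) {x : V × ℝ}
    (hx : x ∈ invSet Δ s g) : ∃ k, -(g (simpleAff Δ s k)) ∈ posAff Δ s := by
  by_contra! h
  have := apply_mem_posAff_of_simple hR ht hg (fun k =>
    (apply_mem_or_neg_mem hR hg (simpleAff_mem_posAff ht k)).resolve_right (h k)) hx.1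
  exact neg_notMem_posAff this hx.2

end

end ExtDag

namespace ExtDag

variable {ι V N : Type*} [Fintype ι] [NormedAddCommGroup V] [InnerProductSpace ℝ V]
  [AddCommGroup N] [Module ℝ N] {R : RootPairing ι ℝ V N} {Δ : R.Base} {s : Setting}

/-! ### Elements of length zero and reduced decompositions -/

/-- The basis dual to the normalized simple roots. -/
def omegaEps [R.IsRootSystem] (Δ : R.Base) (s : Setting) (r : Δ.support) : V :=
  match s with
  | .untwisted => fundCoweight Δ r
  | .twisted => fundWeight Δ r

section

variable [R.IsRootSystem]

theorem piZero_some (r : Δ.support) : piZero Δ s (some r) = piElt Δ (omegaEps Δ s r) := by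
  cases s <;> rfl

open Classical in
theorem inner_rt_omegaEps (q r : Δ.support) :
    ⟪rt R s q, omegaEps Δ s r⟫_ℝ = if q = r then 1 else 0 := by
  cases s
  · rw [rt_untwisted, real_inner_comm]; exact inner_fundCoweight Δ r q
  · rw [rt_twisted, real_inner_comm]; exact inner_fundWeight Δ r q

theorem eq_of_inner_rt_eq {x y : V} (h : ∀ r : Δ.support, ⟪rt R s r, x⟫_ℝ = ⟪rt R s r, y⟫_ℝ) :
    x = y := by
  have h0 : ∀ v : V, ⟪v, x - y⟫_ℝ = 0 := fun v => by
    have : innerₗ V (x - y) = 0 := Δ.toWeightBasis.ext fun r => by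
      rw [Δ.toWeightBasis_apply, root_eq (s := s), innerₗ_apply_apply, real_inner_comm,
        inner_smul_left, inner_sub_right, h]
      simp
    rw [real_inner_comm, ← innerₗ_apply_apply, this, LinearMap.zero_apply]
  exact sub_eq_zero.mp (inner_self_eq_zero.mp (h0 _))

theorem eq_sum_inner_omegaEps (x : V) :
    x = ∑ r : Δ.support, ⟪x, omegaEps Δ s r⟫_ℝ • rt R s r := by
  classical
  have hx := Δ.toWeightBasis.sum_repr x
  simp only [Δ.toWeightBasis_apply] at hx
  have h2 : ∀ r, ⟪x, omegaEps Δ s r⟫_ℝ = Δ.toWeightBasis.repr x r * lv R s r := by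
    intro r
    conv_lhs => rw [← hx, sum_inner]
    rw [Finset.sum_eq_single r]
    · rw [root_eq (s := s), smul_smul, inner_smul_left, inner_rt_omegaEps, if_pos rfl]; simp
    · intro q _ hq
      rw [root_eq (s := s), smul_smul, inner_smul_left, inner_rt_omegaEps, if_neg hq]; simp
    · simp
  conv_lhs => rw [← hx]
  refine Finset.sum_congr rfl fun r _ => ?_
  rw [h2, mul_smul, ← root_eq]

theorem dominant_omegaEps (r : Δ.support) : Dominant Δ (omegaEps Δ s r) := by
  classical
  intro q
  rw [root_eq (s := s), inner_smul_left, inner_rt_omegaEps, conj_trivial]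
  exact mul_nonneg (lv_pos _).le (by split_ifs <;> norm_num)

end

section

variable (hR : IsNormalizedForm R) [R.IsCrystallographic] [R.IsRootSystem] [R.IsReduced]

theorem affLength_eq_zero_iff {g : AffGL V} (hg : g ∈ extGroup hR s) :
    affLength Δ s g = 0 ↔ ∀ x ∈ posAff Δ s, g x ∈ posAff Δ s := by
  change (invSet Δ s g).ncard = 0 ↔ _
  rw [Set.ncard_eq_zero (finite_invSet hR hg)]
  constructor
  · intro h x hx
    refine (apply_mem_or_neg_mem hR hg hx).resolve_right fun h' => ?_
    exact Set.notMem_empty x (h ▸ (⟨hx, h'⟩ : x ∈ invSet Δ s g))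
  · intro h
    refine Set.eq_empty_of_forall_notMem fun x hx => ?_
    exact neg_notMem_posAff (h x hx.1) hx.2

theorem inv_apply_mem_posAff {g : AffGL V} (hg : g ∈ extGroup hR s)
    (h : ∀ x ∈ posAff Δ s, g x ∈ posAff Δ s) {x : V × ℝ} (hx : x ∈ posAff Δ s) :
    g⁻¹ x ∈ posAff Δ s := by
  refine (apply_mem_or_neg_mem hR (inv_mem hg) hx).resolve_right fun h' => ?_
  have := h _ h'
  rw [map_neg, show g (g⁻¹ x) = x from g.apply_symm_apply x] at this
  exact neg_notMem_posAff hx this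

omit [R.IsCrystallographic] [R.IsRootSystem] [R.IsReduced] in
theorem affRefl_conj {g : AffGL V} (hg : g ∈ extGroup hR s) (a x : V × ℝ) :
    affRefl (g a) (g x) = g (affRefl a x) := by
  obtain ⟨b, w, -, rfl⟩ := hg
  rw [affRefl_apply, affRefl_apply, map_sub, map_smul]
  congr 2
  rw [transl_mul_ext_apply, transl_mul_ext_apply]
  simp only [check_weyl hR, inner_weyl hR]

omit [R.IsCrystallographic] [R.IsReduced] in
theorem inner_check_extGroup {g : AffGL V} (hg : g ∈ extGroup hR s) (a b : V × ℝ) :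
    ⟪(g a).1, check (g b).1⟫_ℝ = ⟪a.1, check b.1⟫_ℝ := by
  obtain ⟨c, w, -, rfl⟩ := hg
  rw [transl_mul_ext_apply, transl_mul_ext_apply]
  simp only [check_weyl hR, inner_weyl hR]

variable [R.IsIrreducible] {t : ι} (ht : IsTheta Δ s t)

include hR ht

/-- An element of length zero permutes the simple affine roots. -/
theorem exists_simple_eq {g : AffGL V} (hg : g ∈ extGroup hR s)
    (h : ∀ x ∈ posAff Δ s, g x ∈ posAff Δ s) (k : Option Δ.support) :
    ∃ m, g (simpleAff Δ s k) = simpleAff Δ s m := by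
  set y := g (simpleAff Δ s k) with hy
  have hyp : y ∈ posAff Δ s := h _ (simpleAff_mem_posAff ht k)
  obtain ⟨i, j, -, hij⟩ := mem_posAff_iff.mp hyp
  have hry : affRefl y ∈ extGroup hR s := by rw [hij]; exact affRefl_mem_extGroup hR i j
  have hyinv : y ∈ invSet Δ s (affRefl y) := by
    refine ⟨hyp, ?_⟩
    rwa [affRefl_self (fst_ne_zero_of_mem_posAff hyp), neg_neg]
  -- The reflection in y makes y negative, hence also some simple root α_m. If y were not α_m, then
  -- g⁻¹(α_m) would be a positive root other than α_k and s_k would keep it positive; applying g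
  -- contradicts the choice of m.
  obtain ⟨m, hm⟩ := exists_neg_simple hR ht hry hyinv
  refine ⟨m, ?_⟩
  by_contra hne
  set x := g⁻¹ (simpleAff Δ s m) with hx
  have hgx : g x = simpleAff Δ s m := g.apply_symm_apply _
  have hxp : x ∈ posAff Δ s := inv_apply_mem_posAff hR hg h (simpleAff_mem_posAff ht m)
  have hxk : x ≠ simpleAff Δ s k := fun e => hne (by rw [hy, ← e, hgx])
  have h1 := h _ (saff_apply_mem_posAff hR ht hxp hxk)
  rw [← affRefl_conj hR hg, hgx] at h1
  exact neg_notMem_posAff h1 hm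

/-- The permutation of the simple affine roots given by an element of length zero. -/
theorem exists_perm_simple {g : AffGL V} (hg : g ∈ extGroup hR s)
    (h : ∀ x ∈ posAff Δ s, g x ∈ posAff Δ s) :
    ∃ σ : Equiv.Perm (Option Δ.support), ∀ k, g (simpleAff Δ s k) = simpleAff Δ s (σ k) := by
  choose f hf using exists_simple_eq hR ht hg h
  have hinj : Function.Injective f := fun k l hkl => by
    apply simpleAff_injective ht
    apply g.injective
    rw [hf, hf, hkl]
  exact ⟨Equiv.ofBijective f (Finite.injective_iff_bijective.mp hinj), hf⟩

/-- Write g as a translation a times w. It permutes the simple affine roots by a diagram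
automorphism σ. If σ fixes 0, then w and a are trivial. Otherwise the levels of the images determine
a = ω_r with r = σ(0), and positivity of g and g⁻¹ determines w. -/
theorem exists_eq_piZero {g : AffGL V} (hg : g ∈ extGroup hR s)
    (h : ∀ x ∈ posAff Δ s, g x ∈ posAff Δ s) : ∃ r ∈ diagramOrbit Δ s, g = piZero Δ s r := by
  obtain ⟨σ, hσ⟩ := exists_perm_simple hR ht hg h
  refine ⟨σ none, ⟨σ, rfl, fun i j => by rw [← hσ, ← hσ, inner_check_extGroup hR hg]⟩, ?_⟩
  have hinvpos := fun x hx => inv_apply_mem_posAff hR hg h (x := x) hx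
  obtain ⟨a, w, ha, rfl⟩ := hg
  have hsome : ∀ p q : Δ.support, σ (some p) = some q →
      perm w p = q ∧ ⟪R.root q, a⟫_ℝ = 0 := by
    intro p q hpq
    have := hσ (some p)
    rw [hpq, transl_mul_ext_apply] at this
    simp only [simpleAff, Prod.mk.injEq, ← root_perm, zero_sub, neg_eq_zero] at this
    have h1 := R.root.injective this.1
    exact ⟨h1, by rw [← h1]; exact this.2⟩
  cases hr : σ none with
  | none =>
    have hex : ∀ p : Δ.support, ∃ q, σ (some p) = some q := by
      intro p
      rw [← Option.ne_none_iff_exists']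
      intro e
      rw [← hr] at e
      exact Option.some_ne_none p (σ.injective e)
    have hw : w = 1 := weyl_eq_one hR (Δ := Δ) fun p => by
      obtain ⟨q, hq⟩ := hex p
      rw [(hsome p q hq).1]; exact isPos_support Δ q
    have hex' : ∀ q : Δ.support, ∃ p, σ (some p) = some q := by
      intro q
      obtain ⟨k, hk⟩ := σ.surjective (some q)
      cases k with
      | none => rw [hr] at hk; exact absurd hk (by simp)
      | some p => exact ⟨p, hk⟩
    have ha0 : a = 0 := eq_of_inner_rt_eq (Δ := Δ) (s := s) fun q => by
      obtain ⟨p, hp⟩ := hex' q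
      rw [rt, inner_smul_left, inner_smul_left, (hsome p q hp).2]; simp
    rw [hw, ha0, transl_zero, ext_one]; rfl
  | some r =>
    have h0 := hσ none
    rw [hr, simpleAff_eq ht, simpleAff_eq ht] at h0
    obtain ⟨n, hn⟩ := ha (perm w (negIdx R t))
    simp only [simpleIdx, simpleLevel] at h0
    rw [transl_mul_ext_affVec hR w 1 hn, affVec_inj] at h0
    obtain ⟨h01, h02⟩ := h0
    have haω : a = omegaEps Δ s r := by
      classical
      refine eq_of_inner_rt_eq (Δ := Δ) (s := s) fun q => ?_
      rw [inner_rt_omegaEps]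
      split_ifs with hq
      · subst hq
        rw [← h01, hn, show n = 1 by omega]; simp
      · obtain ⟨k, hk⟩ := σ.surjective (some q)
        cases k with
        | none => rw [hr, Option.some.injEq] at hk; exact absurd hk.symm hq
        | some p => rw [rt, inner_smul_left, (hsome p q hk).2, mul_zero]
    have had : Dominant Δ a := by rw [haω]; exact dominant_omegaEps r
    rw [piZero_some, ← haω, piElt, ext_inv]
    congr 2
    have hu : u Δ a = w⁻¹ := by
      rw [u]
      have hh1 := (longest_spec hR (Δ := Δ) (MulAction.stabilizer R.weylGroup a)).1
      have hh2 := longest_stabilizer_mul_self hR had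
      have hh3 := fun i => not_isPos_longest hR had (i := i)
      set hl := longest Δ (MulAction.stabilizer R.weylGroup a)
      have hfix : ∀ i, ⟪R.root (perm hl i), a⟫_ℝ = ⟪R.root i, a⟫_ℝ := fun i => by
        have e : hl • a = a := hh1
        rw [root_perm]; conv_lhs => rw [← e, inner_weyl hR]
      have hint : ∀ i, ⟪R.root i, a⟫_ℝ = lv R s i * ⟪rt R s i, a⟫_ℝ := fun i => by
        conv_lhs => rw [root_eq (s := s) i, inner_smul_left, conj_trivial]
      -- A positive root orthogonal to a is made negative by `hl`, and w⁻¹ keeps the sign because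
      -- g⁻¹ preserves positivity at level 0. If the root pairs positively with a, a positive image
      -- would be sent by g to a negative level.
      have key : w⁻¹ * hl = w0 Δ := by
        refine eq_w0 hR fun i hi => ?_
        rw [perm_mul]
        rcases (had.inner_root_nonneg hi).eq_or_lt with e | e
        · have e1 := hh3 i hi e.symm
          rw [← isPos_negIdx] at e1
          have e2 : affVec R s (negIdx R (perm hl i)) 0 ∈ posAff Δ s :=
            affVec_mem_posAff.mpr (Or.inr ⟨rfl, e1⟩)
          have e3 : (transl a * ext w)⁻¹ (affVec R s (negIdx R (perm hl i)) 0) =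
              affVec R s (perm w⁻¹ (negIdx R (perm hl i))) 0 := by
            rw [← (transl a * ext w).injective.eq_iff,
              show (transl a * ext w) ((transl a * ext w)⁻¹ (affVec R s (negIdx R (perm hl i)) 0)) =
                affVec R s (negIdx R (perm hl i)) 0 from LinearEquiv.apply_symm_apply _ _,
              transl_mul_ext_affVec hR w (n := 0), perm_perm_inv, sub_zero]
            rw [perm_perm_inv, rt_negIdx, rt, inner_neg_left, inner_smul_left, hfix, ← e]
            simp
          have e4 := hinvpos _ e2
          rw [e3, affVec_mem_posAff, perm_negIdx, isPos_negIdx] at e4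
          simpa using e4
        · intro hp
          obtain ⟨m, hm⟩ := ha (perm hl i)
          have e2 := h _ (affVec_mem_posAff.mpr (Or.inr ⟨rfl, hp⟩) :
            affVec R s (perm w⁻¹ (perm hl i)) 0 ∈ posAff Δ s)
          rw [transl_mul_ext_affVec hR w (n := m) _ (by rw [perm_perm_inv, hm]),
            affVec_mem_posAff] at e2
          have e3 : (0 : ℝ) < m := by
            rw [← hfix, hint, hm] at e
            exact (mul_pos_iff_of_pos_left (lv_pos _)).mp e
          have e4 : 0 < m := by exact_mod_cast e3
          omega
      rw [← key, mul_assoc, hh2, mul_one]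
    rw [hu, inv_inv]

theorem isCoweight_omegaEps (r : Δ.support) : IsCoweight R s (omegaEps Δ s r) := by
  classical
  refine fun i => exists_int_inner_rt hR (fun q => ⟨if q = r then 1 else 0, ?_⟩) i
  rw [inner_rt_omegaEps]; split_ifs <;> simp

theorem piElt_mem_extGroup {a : V} (ha : IsCoweight R s a) : piElt Δ a ∈ extGroup hR s :=
  ⟨a, _, ha, by rw [piElt, ext_inv]⟩

theorem piZero_mem_extGroup (r : Option Δ.support) : piZero Δ s r ∈ extGroup hR s := by
  cases r with
  | none => exact one_mem _
  | some r => rw [piZero_some]; exact piElt_mem_extGroup hR ht (isCoweight_omegaEps hR ht r)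

omit ht [R.IsIrreducible] in
/-- The vectors `-θ`, `α_i` in normalized form. -/
def simpleRt (Δ : R.Base) (s : Setting) (t : ι) (k : Option Δ.support) : V :=
  rt R s (simpleIdx Δ t k)

omit [R.IsIrreducible] in
/-- The vertices in the orbit of the zeroth one are minuscule. -/
theorem inner_rt_theta_omegaEps {r : Δ.support} (hr : some r ∈ diagramOrbit Δ s) :
    ⟪rt R s t, omegaEps Δ s r⟫_ℝ = 1 := by
  classical
  obtain ⟨σ, hσ0, hσ⟩ := hr
  let v : Option Δ.support → V := simpleRt Δ s t
  have hfst : ∀ k, (simpleAff Δ s k).1 = R.root (simpleIdx Δ t k) := fun k => by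
    rw [simpleAff_eq ht]; rfl
  have hσ' : ∀ i j, ⟪v (σ i), check (v (σ j))⟫_ℝ = ⟪v i, check (v j)⟫_ℝ := by
    intro i j
    simp only [hfst] at hσ
    cases s with
    | untwisted => simp only [v, simpleRt, rt_untwisted]; exact hσ i j
    | twisted =>
      simp only [v, simpleRt, rt_twisted, check_check]
      rw [real_inner_comm, hσ j i, real_inner_comm]
  -- The marks of the completed diagram, that is, the coefficients of the linear relation among its
  -- vertices, normalized to 1 at the zeroth vertex.
  let m : Option Δ.support → ℝ := fun k => k.elim 1 fun q => ⟪rt R s t, omegaEps Δ s q⟫_ℝ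
  have hrel : ∑ k, m k • v k = 0 := by
    rw [Fintype.sum_option]
    simp only [m, v, simpleRt, simpleIdx, Option.elim, rt_negIdx]
    rw [← eq_sum_inner_omegaEps, one_smul, neg_add_cancel]
  -- Since σ preserves all pairings, the permuted sum is orthogonal to every simple root.
  have hrel2 : ∑ k, m k • v (σ k) = 0 := by
    refine eq_of_inner_rt_eq (Δ := Δ) (s := s) fun q => ?_
    obtain ⟨j, hj⟩ := σ.surjective (some q)
    have h1 : ⟪∑ k, m k • v (σ k), check (v (σ j))⟫_ℝ = 0 := by
      rw [sum_inner]
      simp only [inner_smul_left, hσ']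
      rw [← inner_zero_left (𝕜 := ℝ) (check (v j)), ← hrel, sum_inner]
      simp only [inner_smul_left]
    rw [hj] at h1
    have h2 : v (some q) = rt R s q := rfl
    rw [h2, check, inner_smul_right] at h1
    rw [inner_zero_right, real_inner_comm]
    refine (mul_eq_zero.mp h1).resolve_left (div_ne_zero two_ne_zero ?_)
    exact inner_self_ne_zero.mpr (rt_ne_zero _)
  have hrel3 : ∑ k, m (σ.symm k) • v k = 0 := by
    rw [← hrel2, ← Equiv.sum_comp σ]
    simp
  -- The relations among the vertices form a line, so the permuted marks are proportional to the
  -- original ones. Summing over all vertices shows that the factor is 1.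
  have hm : ∀ k, m (σ.symm k) = m (σ.symm none) * m k := by
    intro k
    cases k with
    | none => simp [m]
    | some q =>
      have h1 : ⟪∑ k, m (σ.symm k) • v k, omegaEps Δ s q⟫_ℝ = 0 := by rw [hrel3, inner_zero_left]
      rw [sum_inner, Fintype.sum_option] at h1
      simp only [v, simpleRt, simpleIdx, rt_negIdx, inner_smul_left, inner_neg_left,
        inner_rt_omegaEps, conj_trivial] at h1
      simp only [mul_ite, mul_one, mul_zero, Finset.sum_ite_eq', Finset.mem_univ, if_true] at h1
      change _ = _ * ⟪rt R s t, omegaEps Δ s q⟫_ℝ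
      linarith
  have hm0 : ∀ k, 0 ≤ m k := by
    intro k
    cases k with
    | none => simp [m]
    | some q =>
      change 0 ≤ ⟪rt R s t, omegaEps Δ s q⟫_ℝ
      rw [rt, inner_smul_left]
      exact mul_nonneg (by simpa using (lv_pos (R := R) (s := s) t).le)
        ((dominant_omegaEps q).inner_root_nonneg ht.isPos)
  have hsum : ∑ k, m k = m (σ.symm none) * ∑ k, m k := by
    rw [Finset.mul_sum, ← Equiv.sum_comp σ.symm]
    exact Finset.sum_congr rfl fun k _ => hm k
  have hsumpos : 0 < ∑ k, m k :=
    Finset.sum_pos' (fun k _ => hm0 k) ⟨none, Finset.mem_univ _, by simp [m]⟩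
  have hc : m (σ.symm none) = 1 := by
    have : (m (σ.symm none) - 1) * ∑ k, m k = 0 := by rw [sub_mul, ← hsum]; ring
    have := (mul_eq_zero.mp this).resolve_right hsumpos.ne'
    linarith
  have := hm (some r)
  rw [hc, one_mul, ← hσ0, σ.symm_apply_apply] at this
  rw [hσ0] at this
  exact this.symm

theorem affLength_piZero {r : Option Δ.support} (hr : r ∈ diagramOrbit Δ s) :
    affLength Δ s (piZero Δ s r) = 0 := by
  rw [affLength_eq_zero_iff hR (piZero_mem_extGroup hR ht r)]
  cases r with
  | none => exact fun x hx => hx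
  | some r =>
    have hθ := inner_rt_theta_omegaEps hR ht hr
    have hω := isCoweight_omegaEps hR ht r
    have hd := dominant_omegaEps (Δ := Δ) (s := s) r
    rw [piZero_some]
    set a := omegaEps Δ s r
    have hh1 := (longest_spec hR (Δ := Δ) (MulAction.stabilizer R.weylGroup a)).1
    have hh3 := fun i => not_isPos_longest hR hd (i := i)
    have hpi : piElt Δ a = transl a * ext (u Δ a)⁻¹ := by rw [piElt, ext_inv]
    have hperm : ∀ k, perm (u Δ a) k =
        perm (w0 Δ) (perm (longest Δ (MulAction.stabilizer R.weylGroup a)) k) := fun k => by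
      rw [u, perm_mul]
    set hl := longest Δ (MulAction.stabilizer R.weylGroup a)
    have hfix : ∀ i, ⟪R.root (perm hl i), a⟫_ℝ = ⟪R.root i, a⟫_ℝ := fun i => by
      have e : hl • a = a := hh1
      rw [root_perm]; conv_lhs => rw [← e, inner_weyl hR]
    have hpos : ∀ k, 0 < ⟪R.root k, a⟫_ℝ → Δ.IsPos k := by
      intro k hk
      by_contra hn
      rw [← isPos_negIdx] at hn
      have := hd.inner_root_nonneg hn
      rw [root_negIdx, inner_neg_left] at this
      linarith
    intro x hx
    obtain ⟨i, j, hij, rfl⟩ := mem_posAff_iff.mp hx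
    obtain ⟨k, rfl⟩ : ∃ k, i = perm (u Δ a) k := ⟨perm (u Δ a)⁻¹ i, (perm_perm_inv _ _).symm⟩
    obtain ⟨c, hc⟩ := hω k
    rw [hpi, transl_mul_ext_affVec hR _ (n := c) _ (by rw [perm_inv_perm, hc]), perm_inv_perm,
      affVec_mem_posAff]
    have hcroot : ⟪R.root k, a⟫_ℝ = lv R s k * c := by
      rw [root_eq (s := s) k, inner_smul_left, hc, conj_trivial]
    -- Minuscularity: a level lowered from at least 1 stays nonnegative, and level 0 is reached this
    -- way only by roots pairing positively with ω_r, which are positive.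
    have hc1 : c ≤ 1 := by
      have := ht.inner_rt_le hR hd k
      rw [hc, hθ] at this
      exact_mod_cast this
    have hcpos : 0 < c → 0 < ⟪R.root k, a⟫_ℝ := fun h => by
      rw [hcroot]; exact mul_pos (lv_pos k) (by exact_mod_cast h)
    rcases hij with hj | ⟨rfl, hi⟩
    · rcases lt_or_ge 0 c with h | h
      · rcases lt_or_ge 0 (j - c) with h' | h'
        · exact Or.inl h'
        · exact Or.inr ⟨by omega, hpos k (hcpos h)⟩
      · left; omega
    · rw [hperm, isPos_w0_iff hR] at hi
      rcases lt_trichotomy c 0 with h | rfl | h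
      · left; omega
      · refine Or.inr ⟨rfl, ?_⟩
        by_contra hn
        rw [← isPos_negIdx] at hn
        have := hh3 _ hn (by rw [root_negIdx, inner_neg_left, hcroot]; simp)
        rw [perm_negIdx, isPos_negIdx, not_not] at this
        exact hi this
      · exact absurd (hpos _ (by rw [hfix]; exact hcpos h)) hi

/-- The product of simple affine reflections along a word. -/
abbrev word (Δ : R.Base) (s : Setting) (L : List (Option Δ.support)) : AffGL V :=
  (L.map fun k => affRefl (simpleAff Δ s k)).prod

theorem piZero_mul_word_mem_extGroup (r : Option Δ.support) (L : List (Option Δ.support)) :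
    piZero Δ s r * word Δ s L ∈ extGroup hR s := by
  refine mul_mem (piZero_mem_extGroup hR ht r) (list_prod_mem fun g hg => ?_)
  obtain ⟨k, -, rfl⟩ := List.mem_map.mp hg
  exact saff_mem_extGroup hR ht k

theorem affLength_piZero_mul_word_le {r : Option Δ.support} (hr : r ∈ diagramOrbit Δ s)
    (L : List (Option Δ.support)) : affLength Δ s (piZero Δ s r * word Δ s L) ≤ L.length := by
  induction L using List.reverseRecOn with
  | nil => simp [word, affLength_piZero hR ht hr]
  | append_singleton L k ih =>
    have := affLength_mul_saff_le hR ht (piZero_mul_word_mem_extGroup hR ht r L) k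
    rw [word, List.map_append, List.prod_append, ← mul_assoc, List.length_append]
    simp only [List.map_cons, List.map_nil, List.prod_singleton, List.length_singleton]
    exact this.trans (Nat.add_le_add_right ih 1)

/-- An element of positive length makes some simple affine root negative; stripping off that
reflection lowers the length, and at length zero some π_r remains. -/
theorem exists_isReducedDecomp {g : AffGL V} (hg : g ∈ extGroup hR s) :
    ∃ r L, IsReducedDecomp Δ s g r L := by
  induction hn : affLength Δ s g generalizing g with
  | zero =>
    obtain ⟨r, hr, rfl⟩ := exists_eq_piZero hR ht hg ((affLength_eq_zero_iff hR hg).mp hn)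
    exact ⟨r, [], hr, by simp, by simp [hn]⟩
  | succ n ih =>
    obtain ⟨x, hx⟩ : (invSet Δ s g).Nonempty := by
      apply Set.nonempty_of_ncard_ne_zero
      change affLength Δ s g ≠ 0
      omega
    obtain ⟨k, hk⟩ := exists_neg_simple hR ht hg hx
    have h1 := affLength_mul_saff_of_neg hR ht hg hk
    obtain ⟨r, L, hr, h2, h3⟩ := ih (mul_mem hg (saff_mem_extGroup hR ht k)) (by omega)
    refine ⟨r, L ++ [k], hr, ?_, ?_⟩
    · rw [List.map_append, List.prod_append, ← mul_assoc, ← h2]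
      simp [mul_assoc, affRefl_mul_self]
    · rw [List.length_append, h3, ← h1]; rfl

theorem IsReducedDecomp.of_append {g : AffGL V} {r k : Option Δ.support}
    {L : List (Option Δ.support)} (h : IsReducedDecomp Δ s g r (L ++ [k])) :
    IsReducedDecomp Δ s (g * saff Δ s k) r L ∧ -(g (simpleAff Δ s k)) ∈ posAff Δ s := by
  obtain ⟨hr, hg, hl⟩ := h
  have hg' : g * saff Δ s k = piZero Δ s r * word Δ s L := by
    rw [hg, List.map_append, List.prod_append]
    simp [mul_assoc, affRefl_mul_self]
  have h0 := affLength_piZero_mul_word_le hR ht hr L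
  have hm : g ∈ extGroup hR s := by rw [hg]; exact piZero_mul_word_mem_extGroup hR ht r _
  rw [List.length_append, List.length_singleton] at hl
  rw [← hg'] at h0
  rcases apply_mem_or_neg_mem hR hm (simpleAff_mem_posAff ht k) with h1 | h1
  · have := affLength_mul_saff hR ht hm h1
    omega
  · have := affLength_mul_saff_of_neg hR ht hm h1
    exact ⟨⟨hr, hg', by omega⟩, h1⟩

end

end ExtDag

namespace ExtDag

variable {ι V N : Type*} [Fintype ι] [NormedAddCommGroup V] [InnerProductSpace ℝ V]
  [AddCommGroup N] [Module ℝ N] {R : RootPairing ι ℝ V N} {Δ : R.Base} {s : Setting}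

/-! ### The operators `𝕋♮` as transposes of maps of points -/

/-- The pairing with the coroot of an affine root. -/
def pr (a z : V × ℝ) : ℝ := ⟪z.1, check a.1⟫_ℝ

/-- The map of `V × ℝ` which reflects a point into the half-space where the affine root `a`
is nonpositive. -/
def phi (a z : V × ℝ) : V × ℝ :=
  open Classical in if 0 < pr a z then affRefl a z else z

/-- The coefficient of `X_c` in `q ^ (-ζ) f`, at the point `[c, ζ]`. -/
def ev (z : V × ℝ) : Laurent V →ₗ[Coeff] Coeff :=
  (qPow (-z.2)) • (Finsupp.lapply z.1 ∘ₗ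
    (AddMonoidAlgebra.coeffLinearEquiv Coeff : Laurent V ≃ₗ[Coeff] (V →₀ Coeff)).toLinearMap)

theorem ev_apply (z : V × ℝ) (f : Laurent V) : ev z f = qPow (-z.2) * f.coeff z.1 := rfl

open Classical in
theorem ev_X (z : V × ℝ) (b : V) : ev z (X b) = if b = z.1 then qPow (-z.2) else 0 := by
  rw [ev_apply, X, AddMonoidAlgebra.coeff_single, Finsupp.single_apply, mul_ite, mul_one, mul_zero]

theorem qPow_mul (a b : ℝ) : qPow a * qPow b = qPow (a + b) := by
  simp [qPow]

theorem qPow_zero : qPow 0 = 1 := rfl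

theorem laurent_ext {f g : Laurent V} (h : ∀ c : V, ev (c, 0) f = ev (c, 0) g) : f = g := by
  apply AddMonoidAlgebra.coeff_injective
  ext1 c
  simpa [ev_apply, qPow_zero] using h c

theorem laurent_hom_ext {M : Type*} [AddCommMonoid M] [Module Coeff M]
    {f g : Laurent V →ₗ[Coeff] M} (h : ∀ b, f (X b) = g (X b)) : f = g := by
  ext b
  exact h b

open Classical in
theorem ev_XAff (z y : V × ℝ) : ev z (XAff y) = if y.1 = z.1 then qPow (y.2 - z.2) else 0 := by
  rw [XAff, map_smul, ev_X, smul_eq_mul, mul_ite, mul_zero, qPow_mul, sub_eq_add_neg]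

theorem act_X (g : AffGL V) (b : V) : act g (X b) = XAff (g (b, 0)) := ofMonomials_X _ _

theorem ev_act_X (hR : IsNormalizedForm R) {g : AffGL V} (hg : g ∈ extGroup hR s) (z : V × ℝ)
    (b : V) : ev z (act g (X b)) = ev (g⁻¹ z) (X b) := by
  obtain ⟨y, rfl⟩ : ∃ y, z = g y := ⟨g⁻¹ z, (g.apply_symm_apply z).symm⟩
  rw [show g⁻¹ (g y) = y from g.symm_apply_apply y, act_X]
  obtain ⟨a, w, -, rfl⟩ := hg
  rw [ev_XAff, ev_X, transl_mul_ext_apply, transl_mul_ext_apply]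
  have hw : (w • b = w • y.1) ↔ b = y.1 := (MulAction.injective w).eq_iff
  by_cases h : b = y.1
  · rw [if_pos (hw.mpr h), if_pos h]
    subst h
    congr 1
    ring
  · rw [if_neg (mt hw.mp h), if_neg h]

/-- The transpose of `act g` is g⁻¹ on points, because elements of the extended group fix the
direction [0, 1]. -/
theorem ev_act (hR : IsNormalizedForm R) {g : AffGL V} (hg : g ∈ extGroup hR s) (z : V × ℝ)
    (f : Laurent V) : ev z (act g f) = ev (g⁻¹ z) f :=
  LinearMap.congr_fun (laurent_hom_ext (f := ev z ∘ₗ act g) (g := ev (g⁻¹ z))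
    fun b => ev_act_X hR hg z b) f

theorem pr_affRefl_self {a : V × ℝ} (ha : a.1 ≠ 0) (z : V × ℝ) :
    pr a (affRefl a z) = -pr a z := by
  simp only [pr, affRefl_apply, Prod.fst_sub, Prod.smul_fst, inner_sub_left, inner_smul_left,
    inner_self_check ha, conj_trivial]
  ring

/-- Exactly one monomial contributes at each point. On the nonpositive side of a it is the monomial
of the point itself; on the positive side it is that of the reflected point. This is why the
coefficients of 𝔗(M_b) are single powers of q and not sums. -/
theorem ev_tNat (hR : IsNormalizedForm R) {a : V × ℝ} (ha : a.1 ≠ 0)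
    (hg : affRefl a ∈ extGroup hR s) (z : V × ℝ) (f : Laurent V) :
    ev z (tNat a f) = ev (phi a z) f := by
  refine LinearMap.congr_fun (laurent_hom_ext (f := ev z ∘ₗ tNat a) (g := ev (phi a z))
    fun b => ?_) f
  have hc : 0 < 2 / ⟪a.1, a.1⟫_ℝ := div_pos two_pos (real_inner_self_pos.mpr ha)
  have hb : ∀ c : V, pr a (c, 0) = 2 / ⟪a.1, a.1⟫_ℝ * ⟪c, a.1⟫_ℝ := fun c => by
    rw [pr, check, inner_smul_right]
  have hpr : ∀ y : V × ℝ, pr a y = pr a (y.1, 0) := fun y => rfl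
  have hinv : (affRefl a)⁻¹ = affRefl a := inv_eq_of_mul_eq_one_left (affRefl_mul_self a)
  have h1 : ∀ y, ev y (act (affRefl a) (X b)) = ev (affRefl a y) (X b) := fun y => by
    rw [ev_act_X hR hg, hinv]
  have hz : ∀ y : V × ℝ, pr a y ≠ pr a (b, 0) → ev y (X b) = 0 := fun y hy => by
    classical
    rw [ev_X, if_neg]
    rintro rfl
    exact hy rfl
  rw [LinearMap.comp_apply, tNat, ofMonomials_X, phi]
  have hs := pr_affRefl_self ha z
  rcases lt_trichotomy ⟪b, a.1⟫_ℝ 0 with hneg | hzero | hpos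
  · have hb' : pr a (b, 0) < 0 := by rw [hb]; exact mul_neg_of_pos_of_neg hc hneg
    rw [if_pos hneg, map_add, h1]
    split_ifs with h
    · rw [hz z (by linarith), add_zero]
    · rw [hz (affRefl a z) (by linarith), zero_add]
  · have hb' : pr a (b, 0) = 0 := by rw [hb, hzero, mul_zero]
    rw [if_neg (by linarith), if_pos hzero]
    split_ifs with h
    · rw [hz z (by linarith), hz (affRefl a z) (by linarith)]
    · rfl
  · have hb' : 0 < pr a (b, 0) := by rw [hb]; exact mul_pos hc hpos
    rw [if_neg (by linarith), if_neg (by linarith), map_zero]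
    split_ifs with h
    · rw [hz (affRefl a z) (by linarith)]
    · rw [hz z (by linarith)]

/-- The composition of the maps `phi` along a word, the first letter acting first. -/
def phiWord (Δ : R.Base) (s : Setting) (L : List (Option Δ.support)) (z : V × ℝ) : V × ℝ :=
  L.foldl (fun z k => phi (simpleAff Δ s k) z) z

theorem phiWord_append (L L' : List (Option Δ.support)) (z : V × ℝ) :
    phiWord Δ s (L ++ L') z = phiWord Δ s L' (phiWord Δ s L z) := List.foldl_append

theorem phiWord_cons (k : Option Δ.support) (L : List (Option Δ.support)) (z : V × ℝ) :
    phiWord Δ s (k :: L) z = phiWord Δ s L (phi (simpleAff Δ s k) z) := rfl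

variable (hR : IsNormalizedForm R) [R.IsCrystallographic] [R.IsRootSystem] [R.IsReduced]
  [R.IsIrreducible] {t : ι} (ht : IsTheta Δ s t)

include hR ht

theorem ev_tNat_word (L : List (Option Δ.support)) (z : V × ℝ) (f : Laurent V) :
    ev z ((L.map fun i => tNat (simpleAff Δ s i)).prod f) = ev (phiWord Δ s L z) f := by
  induction L generalizing z with
  | nil => rfl
  | cons k L ih =>
    rw [List.map_cons, List.prod_cons, Module.End.mul_apply, ev_tNat hR
      (fst_ne_zero_of_mem_posAff (simpleAff_mem_posAff ht k)) (saff_mem_extGroup hR ht k), ih,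
      phiWord_cons]

theorem ev_tWord (r : Option Δ.support) (L : List (Option Δ.support)) (z : V × ℝ)
    (f : Laurent V) :
    ev z (tWord Δ s r L f) = ev (phiWord Δ s L ((piZero Δ s r)⁻¹ z)) f := by
  rw [tWord, Module.End.mul_apply, ev_act hR (piZero_mem_extGroup hR ht r), ev_tNat_word hR ht]

end ExtDag

namespace ExtDag

/-! ### Dihedral configurations -/

/-- The alternating composition of `k` maps, starting with `f`. -/
def alt {α : Type*} (f g : α → α) : ℕ → α → α
  | 0, z => z
  | k + 1, z => alt g f k (f z)

/-- Positivity of the successive pairings of a point along alternating reflections. -/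
def AltPos (p q : ℝ) : ℕ → ℝ → ℝ → Prop
  | 0, _, _ => True
  | k + 1, x, y => 0 < x ∧ AltPos q p k (y - x * p) (-x)

/-- The last pairing of a point along alternating reflections. -/
def altEnd (p q : ℝ) : ℕ → ℝ → ℝ → ℝ
  | 0, x, _ => x
  | k + 1, x, y => altEnd q p k (y - x * p) (-x)

/-- The numerical properties of the Cartan integers of a dihedral group of order `2 (m + 1)`. -/
structure IsDihedral (p q : ℝ) (m : ℕ) : Prop where
  pos : ∀ x y, 0 < x → 0 < y → AltPos p q (m + 1) x y
  pos' : ∀ x y, 0 < x → 0 < y → AltPos q p (m + 1) x y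
  last : ∀ x y, altEnd q p m y x = x
  last' : ∀ x y, altEnd p q m y x = x

theorem IsDihedral.symm {p q : ℝ} {m : ℕ} (h : IsDihedral p q m) : IsDihedral q p m :=
  ⟨h.pos', h.pos, h.last', h.last⟩

theorem isDihedral_two : IsDihedral 0 0 1 := by
  constructor <;> intros <;> simp only [AltPos, altEnd] <;>
    first | ring1 | (and_intros <;> first | trivial | linarith)

theorem isDihedral_three : IsDihedral (-1) (-1) 2 := by
  constructor <;> intros <;> simp only [AltPos, altEnd] <;>
    first | ring1 | (and_intros <;> first | trivial | linarith)

theorem isDihedral_four : IsDihedral (-1) (-2) 3 := by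
  constructor <;> intros <;> simp only [AltPos, altEnd] <;>
    first | ring1 | (and_intros <;> first | trivial | linarith)

theorem isDihedral_six : IsDihedral (-1) (-3) 5 := by
  constructor <;> intros <;> simp only [AltPos, altEnd] <;>
    first | ring1 | (and_intros <;> first | trivial | linarith)

variable {V : Type*} [NormedAddCommGroup V] [InnerProductSpace ℝ V]

theorem pr_affRefl (a b z : V × ℝ) :
    pr b (affRefl a z) = pr b z - pr a z * ⟪a.1, check b.1⟫_ℝ := by
  simp only [pr, affRefl_apply, Prod.fst_sub, Prod.smul_fst, inner_sub_left, inner_smul_left,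
    conj_trivial]

theorem affRefl_combination {a b : V × ℝ} (ha : a.1 ≠ 0) (z : V × ℝ) (c d : ℝ) :
    affRefl a (z + c • a + d • b) =
      z + (-pr a z - c - d * ⟪b.1, check a.1⟫_ℝ) • a + d • b := by
  rw [affRefl_apply]
  have : ⟪(z + c • a + d • b).1, check a.1⟫_ℝ = pr a z + c * 2 + d * ⟪b.1, check a.1⟫_ℝ := by
    simp only [pr, Prod.fst_add, Prod.smul_fst, inner_add_left, inner_smul_left,
      inner_self_check ha, conj_trivial]
  rw [this]
  module

theorem affRefl_combination' {a b : V × ℝ} (hb : b.1 ≠ 0) (z : V × ℝ) (c d : ℝ) :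
    affRefl b (z + c • a + d • b) =
      z + c • a + (-pr b z - d - c * ⟪a.1, check b.1⟫_ℝ) • b := by
  rw [add_right_comm, affRefl_combination hb, add_right_comm]

/-- The point moves only by multiples of a and b, so both sides of the braid relation are compared
through their coefficients. -/
theorem alt_affRefl_comm {a b : V × ℝ} (ha : a.1 ≠ 0) (hb : b.1 ≠ 0) {m : ℕ}
    (h : (⟪a.1, check b.1⟫_ℝ = 0 ∧ ⟪b.1, check a.1⟫_ℝ = 0 ∧ m = 1) ∨
      (⟪a.1, check b.1⟫_ℝ = -1 ∧ ⟪b.1, check a.1⟫_ℝ = -1 ∧ m = 2) ∨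
      (⟪a.1, check b.1⟫_ℝ = -1 ∧ ⟪b.1, check a.1⟫_ℝ = -2 ∧ m = 3) ∨
      (⟪a.1, check b.1⟫_ℝ = -1 ∧ ⟪b.1, check a.1⟫_ℝ = -3 ∧ m = 5)) (z : V × ℝ) :
    alt (affRefl a) (affRefl b) (m + 1) z = alt (affRefl b) (affRefl a) (m + 1) z := by
  obtain ⟨z', hz⟩ : ∃ z', z' = z := ⟨z, rfl⟩
  have h0 : z = z' + (0 : ℝ) • a + (0 : ℝ) • b := by rw [hz]; module
  rw [h0]
  rcases h with ⟨h1, h2, rfl⟩ | ⟨h1, h2, rfl⟩ | ⟨h1, h2, rfl⟩ | ⟨h1, h2, rfl⟩ <;>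
  · simp only [alt, affRefl_combination ha, affRefl_combination' hb, h1, h2]
    congr 1
    · congr 2; ring
    · congr 1; ring

theorem phi_of_nonpos {a z : V × ℝ} (h : pr a z ≤ 0) : phi a z = z := if_neg h.not_gt

theorem phi_of_pos {a z : V × ℝ} (h : 0 < pr a z) : phi a z = affRefl a z := if_pos h

theorem alt_of_fixed {α : Type*} {f g : α → α} {z : α} (hf : f z = z) (hg : g z = z) (k : ℕ) :
    alt f g k z = z := by
  induction k generalizing f g with
  | zero => rfl
  | succ k ih => rw [alt, hf, ih hg hf]

/-- Which map acts last depends on the parity of k; the alternative avoids keeping track of it. -/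
theorem alt_succ {α : Type*} (f g : α → α) (k : ℕ) (z : α) :
    alt f g (k + 1) z = f (alt f g k z) ∨ alt f g (k + 1) z = g (alt f g k z) := by
  induction k generalizing f g z with
  | zero => exact Or.inl rfl
  | succ k ih =>
    rw [alt, alt]
    exact (ih g f (f z)).symm

theorem alt_phi_of_altPos {a b : V × ℝ} (ha : a.1 ≠ 0) (hb : b.1 ≠ 0) (k : ℕ) (z : V × ℝ)
    (h : AltPos ⟪a.1, check b.1⟫_ℝ ⟪b.1, check a.1⟫_ℝ k (pr a z) (pr b z)) :
    alt (phi a) (phi b) k z = alt (affRefl a) (affRefl b) k z := by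
  induction k generalizing a b z with
  | zero => rfl
  | succ k ih =>
    rw [alt, alt, phi_of_pos h.1]
    refine ih hb ha _ ?_
    rw [pr_affRefl, pr_affRefl_self ha]
    exact h.2

/-- Alternating the maps `phi` ends in the closed antidominant chamber. -/
theorem alt_phi_antidominant {a b : V × ℝ} (ha : a.1 ≠ 0) (hb : b.1 ≠ 0) (k : ℕ) (z : V × ℝ)
    (h0 : pr b z ≤ 0)
    (h : altEnd ⟪a.1, check b.1⟫_ℝ ⟪b.1, check a.1⟫_ℝ k (pr a z) (pr b z) ≤ 0) :
    pr a (alt (phi a) (phi b) k z) ≤ 0 ∧ pr b (alt (phi a) (phi b) k z) ≤ 0 := by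
  induction k generalizing a b z with
  | zero => exact ⟨h, h0⟩
  | succ k ih =>
    -- Only the pairing with the next letter can be positive; once it is not, the point is in the
    -- chamber and no folding moves it.
    rcases le_or_gt (pr a z) 0 with h1 | h1
    · rw [alt_of_fixed (phi_of_nonpos h1) (phi_of_nonpos h0)]
      exact ⟨h1, h0⟩
    · rw [alt, phi_of_pos h1]
      refine (ih hb ha _ ?_ ?_).symm
      · rw [pr_affRefl_self ha]; linarith
      · rw [pr_affRefl, pr_affRefl_self ha]; exact h

/-- If both pairings are positive, all foldings on both sides are genuine reflections and the braid
relation of the group applies. Otherwise one side begins with a trivial folding, and its other m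
foldings already reach the antidominant chamber, where the extra final folding of the other side is
trivial too. -/
theorem alt_phi_comm {a b : V × ℝ} (ha : a.1 ≠ 0) (hb : b.1 ≠ 0) {m : ℕ}
    (h : IsDihedral ⟪a.1, check b.1⟫_ℝ ⟪b.1, check a.1⟫_ℝ m)
    (hs : ∀ z, alt (affRefl a) (affRefl b) (m + 1) z = alt (affRefl b) (affRefl a) (m + 1) z)
    (z : V × ℝ) : alt (phi a) (phi b) (m + 1) z = alt (phi b) (phi a) (m + 1) z := by
  have half : ∀ {a b : V × ℝ}, a.1 ≠ 0 → b.1 ≠ 0 →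
      IsDihedral ⟪a.1, check b.1⟫_ℝ ⟪b.1, check a.1⟫_ℝ m → pr a z ≤ 0 →
      alt (phi a) (phi b) (m + 1) z = alt (phi b) (phi a) (m + 1) z := by
    intro a b ha hb h h1
    obtain ⟨h2, h3⟩ := alt_phi_antidominant hb ha m z h1 (by rw [h.last]; exact h1)
    rw [alt, phi_of_nonpos h1]
    rcases alt_succ (phi b) (phi a) m z with e | e
    · rw [e, phi_of_nonpos h2]
    · rw [e, phi_of_nonpos h3]
  rcases le_or_gt (pr a z) 0 with h1 | h1
  · exact half ha hb h h1
  rcases le_or_gt (pr b z) 0 with h2 | h2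
  · exact (half hb ha h.symm h2).symm
  rw [alt_phi_of_altPos ha hb _ _ (h.pos _ _ h1 h2), hs,
    alt_phi_of_altPos hb ha _ _ (h.pos' _ _ h2 h1)]

end ExtDag

namespace ExtDag

/-! ### Independence of the reduced decomposition -/

/-- The alternating composition of `k` maps, ending with `f`. -/
def altOut {α : Type*} (f g : α → α) : ℕ → α → α
  | 0, z => z
  | k + 1, z => f (altOut g f k z)

/-- The two alternatives are k even and k odd. Each holds for all pairs of maps, so both sides of a
braid relation fall into the same case. -/
theorem altOut_eq_alt {α : Type*} (k : ℕ) :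
    (∀ (f g : α → α) (z : α), altOut f g k z = alt g f k z ∧
      altOut f g (k + 1) z = alt f g (k + 1) z) ∨
    (∀ (f g : α → α) (z : α), altOut f g k z = alt f g k z ∧
      altOut f g (k + 1) z = alt g f (k + 1) z) := by
  induction k with
  | zero => exact Or.inl fun f g z => ⟨rfl, rfl⟩
  | succ k ih =>
    rcases ih with ih | ih
    · refine Or.inr fun f g z => ⟨(ih f g z).2, ?_⟩
      rw [altOut, (ih g f z).2, alt, alt, ← (ih f g (g z)).2, altOut, (ih g f (g z)).1]
    · refine Or.inl fun f g z => ⟨(ih f g z).2, ?_⟩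
      rw [altOut, (ih g f z).2, alt, alt, ← (ih f g (f z)).2, altOut, (ih g f (f z)).1]

theorem altOut_comm {α : Type*} {f g : α → α} {k : ℕ} (h : ∀ z, alt f g k z = alt g f k z)
    (z : α) : altOut f g k z = altOut g f k z := by
  rcases altOut_eq_alt (α := α) k with e | e
  · rw [(e f g z).1, (e g f z).1, h]
  · rw [(e f g z).1, (e g f z).1, h]

variable {ι V N : Type*} [Fintype ι] [NormedAddCommGroup V] [InnerProductSpace ℝ V]
  [AddCommGroup N] [Module ℝ N] {R : RootPairing ι ℝ V N} {Δ : R.Base} {s : Setting}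

/-- The linear functional `(·, ρ) + h ζ`, where `h` is the Coxeter number. -/
def height (Δ : R.Base) (s : Setting) (t : ι) : (V × ℝ) →ₗ[ℝ] ℝ :=
  (innerₗ V (rhoEps Δ s)) ∘ₗ LinearMap.fst ℝ V ℝ +
    (⟪rt R s t, rhoEps Δ s⟫_ℝ + 1) • LinearMap.snd ℝ V ℝ

theorem height_apply (t : ι) (z : V × ℝ) : height Δ s t z =
    ⟪z.1, rhoEps Δ s⟫_ℝ + (⟪rt R s t, rhoEps Δ s⟫_ℝ + 1) * z.2 := by
  rw [real_inner_comm]; rfl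

variable (hR : IsNormalizedForm R) [R.IsCrystallographic] [R.IsRootSystem] [R.IsReduced]
  [R.IsIrreducible] {t : ι} (ht : IsTheta Δ s t)

include hR ht

theorem affVec_mem_posAff_iff_height (i : ι) (j : ℤ) :
    affVec R s i j ∈ posAff Δ s ↔ 0 < height Δ s t (affVec R s i j) := by
  rw [affVec_mem_posAff_iff_inner hR ht, height_apply, affVec, root_eq (s := s), inner_smul_left,
    conj_trivial, show lv R s i * ⟪rt R s i, rhoEps Δ s⟫_ℝ +
      (⟪rt R s t, rhoEps Δ s⟫_ℝ + 1) * (lv R s i * j) = lv R s i * (⟪rt R s i, rhoEps Δ s⟫_ℝ +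
      (⟪rt R s t, rhoEps Δ s⟫_ℝ + 1) * j) by ring, mul_pos_iff_of_pos_left (lv_pos i)]

theorem neg_apply_mem_posAff_iff {g : AffGL V} (hg : g ∈ extGroup hR s) (k : Option Δ.support) :
    -(g (simpleAff Δ s k)) ∈ posAff Δ s ↔ 0 < -height Δ s t (g (simpleAff Δ s k)) := by
  obtain ⟨a, w, ha, rfl⟩ := hg
  obtain ⟨n, hn⟩ := ha (perm w (simpleIdx Δ t k))
  rw [simpleAff_eq ht, transl_mul_ext_affVec hR w _ hn, neg_affVec,
    affVec_mem_posAff_iff_height hR ht, ← neg_affVec, map_neg]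

omit ht [R.IsIrreducible] in
theorem simpleAff_inner_nonpos (ht : IsTheta Δ s t) {i j : Option Δ.support} (h : i ≠ j) :
    ⟪(simpleAff Δ s i).1, check (simpleAff Δ s j).1⟫_ℝ ≤ 0 := by
  have hc : ∀ x v : V, ⟪x, v⟫_ℝ ≤ 0 → ⟪x, check v⟫_ℝ ≤ 0 := fun x v hv => by
    rw [check, inner_smul_right]
    exact mul_nonpos_of_nonneg_of_nonpos (div_nonneg two_pos.le real_inner_self_nonneg) hv
  rcases i with _ | i <;> rcases j with _ | j
  · exact absurd rfl h
  · apply hc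
    change ⟪-theta Δ s, R.root j⟫_ℝ ≤ 0
    rw [ht.theta_eq, inner_neg_left, real_inner_comm, neg_nonpos]
    exact ht.dominant j
  · apply hc
    change ⟪R.root i, -theta Δ s⟫_ℝ ≤ 0
    rw [ht.theta_eq, inner_neg_right, neg_nonpos]
    exact ht.dominant i
  · change ⟪R.root i, check (R.root j)⟫_ℝ ≤ 0
    rw [← pairing_eq_inner hR, ← R.algebraMap_pairingIn ℤ]
    have := Δ.pairingIn_le_zero_of_ne (i := (i : ι)) (j := (j : ι))
      (fun e => h (congrArg some (Subtype.ext e))) i.2 j.2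
    simpa using this

theorem fst_simpleAff (k : Option Δ.support) :
    (simpleAff Δ s k).1 = R.root (simpleIdx Δ t k) := by
  rw [simpleAff_eq ht]; rfl

/-- Two distinct simple affine roots made negative by an element of the extended affine Weyl group
generate a finite dihedral group. -/
theorem exists_isDihedral {g : AffGL V} (hg : g ∈ extGroup hR s) {i j : Option Δ.support}
    (h : i ≠ j) (hi : -(g (simpleAff Δ s i)) ∈ posAff Δ s)
    (hj : -(g (simpleAff Δ s j)) ∈ posAff Δ s) :
    ∃ m, IsDihedral ⟪(simpleAff Δ s i).1, check (simpleAff Δ s j).1⟫_ℝ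
        ⟪(simpleAff Δ s j).1, check (simpleAff Δ s i).1⟫_ℝ m ∧
      ∀ z, alt (saff Δ s i) (saff Δ s j) (m + 1) z = alt (saff Δ s j) (saff Δ s i) (m + 1) z := by
  have ha := fst_ne_zero_of_mem_posAff (simpleAff_mem_posAff ht i)
  have hb := fst_ne_zero_of_mem_posAff (simpleAff_mem_posAff ht j)
  have hp := simpleAff_inner_nonpos hR ht h
  have hq := simpleAff_inner_nonpos hR ht h.symm
  have hmem : ∃ p q : ℤ, ⟪(simpleAff Δ s i).1, check (simpleAff Δ s j).1⟫_ℝ = p ∧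
      ⟪(simpleAff Δ s j).1, check (simpleAff Δ s i).1⟫_ℝ = q ∧
      (p, q) ∈ ({(0, 0), (1, 1), (-1, -1), (1, 2), (2, 1), (-1, -2), (-2, -1), (1, 3), (3, 1),
        (-1, -3), (-3, -1)} : Set (ℤ × ℤ)) := by
    have h1 : simpleIdx Δ t i ≠ simpleIdx Δ t j := fun e => by
      rw [fst_simpleAff hR ht, fst_simpleAff hR ht, e, inner_self_check (R.ne_zero _)] at hp
      linarith
    -- This excludes the infinite dihedral group: opposite finite parts would make α_i + α_j a
    -- nonnegative multiple of [0, 1], which g fixes and which has nonnegative height, although both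
    -- images have negative height.
    have h2 : R.root (simpleIdx Δ t i) ≠ -R.root (simpleIdx Δ t j) := fun e => by
      rw [neg_apply_mem_posAff_iff hR ht hg] at hi hj
      have hs : simpleAff Δ s i + simpleAff Δ s j =
          (0, (simpleAff Δ s i).2 + (simpleAff Δ s j).2) := by
        refine Prod.ext ?_ rfl
        rw [Prod.fst_add, fst_simpleAff hR ht, fst_simpleAff hR ht, e, neg_add_cancel]
      have hl : ∀ k, 0 ≤ (simpleAff Δ s k).2 := fun k => by
        cases k
        · exact zero_le_one
        · exact le_rfl
      have hsum : height Δ s t (g (simpleAff Δ s i)) + height Δ s t (g (simpleAff Δ s j)) =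
          (⟪rt R s t, rhoEps Δ s⟫_ℝ + 1) * ((simpleAff Δ s i).2 + (simpleAff Δ s j).2) := by
        rw [← map_add, ← map_add, hs]
        obtain ⟨a, w, -, rfl⟩ := hg
        rw [transl_mul_ext_apply, height_apply]
        simp
      have hpos : 0 < ⟪rt R s t, rhoEps Δ s⟫_ℝ := by
        rw [inner_rt_pos_iff]
        exact (strictlyDominant_rhoEps hR).inner_root_pos ht.isPos
      have := mul_nonneg (add_pos hpos one_pos).le (add_nonneg (hl i) (hl j))
      linarith
    -- The list of possible Cartan integers of two non-proportional roots.
    refine ⟨_, _, ?_, ?_, R.pairingIn_pairingIn_mem_set_of_isCrystal_of_isRed' _ _ (R.root.injective.ne h1) h2⟩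
    · rw [fst_simpleAff hR ht, fst_simpleAff hR ht, ← pairing_eq_inner hR,
        ← R.algebraMap_pairingIn ℤ]
      simp
    · rw [fst_simpleAff hR ht, fst_simpleAff hR ht, ← pairing_eq_inner hR,
        ← R.algebraMap_pairingIn ℤ]
      simp
  obtain ⟨p, q, h1, h2, h3⟩ := hmem
  rw [h1] at hp
  rw [h2] at hq
  have hp' : p ≤ 0 := by exact_mod_cast hp
  have hq' : q ≤ 0 := by exact_mod_cast hq
  have h4 : (p = 0 ∧ q = 0) ∨ (p = -1 ∧ q = -1) ∨ (p = -1 ∧ q = -2) ∨ (p = -1 ∧ q = -3) ∨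
      (p = -2 ∧ q = -1) ∨ (p = -3 ∧ q = -1) := by
    simp only [Set.mem_insert_iff, Set.mem_singleton_iff, Prod.mk.injEq] at h3
    omega
  rw [h1, h2]
  rcases h4 with ⟨rfl, rfl⟩ | ⟨rfl, rfl⟩ | ⟨rfl, rfl⟩ | ⟨rfl, rfl⟩ | ⟨rfl, rfl⟩ | ⟨rfl, rfl⟩
  · refine ⟨1, by simpa using isDihedral_two, alt_affRefl_comm ha hb ?_⟩
    simp [h1, h2]
  · refine ⟨2, by simpa using isDihedral_three, alt_affRefl_comm ha hb ?_⟩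
    simp [h1, h2]
  · refine ⟨3, by simpa using isDihedral_four, alt_affRefl_comm ha hb ?_⟩
    simp [h1, h2]
  · refine ⟨5, by simpa using isDihedral_six, alt_affRefl_comm ha hb ?_⟩
    simp [h1, h2]
  · refine ⟨3, by simpa using isDihedral_four.symm, fun z => (alt_affRefl_comm hb ha ?_ z).symm⟩
    simp [h1, h2]
  · refine ⟨5, by simpa using isDihedral_six.symm, fun z => (alt_affRefl_comm hb ha ?_ z).symm⟩
    simp [h1, h2]

omit hR ht [R.IsCrystallographic] [R.IsReduced] [R.IsIrreducible] in
/-- The relation `y = Φ (z)`, where `Φ` is the map given by a reduced decomposition of `g`. -/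
def IsValue (Δ : R.Base) (s : Setting) (g : AffGL V) (z y : V × ℝ) : Prop :=
  ∃ r L, IsReducedDecomp Δ s g r L ∧ y = phiWord Δ s L ((piZero Δ s r)⁻¹ z)

theorem IsValue.of_mul_saff {g : AffGL V} (hg : g ∈ extGroup hR s) {k : Option Δ.support}
    (hk : -(g (simpleAff Δ s k)) ∈ posAff Δ s) {z y : V × ℝ}
    (h : IsValue Δ s (g * saff Δ s k) z y) : IsValue Δ s g z (phi (simpleAff Δ s k) y) := by
  obtain ⟨r, L, ⟨hr, h1, h2⟩, rfl⟩ := h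
  refine ⟨r, L ++ [k], ⟨hr, ?_, ?_⟩, ?_⟩
  · rw [List.map_append, List.prod_append, ← mul_assoc, ← h1]
    simp [mul_assoc, affRefl_mul_self]
  · rw [List.length_append, h2, ← affLength_mul_saff_of_neg hR ht hg hk]; rfl
  · rw [phiWord_append]; rfl

omit hR ht [R.IsCrystallographic] [R.IsReduced] [R.IsIrreducible] [R.IsRootSystem] in
theorem exists_mul_altOut (hR : IsNormalizedForm R) [R.IsCrystallographic] [R.IsRootSystem]
    [R.IsReduced] [R.IsIrreducible] (ht : IsTheta Δ s t) {g : AffGL V}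
    (hg : g ∈ extGroup hR s) (i j : Option Δ.support) (k : ℕ) :
    ∃ x ∈ extGroup hR s, ∀ v, x v = g (altOut (saff Δ s i) (saff Δ s j) k v) := by
  induction k generalizing g i j with
  | zero => exact ⟨g, hg, fun v => rfl⟩
  | succ k ih => exact ih (mul_mem hg (saff_mem_extGroup hR ht i)) j i

/-- The negated heights of the images of the two simple roots transform exactly as in `AltPos`. Its
positivity says that every letter stripped from g shortens it, so reduced words of x extend to
reduced words of g. -/
theorem isValue_altOut {g x : AffGL V} (hg : g ∈ extGroup hR s) {i j : Option Δ.support} {k : ℕ}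
    (hpos : AltPos ⟪(simpleAff Δ s j).1, check (simpleAff Δ s i).1⟫_ℝ
      ⟪(simpleAff Δ s i).1, check (simpleAff Δ s j).1⟫_ℝ k
      (-height Δ s t (g (simpleAff Δ s i))) (-height Δ s t (g (simpleAff Δ s j))))
    (hx : ∀ v, x v = g (altOut (saff Δ s i) (saff Δ s j) k v)) {z y : V × ℝ}
    (h : IsValue Δ s x z y) :
    IsValue Δ s g z (altOut (phi (simpleAff Δ s i)) (phi (simpleAff Δ s j)) k y) := by
  induction k generalizing g i j with
  | zero => rwa [show x = g from LinearEquiv.ext hx] at h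
  | succ k ih =>
    have hi := (neg_apply_mem_posAff_iff hR ht hg i).mpr hpos.1
    refine IsValue.of_mul_saff hR ht hg hi (ih (mul_mem hg (saff_mem_extGroup hR ht i)) ?_ hx)
    have h2 := hpos.2
    convert h2 using 1
    · rw [LinearEquiv.mul_apply, affRefl_apply, map_sub, map_sub, map_smul, map_smul, smul_eq_mul]
      ring
    · rw [LinearEquiv.mul_apply, affRefl_self
        (fst_ne_zero_of_mem_posAff (simpleAff_mem_posAff ht i)), map_neg, map_neg]

theorem IsReducedDecomp.mem_extGroup {g : AffGL V} {r : Option Δ.support}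
    {L : List (Option Δ.support)} (h : IsReducedDecomp Δ s g r L) : g ∈ extGroup hR s := by
  rw [h.2.1]; exact piZero_mul_word_mem_extGroup hR ht r L

/-- The map given by a reduced decomposition does not depend on the decomposition. -/
theorem IsValue.unique {g : AffGL V} {z y y' : V × ℝ} (h : IsValue Δ s g z y)
    (h' : IsValue Δ s g z y') : y = y' := by
  induction hn : affLength Δ s g using Nat.strong_induction_on generalizing g y y' with
  | _ n ih =>
    obtain ⟨r, L, hL, rfl⟩ := h
    obtain ⟨r', L', hL', rfl⟩ := h'
    have hg := hL.mem_extGroup hR ht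
    have hlen : L.length = L'.length := hL.2.2.trans hL'.2.2.symm
    rcases List.eq_nil_or_concat L with rfl | ⟨L, i, rfl⟩
    · obtain rfl : L' = [] := List.length_eq_zero_iff.mp hlen.symm
      have h1 := hL.2.1
      have h2 := hL'.2.1
      simp only [List.map_nil, List.prod_nil, mul_one] at h1 h2
      rw [← h1, ← h2]
    rcases List.eq_nil_or_concat L' with rfl | ⟨L', j, rfl⟩
    · simp at hlen
    rw [List.concat_eq_append] at hL hL' ⊢
    rw [List.concat_eq_append, phiWord_append, phiWord_append]
    obtain ⟨h1, hi⟩ := hL.of_append hR ht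
    obtain ⟨h2, hj⟩ := hL'.of_append hR ht
    have hlt : ∀ k, -(g (simpleAff Δ s k)) ∈ posAff Δ s →
        affLength Δ s (g * saff Δ s k) < n := fun k hk => by
      have := affLength_mul_saff_of_neg hR ht hg hk
      omega
    rcases eq_or_ne i j with rfl | hij
    · rw [ih _ (hlt i hi) ⟨_, _, h1, rfl⟩ ⟨_, _, h2, rfl⟩ rfl]
    -- Both last letters are removable, hence so is the longest word of the dihedral group they
    -- generate. The two given values are compared through the remaining element x.
    obtain ⟨m, hd, hs⟩ := exists_isDihedral hR ht hg hij hi hj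
    obtain ⟨x, hx, hxv⟩ := exists_mul_altOut hR ht hg i j (m + 1)
    obtain ⟨r'', L'', hL''⟩ := exists_isReducedDecomp hR ht hx
    have key : ∀ {i j : Option Δ.support} {r : Option Δ.support} {L : List (Option Δ.support)},
        -(g (simpleAff Δ s i)) ∈ posAff Δ s → -(g (simpleAff Δ s j)) ∈ posAff Δ s →
        IsDihedral ⟪(simpleAff Δ s i).1, check (simpleAff Δ s j).1⟫_ℝ
          ⟪(simpleAff Δ s j).1, check (simpleAff Δ s i).1⟫_ℝ m →
        IsReducedDecomp Δ s (g * saff Δ s i) r L →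
        (∀ v, x v = g (altOut (saff Δ s i) (saff Δ s j) (m + 1) v)) →
        phi (simpleAff Δ s i) (phiWord Δ s L ((piZero Δ s r)⁻¹ z)) =
          altOut (phi (simpleAff Δ s i)) (phi (simpleAff Δ s j)) (m + 1)
            (phiWord Δ s L'' ((piZero Δ s r'')⁻¹ z)) := by
      intro i j r L hi hj hd hL hxv
      have h3 := hd.symm.pos _ _ ((neg_apply_mem_posAff_iff hR ht hg i).mp hi)
        ((neg_apply_mem_posAff_iff hR ht hg j).mp hj)
      rw [altOut]
      congr 1
      -- By induction the shorter element g s_i has one value only, so its word may be replaced by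
      -- one passing through x.
      refine ih _ (hlt i hi) ⟨_, _, hL, rfl⟩ (isValue_altOut hR ht
        (mul_mem hg (saff_mem_extGroup hR ht i)) (x := x) ?_ hxv ⟨_, _, hL'', rfl⟩) rfl
      have h2 := h3.2
      convert h2 using 1
      · rw [LinearEquiv.mul_apply, affRefl_apply, map_sub, map_sub, map_smul, map_smul,
          smul_eq_mul]
        ring
      · rw [LinearEquiv.mul_apply, affRefl_self
          (fst_ne_zero_of_mem_posAff (simpleAff_mem_posAff ht i)), map_neg, map_neg]
    have ha := fst_ne_zero_of_mem_posAff (simpleAff_mem_posAff ht i)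
    have hb := fst_ne_zero_of_mem_posAff (simpleAff_mem_posAff ht j)
    refine (key hi hj hd h1 hxv).trans (Eq.trans ?_ (key hj hi hd.symm h2 fun v => ?_).symm)
    · exact altOut_comm (alt_phi_comm ha hb hd hs) _
    · rw [hxv, altOut_comm hs]

theorem tWord_eq {g : AffGL V} {r r' : Option Δ.support} {L L' : List (Option Δ.support)}
    (h : IsReducedDecomp Δ s g r L) (h' : IsReducedDecomp Δ s g r' L') :
    tWord Δ s r L = tWord Δ s r' L' := by
  refine LinearMap.ext fun f => laurent_ext fun c => ?_
  rw [ev_tWord hR ht, ev_tWord hR ht,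
    IsValue.unique hR ht (⟨r, L, h, rfl⟩ : IsValue Δ s g (c, 0) _) ⟨r', L', h', rfl⟩]

theorem tOf_eq {g : AffGL V} {r : Option Δ.support} {L : List (Option Δ.support)}
    (h : IsReducedDecomp Δ s g r L) : tOf Δ s g = tWord Δ s r L := by
  obtain ⟨r', L', h', e⟩ := Classical.epsilon_spec
    (p := fun T => ∃ r L, IsReducedDecomp Δ s g r L ∧ T = tWord Δ s r L) ⟨_, r, L, h, rfl⟩
  exact e.trans (tWord_eq hR ht h' h)

end ExtDag

namespace ExtDag

variable {ι V N : Type*} [Fintype ι] [NormedAddCommGroup V] [InnerProductSpace ℝ V]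
  [AddCommGroup N] [Module ℝ N] {R : RootPairing ι ℝ V N} {Δ : R.Base} {s : Setting}
  (hR : IsNormalizedForm R) [R.IsCrystallographic] [R.IsRootSystem] [R.IsReduced]

include hR

/-! ### The element `π_ρ` -/

theorem StrictlyDominant.eq_one_of_smul_eq {x : V} (hx : StrictlyDominant Δ x) {w : R.weylGroup}
    (h : w • x = x) : w = 1 := by
  refine weyl_eq_one hR fun r => (hx.isPos_iff _).mpr ?_
  rw [root_perm, ← h, inner_weyl hR]
  exact hx.inner_root_pos (isPos_support Δ r)

theorem StrictlyDominant.u_eq_w0 {x : V} (hx : StrictlyDominant Δ x) : u Δ x = w0 Δ := by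
  rw [u, hx.eq_one_of_smul_eq hR (longest_spec hR (MulAction.stabilizer R.weylGroup x)).1, mul_one]

theorem piRho_eq : piRho Δ s = transl (rhoEps Δ s) * ext (w0 Δ) := by
  rw [piRho, piElt, (strictlyDominant_rhoEps hR).u_eq_w0 hR, ext_inv, w0_inv hR]

theorem piRho_eq' : piRho Δ s = ext (w0 Δ) * (transl (rhoEps Δ s))⁻¹ := by
  rw [piRho_eq hR]
  refine LinearEquiv.ext fun z => ?_
  rw [transl_mul_ext_apply, inner_weyl_left hR, w0_inv hR, w0_smul_rhoEps hR, inner_neg_right,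
    sub_neg_eq_add]
  rfl

theorem piRho_inv : (piRho Δ s)⁻¹ = piRho Δ s := by
  conv_lhs => rw [piRho_eq' hR]
  rw [mul_inv_rev, inv_inv, ext_inv, w0_inv hR, piRho_eq hR]

theorem piRho_apply (z : V × ℝ) :
    piRho Δ s z = (w0 Δ • z.1, z.2 + ⟪z.1, rhoEps Δ s⟫_ℝ) := by
  rw [piRho_eq' hR]; rfl

theorem piRho_mem_extGroup : piRho Δ s ∈ extGroup hR s :=
  ⟨_, _, exists_int_inner_rt_rhoEps hR, piRho_eq hR⟩

theorem piRho_affVec {i : ι} {n : ℤ} (h : ⟪rt R s i, rhoEps Δ s⟫_ℝ = n) (j : ℤ) :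
    piRho Δ s (affVec R s i j) = affVec R s (perm (w0 Δ) i) (j + n) := by
  rw [piRho_eq hR, transl_mul_ext_affVec hR _ (n := -n), sub_neg_eq_add]
  rw [rt_perm hR, inner_weyl_left hR, w0_inv hR, w0_smul_rhoEps hR, inner_neg_right, h]
  push_cast; rfl

theorem inner_rt_rhoEps_pos {i : ι} (hi : Δ.IsPos i) : 0 < ⟪rt R s i, rhoEps Δ s⟫_ℝ := by
  rw [inner_rt_pos_iff]
  exact (strictlyDominant_rhoEps hR).inner_root_pos hi

/-- The inversions of `π_ρ`. -/
theorem mem_invSet_piRho {h : ι → ℤ} (hh : ∀ i, ⟪rt R s i, rhoEps Δ s⟫_ℝ = h i) {x : V × ℝ} :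
    x ∈ invSet Δ s (piRho Δ s) ↔
      ∃ i j, Δ.IsPos i ∧ 0 < j ∧ j < h i ∧ x = affVec R s (negIdx R i) j := by
  have hneg : ∀ i, h (negIdx R i) = -h i := fun i => by
    have := hh (negIdx R i)
    rw [rt_negIdx, inner_neg_left, hh] at this
    exact_mod_cast this.symm
  have hpos : ∀ i, Δ.IsPos i → 0 < h i := fun i hi => by
    have := inner_rt_rhoEps_pos (s := s) hR hi
    rw [hh] at this
    exact_mod_cast this
  constructor
  · rintro ⟨h1, h2⟩
    obtain ⟨i, j, hij, rfl⟩ := mem_posAff_iff.mp h1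
    rw [piRho_affVec hR (hh i), neg_affVec_mem_posAff, affVec_mem_posAff, isPos_w0_iff hR] at h2
    by_cases hi : Δ.IsPos i
    · have := hpos i hi
      exact absurd (Or.inl (by omega)) h2
    · have hi' := (isPos_negIdx Δ i).mpr hi
      have h3 := hneg i
      refine ⟨negIdx R i, j, hi', ?_, ?_, by rw [negIdx_negIdx]⟩
      · rcases hij with hj | ⟨-, hj⟩
        · exact hj
        · exact absurd hj hi
      · by_contra hlt
        -- Level 0 is not an inversion either, since w_0 has made the negative root positive; hence
        -- the strict bound on j.
        rcases (show 0 < j + h i ∨ j + h i = 0 by omega) with h4 | h4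
        · exact h2 (Or.inl h4)
        · exact h2 (Or.inr ⟨h4, hi⟩)
  · rintro ⟨i, j, hi, h0, h1, rfl⟩
    refine ⟨affVec_mem_posAff.mpr (Or.inl h0), ?_⟩
    rw [piRho_affVec hR (hh _), neg_affVec_mem_posAff, affVec_mem_posAff, hneg]
    omega

theorem sum_inner_rt_rhoEps [DecidablePred Δ.IsPos] :
    ∑ i with Δ.IsPos i, ⟪rt R s i, rhoEps Δ s⟫_ℝ = 2 * ⟪rho Δ, rhoCheck Δ⟫_ℝ := by
  rw [← sum_inner]
  cases s with
  | untwisted =>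
    simp only [rt_untwisted, rhoEps, rho, inner_smul_left, conj_trivial]
    rw [← mul_assoc]
    norm_num
    congr!
  | twisted =>
    simp only [rt_twisted, rhoEps]
    rw [real_inner_comm (rhoCheck Δ)]
    simp only [rhoCheck, inner_smul_left, conj_trivial]
    rw [← mul_assoc]
    norm_num
    congr!

theorem affLength_piRho : (affLength Δ s (piRho Δ s) : ℝ) =
    2 * ⟪rho Δ, rhoCheck Δ⟫_ℝ - (Nat.card {i : ι // Δ.IsPos i} : ℝ) := by
  classical
  choose h hh using exists_int_inner_rt_rhoEps (Δ := Δ) (s := s) hR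
  have hinv : invSet Δ s (piRho Δ s) = ↑(((Finset.univ.filter Δ.IsPos).sigma
      fun i => Finset.Ioo 0 (h i)).image fun x => affVec R s (negIdx R x.1) x.2) := by
    ext x
    rw [mem_invSet_piRho hR hh]
    simp only [Finset.coe_image, Set.mem_image, Finset.mem_coe, Finset.mem_sigma,
      Finset.mem_filter, Finset.mem_univ, true_and, Finset.mem_Ioo]
    constructor
    · rintro ⟨i, j, hi, h0, h1, rfl⟩
      exact ⟨⟨i, j⟩, ⟨hi, h0, h1⟩, rfl⟩
    · rintro ⟨⟨i, j⟩, ⟨hi, h0, h1⟩, rfl⟩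
      exact ⟨i, j, hi, h0, h1, rfl⟩
  have hl : affLength Δ s (piRho Δ s) = (invSet Δ s (piRho Δ s)).ncard := rfl
  rw [hl, hinv, Set.ncard_coe_finset, Finset.card_image_of_injective, Finset.card_sigma,
    ← sum_inner_rt_rhoEps hR (s := s), Nat.card_eq_fintype_card, Fintype.card_subtype,
    Finset.card_eq_sum_ones]
  · push_cast
    rw [← Finset.sum_sub_distrib]
    refine Finset.sum_congr rfl fun i hi => ?_
    have h1 := inner_rt_rhoEps_pos (s := s) hR (Finset.mem_filter.mp hi).2
    rw [hh] at h1 ⊢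
    have h2 : 0 < h i := by exact_mod_cast h1
    rw [Int.card_Ioo]
    have h3 : ((h i - 0 - 1).toNat : ℤ) = h i - 1 := by omega
    exact_mod_cast h3
  · rintro ⟨i, j⟩ ⟨i', j'⟩ e
    obtain ⟨h1, rfl⟩ := affVec_inj.mp e
    obtain rfl : i = i' := by
      have := congrArg (negIdx R) h1
      simpa only [negIdx_negIdx] using this
    rfl

/-! ### The orbits of points under the maps `phi` -/

omit hR in
/-- The point `z'` is obtained from `z` by a reflection in an affine root from `S` which is positive
at `z`. -/
def Step (S : Set (V × ℝ)) (z z' : V × ℝ) : Prop :=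
  ∃ a ∈ S, 0 < pr a z ∧ z' = affRefl a z

omit [R.IsCrystallographic] [R.IsReduced] in
theorem pr_apply {g : AffGL V} (hg : g ∈ extGroup hR s) (a z : V × ℝ) :
    pr (g a) (g z) = pr a z :=
  inner_check_extGroup hR hg z a

variable [R.IsIrreducible] {t : ι} (ht : IsTheta Δ s t)

include ht

/-- The inversions of g are α_k together with the s_k-images of those of g s_k. Applying s_k to the
path of the shorter word gives a path from g⁻¹(z) to s_k(y). If folding reflects y, this is the end
point; if folding leaves y strictly on the negative side, one more step along α_k returns from
s_k(y) to y. -/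
theorem reflTransGen_step_phiWord {g : AffGL V} {r : Option Δ.support}
    {L : List (Option Δ.support)} (h : IsReducedDecomp Δ s g r L) (z : V × ℝ) :
    Relation.ReflTransGen (Step (invSet Δ s g)) (g⁻¹ z)
      (phiWord Δ s L ((piZero Δ s r)⁻¹ z)) := by
  induction L using List.reverseRecOn generalizing g with
  | nil =>
    have h1 := h.2.1
    simp only [List.map_nil, List.prod_nil, mul_one] at h1
    rw [h1]
    exact .refl
  | append_singleton L k ih =>
    obtain ⟨h1, h2⟩ := h.of_append hR ht
    have hg := h1.mem_extGroup hR ht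
    have hk := saff_mem_extGroup hR ht k
    have ha := fst_ne_zero_of_mem_posAff (simpleAff_mem_posAff ht k)
    have hpos : (g * saff Δ s k) (simpleAff Δ s k) ∈ posAff Δ s := by
      rw [LinearEquiv.mul_apply, affRefl_self ha, map_neg]; exact h2
    have hinv := invSet_mul_saff hR ht hpos
    have hgg : g * saff Δ s k * saff Δ s k = g := by
      rw [mul_assoc, affRefl_mul_self, mul_one]
    rw [hgg] at hinv
    have hstart : g⁻¹ z = saff Δ s k ((g * saff Δ s k)⁻¹ z) := by
      rw [mul_inv_rev, LinearEquiv.mul_apply, ← LinearEquiv.mul_apply, mul_inv_cancel]; rfl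
    have hlift : Relation.ReflTransGen (Step (invSet Δ s g)) (g⁻¹ z)
        (saff Δ s k (phiWord Δ s L ((piZero Δ s r)⁻¹ z))) := by
      rw [hstart]
      refine Relation.ReflTransGen.lift (saff Δ s k) ?_ _ _ (ih h1)
      rintro x y ⟨a, ha, hx, rfl⟩
      refine ⟨saff Δ s k a, ?_, ?_, (affRefl_conj hR hk a x).symm⟩
      · rw [hinv]; exact Set.mem_insert_of_mem _ ⟨a, ha, rfl⟩
      · rwa [pr_apply hR hk]
    rw [phiWord_append]
    set y := phiWord Δ s L ((piZero Δ s r)⁻¹ z)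
    change Relation.ReflTransGen _ _ (phi (simpleAff Δ s k) y)
    have hs := pr_affRefl_self ha y
    rcases lt_trichotomy 0 (pr (simpleAff Δ s k) y) with h3 | h3 | h3
    · rwa [phi_of_pos h3]
    · rw [phi_of_nonpos h3.ge]
      convert hlift using 1
      rw [affRefl_apply]
      have h4 : ⟪y.1, check (simpleAff Δ s k).1⟫_ℝ = 0 := h3.symm
      rw [h4, zero_smul, sub_zero]
    · rw [phi_of_nonpos h3.le]
      refine hlift.tail ⟨simpleAff Δ s k, ?_, by linarith, (affRefl_affRefl _ _).symm⟩
      rw [hinv]; exact Set.mem_insert _ _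

omit ht [R.IsIrreducible] in
/-- The effect of a step for the inversions of `π_ρ`. -/
theorem Step.exists_refl {z z' : V × ℝ} (hz : Step (invSet Δ s (piRho Δ s)) z z') :
    ∃ (i : ι) (j : ℤ), Δ.IsPos i ∧ 0 < j ∧ (j : ℝ) < ⟪rt R s i, rhoEps Δ s⟫_ℝ ∧
      ⟪z.1, check (R.root i)⟫_ℝ < 0 ∧ z'.1 = refl R i • z.1 ∧
      z'.2 = z.2 + ⟪z.1, check (R.root i)⟫_ℝ * (lv R s i * j) := by
  obtain ⟨a, ha, hpr, rfl⟩ := hz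
  choose h hh using exists_int_inner_rt_rhoEps (Δ := Δ) (s := s) hR
  obtain ⟨i, j, hi, h0, h1, rfl⟩ := (mem_invSet_piRho hR hh).mp ha
  have hc : ⟪z.1, check (affVec R s (negIdx R i) j).1⟫_ℝ = -⟪z.1, check (R.root i)⟫_ℝ := by
    rw [affVec, root_negIdx, check_neg, inner_neg_right]
  refine ⟨i, j, hi, h0, by rw [hh]; exact_mod_cast h1, ?_, ?_, ?_⟩
  · rw [pr, hc] at hpr; linarith
  · rw [affRefl_apply, hc, affVec, root_negIdx, refl_smul hR]
    simp
  · rw [affRefl_apply, hc, affVec, lv_negIdx]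
    simp

/-! ### Integrality and size of the exponents. -/

omit hR ht in
theorem exists_int_of_mem_Pminus (hR : IsNormalizedForm R) {b : V} (hb : b ∈ Pminus Δ) :
    (∀ i, ∃ n : ℤ, ⟪b, check (R.root i)⟫_ℝ = n) ∧ Dominant Δ (-b) := by
  have key : ∀ r : Δ.support, ∃ n : ℕ, ⟪b, check (R.root r)⟫_ℝ = -n := by
    classical
    intro r
    refine AddSubmonoid.closure_induction (motive := fun b _ => ∃ n : ℕ,
      ⟪b, check (R.root r)⟫_ℝ = -n) ?_ ⟨0, by simp⟩ ?_ hb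
    · rintro _ ⟨q, rfl⟩
      refine ⟨if r = q then 1 else 0, ?_⟩
      rw [inner_neg_left, inner_fundWeight]
      split_ifs <;> simp
    · rintro x y - - ⟨n, hn⟩ ⟨m, hm⟩
      exact ⟨n + m, by rw [inner_add_left, hn, hm]; push_cast; ring⟩
  constructor
  · intro i
    obtain ⟨n, hn⟩ := exists_int_inner_rt (s := .twisted) (Δ := Δ) (x := b) hR (fun r => by
      obtain ⟨n, hn⟩ := key r
      exact ⟨-n, by rw [rt_twisted, real_inner_comm, hn]; push_cast; rfl⟩) i
    exact ⟨n, by rw [real_inner_comm, ← rt_twisted, hn]⟩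
  · intro r
    obtain ⟨n, hn⟩ := key r
    have hp := inner_root_root_pos R r
    have : ⟪R.root r, -b⟫_ℝ = ⟪R.root r, R.root r⟫_ℝ / 2 * n := by
      rw [check, inner_smul_right, real_inner_comm] at hn
      rw [inner_neg_right, real_inner_comm]
      field_simp at hn ⊢
      linarith
    rw [this]
    positivity

theorem exists_int_inner_root_rhoEps (i : ι) : ∃ n : ℤ, ⟪R.root i, rhoEps Δ s⟫_ℝ = n := by
  obtain ⟨n, hn⟩ := exists_int_inner_rt_rhoEps (Δ := Δ) (s := s) hR i
  obtain ⟨m, hm⟩ := exists_int_lv (s := s) hR i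
  exact ⟨m * n, by rw [root_eq (s := s), inner_smul_left, hn, hm, conj_trivial]; push_cast; rfl⟩

theorem exists_int_inner_smul_sub {b : V} (hb : ∀ i, ∃ n : ℤ, ⟪b, check (R.root i)⟫_ℝ = n)
    (w : R.weylGroup) : ∃ n : ℤ, ⟪w • b, rhoEps Δ s⟫_ℝ - ⟪b, rhoEps Δ s⟫_ℝ = n := by
  induction w using weyl_induction (Δ := Δ) hR with
  | h1 => exact ⟨0, by simp⟩
  | h2 w r _ ih =>
    obtain ⟨n, hn⟩ := ih
    obtain ⟨k, hk⟩ := hb r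
    obtain ⟨m, hm⟩ := exists_int_inner_root_rhoEps hR ht (perm w r)
    refine ⟨n - k * m, ?_⟩
    rw [mul_smul, refl_smul hR, smul_sub, weyl_smul_comm, ← root_perm, inner_sub_left,
      inner_smul_left, hk, hm]
    push_cast
    rw [← hn, conj_trivial]
    ring

omit ht [R.IsIrreducible] in
theorem exists_smul_of_reflTransGen {z z' : V × ℝ}
    (h : Relation.ReflTransGen (Step (invSet Δ s (piRho Δ s))) z z') :
    ∃ w : R.weylGroup, z'.1 = w • z.1 := by
  induction h with
  | refl => exact ⟨1, (one_smul _ _).symm⟩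
  | tail _ h ih =>
    obtain ⟨w, hw⟩ := ih
    obtain ⟨i, j, -, -, -, -, h1, -⟩ := h.exists_refl hR
    exact ⟨refl R i * w, by rw [h1, hw, mul_smul]⟩

theorem exists_int_of_reflTransGen {z z' : V × ℝ}
    (hz : ∀ (w : R.weylGroup) i, ∃ n : ℤ, ⟪w • z.1, check (R.root i)⟫_ℝ = n)
    (h : Relation.ReflTransGen (Step (invSet Δ s (piRho Δ s))) z z') :
    ∃ n : ℤ, z'.2 - z.2 = n := by
  induction h with
  | refl => exact ⟨0, by simp⟩
  | tail h' h ih =>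
    obtain ⟨n, hn⟩ := ih
    obtain ⟨w, hw⟩ := exists_smul_of_reflTransGen hR h'
    obtain ⟨i, j, -, -, -, -, -, h1⟩ := h.exists_refl hR
    obtain ⟨k, hk⟩ := hz w i
    obtain ⟨m, hm⟩ := exists_int_lv (s := s) hR i
    refine ⟨n + k * (m * j), ?_⟩
    rw [h1, hw, hk, hm]
    push_cast
    rw [← hn]
    ring

-- With α positive and (z, α^∨) negative, a step adds -(z, α^∨) `lv` ((`rt` α, ρ^ε) - j) to the
-- quantity; this is positive because j lies strictly below the height.
omit ht [R.IsIrreducible] in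
theorem eq_or_lt_of_reflTransGen {z z' : V × ℝ}
    (h : Relation.ReflTransGen (Step (invSet Δ s (piRho Δ s))) z z') :
    z = z' ∨ z.2 + ⟪z.1, rhoEps Δ s⟫_ℝ < z'.2 + ⟪z'.1, rhoEps Δ s⟫_ℝ := by
  induction h with
  | refl => exact Or.inl rfl
  | @tail y y' _ h ih =>
    right
    have h1 : y.2 + ⟪y.1, rhoEps Δ s⟫_ℝ < y'.2 + ⟪y'.1, rhoEps Δ s⟫_ℝ := by
      obtain ⟨i, j, -, -, hj, hneg, h1, h2⟩ := h.exists_refl hR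
      have h3 : ⟪R.root i, rhoEps Δ s⟫_ℝ = lv R s i * ⟪rt R s i, rhoEps Δ s⟫_ℝ := by
        rw [root_eq (s := s), inner_smul_left, conj_trivial]
      rw [h1, h2, refl_smul hR, inner_sub_left, inner_smul_left, h3, conj_trivial]
      have := mul_pos (neg_pos.mpr hneg) (mul_pos (lv_pos (R := R) (s := s) i) (sub_pos.mpr hj))
      linarith
    rcases ih with rfl | ih
    · exact h1
    · exact ih.trans h1

-- A step requires a negative pairing with some positive root.
omit ht [R.IsIrreducible] in
theorem eq_of_reflTransGen_of_dominant {z z' : V × ℝ} (hz : Dominant Δ z.1)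
    (h : Relation.ReflTransGen (Step (invSet Δ s (piRho Δ s))) z z') : z' = z := by
  induction h with
  | refl => rfl
  | tail _ h ih =>
    subst ih
    obtain ⟨i, -, hi, -, -, hneg, -, -⟩ := h.exists_refl hR
    have := hz.inner_root_nonneg hi
    rw [real_inner_comm] at this
    rw [check, inner_smul_right] at hneg
    exact absurd (mul_nonneg (div_nonneg two_pos.le real_inner_self_nonneg) this) hneg.not_ge

/-- The exponents of the extremal dag-polynomials. -/
theorem exists_nat_of_reflTransGen {b c : V} (hb : b ∈ Pminus Δ)
    (hc : c ∈ MulAction.orbit R.weylGroup b) {z : V × ℝ}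
    (h : Relation.ReflTransGen (Step (invSet Δ s (piRho Δ s))) ((piRho Δ s)⁻¹ (c, 0)) z) :
    ∃ n : ℕ, z.2 - ⟪b, rhoEps Δ s⟫_ℝ = n ∧ (n = 0 ↔ c = b) := by
  obtain ⟨v, rfl⟩ := hc
  change Relation.ReflTransGen _ ((piRho Δ s)⁻¹ (v • b, 0)) z at h
  change ∃ n : ℕ, _ ∧ (n = 0 ↔ v • b = b)
  rw [piRho_inv hR, piRho_apply hR, zero_add] at h
  dsimp only at h
  obtain ⟨hint, hdom⟩ := exists_int_of_mem_Pminus hR hb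
  have hρ := strictlyDominant_rhoEps (Δ := Δ) (s := s) hR
  have hint' : ∀ (w : R.weylGroup) i, ∃ n : ℤ, ⟪w • b, check (R.root i)⟫_ℝ = n := fun w i => by
    obtain ⟨n, hn⟩ := hint (perm w⁻¹ i)
    exact ⟨n, by rw [inner_weyl_left hR, ← check_weyl hR, ← root_perm, hn]⟩
  have hdom' : Dominant Δ (w0 Δ • b) := fun r => by
    have h1 : Δ.IsPos (negIdx R (perm (w0 Δ) r)) :=
      (isPos_negIdx Δ _).mpr (not_isPos_w0 hR (isPos_support Δ r))
    have := hdom.inner_root_nonneg h1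
    rwa [root_negIdx, inner_neg_neg, root_perm, inner_weyl_left hR, w0_inv hR] at this
  have hw0 : ∀ x : V, ⟪w0 Δ • x, rhoEps Δ s⟫_ℝ = -⟪x, rhoEps Δ s⟫_ℝ := fun x => by
    rw [inner_weyl_left hR, w0_inv hR, w0_smul_rhoEps hR, inner_neg_right]
  obtain ⟨w, hw⟩ := exists_smul_of_reflTransGen hR h
  dsimp only at hw
  have horb : z.1 = (w * w0 Δ * v * w0 Δ) • w0 Δ • b := by
    rw [hw, ← mul_smul, ← mul_smul, ← mul_smul]
    congr 1
    rw [mul_assoc (w * w0 Δ * v), w0_mul_self hR, mul_one]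
  -- Every vector of the orbit pairs with ρ^ε at most as the dominant w_0 b does, that is, by at
  -- most -(b, ρ^ε).
  have hle := hdom'.inner_smul_le hR hρ.dominant (w * w0 Δ * v * w0 Δ)
  rw [← horb, hw0] at hle
  have hF := eq_or_lt_of_reflTransGen hR h
  dsimp only at hF
  rw [hw0, add_neg_cancel] at hF
  have hn : ∃ n : ℤ, z.2 - ⟪b, rhoEps Δ s⟫_ℝ = n := by
    obtain ⟨n, hn⟩ := exists_int_of_reflTransGen hR ht (fun w i => by
      dsimp only; rw [← mul_smul, ← mul_smul]; exact hint' _ i) h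
    obtain ⟨m, hm⟩ := exists_int_inner_smul_sub (s := s) (Δ := Δ) hR ht hint v
    exact ⟨n + m, by push_cast; rw [← hn, ← hm]; ring⟩
  obtain ⟨n, hn⟩ := hn
  have hF0 : 0 ≤ z.2 + ⟪z.1, rhoEps Δ s⟫_ℝ := by
    rcases hF with rfl | hF
    · dsimp only; rw [hw0, add_neg_cancel]
    · exact hF.le
  have hn0 : 0 ≤ n := by
    have : (0 : ℝ) ≤ n := by rw [← hn]; linarith
    exact_mod_cast this
  lift n to ℕ using hn0
  refine ⟨n, by rw [hn]; simp, ?_⟩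
  constructor
  · rintro rfl
    simp only [Nat.cast_zero, Int.cast_zero] at hn
    -- A nontrivial path would make the exponent positive. Without steps the end point is w_0 c, and
    -- equality in the orbit bound forces it to be w_0 b.
    rcases hF with rfl | hF
    · dsimp only at horb hn hle
      have h1 := hdom'.smul_eq_of_inner_eq hR hρ (w * w0 Δ * v * w0 Δ) (by
        rw [← horb, hw0, hw0]; linarith)
      rw [← horb] at h1
      exact MulAction.injective _ h1
    · linarith
  · intro hv
    rw [hv] at h
    have h1 := eq_of_reflTransGen_of_dominant hR hdom' h
    rw [h1] at hn
    simpa using hn.symm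

end ExtDag

namespace ExtDag

variable {ι V N : Type*} [Fintype ι] [NormedAddCommGroup V] [InnerProductSpace ℝ V]
  [AddCommGroup N] [Module ℝ N] {R : RootPairing ι ℝ V N} {Δ : R.Base} {s : Setting}

/-! ### The extremal dag-polynomials -/

open Classical in
theorem ev_orbitSum [R.IsRootSystem] (z : V × ℝ) (b : V) : ev z (orbitSum R b) =
    if z.1 ∈ MulAction.orbit R.weylGroup b then qPow (-z.2) else 0 := by
  simp only [orbitSum, map_sum, ev_X, Finset.sum_ite_eq', Set.Finite.mem_toFinset]

open Classical in
theorem ev_sum_orbit [R.IsRootSystem] (b c : V) (e : V → Coeff) :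
    ev (c, 0) (∑ x ∈ (finite_orbit (R := R) b).toFinset, e x • X x) =
      if c ∈ MulAction.orbit R.weylGroup b then e c else 0 := by
  simp only [map_sum, map_smul, ev_X, neg_zero, qPow_zero, smul_eq_mul, mul_ite, mul_one, mul_zero,
    Finset.sum_ite_eq', Set.Finite.mem_toFinset]

variable (hR : IsNormalizedForm R) [R.IsCrystallographic] [R.IsRootSystem] [R.IsReduced]
  [R.IsIrreducible] {t : ι} (ht : IsTheta Δ s t)

include hR ht

theorem extremalDag_eq {b : V} (hb : b ∈ Pminus Δ) : ∃ e : V → ℕ,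
    extremalDag Δ s b =
      ∑ c ∈ (finite_orbit (R := R) b).toFinset, qPow (-(e c : ℝ)) • X c ∧
    ∀ c ∈ MulAction.orbit R.weylGroup b, (e c = 0 ↔ c = b) := by
  classical
  obtain ⟨r, L, hL⟩ := exists_isReducedDecomp hR ht (piRho_mem_extGroup (Δ := Δ) hR)
  set Φ : V → V × ℝ := fun c => phiWord Δ s L ((piZero Δ s r)⁻¹ (c, 0))
  have hΦ : ∀ c, Relation.ReflTransGen (Step (invSet Δ s (piRho Δ s)))
    ((piRho Δ s)⁻¹ (c, 0)) (Φ c) := fun c => reflTransGen_step_phiWord hR ht hL (c, 0)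
  have horb : ∀ c, (Φ c).1 ∈ MulAction.orbit R.weylGroup b ↔
      c ∈ MulAction.orbit R.weylGroup b := fun c => by
    obtain ⟨w, hw⟩ := exists_smul_of_reflTransGen hR (hΦ c)
    rw [hw, piRho_inv hR, piRho_apply hR]
    dsimp only
    rw [← MulAction.orbit_eq_iff, MulAction.orbit_smul, MulAction.orbit_smul,
      MulAction.orbit_eq_iff]
  have hspec := fun c (hc : c ∈ MulAction.orbit R.weylGroup b) =>
    exists_nat_of_reflTransGen hR ht hb hc (hΦ c)
  -- On the orbit the difference is already a natural number, so the floor changes nothing there;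
  -- its values elsewhere play no role.
  refine ⟨fun c => ⌊(Φ c).2 - ⟪b, rhoEps Δ s⟫_ℝ⌋₊, laurent_ext fun c => ?_, fun c hc => ?_⟩
  · rw [extremalDag, frakT, tOf_eq hR ht hL, map_smul, ev_tWord hR ht, ev_orbitSum,
      ev_sum_orbit b c fun c => qPow (-(⌊(Φ c).2 - ⟪b, rhoEps Δ s⟫_ℝ⌋₊ : ℝ))]
    change _ • (if (Φ c).1 ∈ _ then qPow (-(Φ c).2) else 0) = _
    simp only [horb]
    split_ifs with hc
    · obtain ⟨n, hn, -⟩ := hspec c hc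
      rw [hn, Nat.floor_natCast, smul_eq_mul, qPow_mul, ← hn, real_inner_comm]
      congr 1
      ring
    · rw [smul_zero]
  · obtain ⟨n, hn, h⟩ := hspec c hc
    dsimp only
    rw [hn, Nat.floor_natCast, h]

end ExtDag

end

open ExtDag in
theorem theorem3p1 {ι V N : Type*} [Fintype ι] [NormedAddCommGroup V] [InnerProductSpace ℝ V]
    [AddCommGroup N] [Module ℝ N] (R : RootPairing ι ℝ V N) [R.IsRootSystem] [R.IsCrystallographic]
    [R.IsReduced] [R.IsIrreducible] (hR : IsNormalizedForm R) (Δ : R.Base) (s : Setting) :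
    -- the decomposition of `ρ^∨` (of `ρ` in the twisted setting)
    u Δ (rhoEps Δ s) = w0 Δ ∧
    piRho Δ s = ext (w0 Δ) * (transl (rhoEps Δ s))⁻¹ ∧
    piRho Δ s = transl (rhoEps Δ s) * ext (w0 Δ) ∧
    (affLength Δ s (piRho Δ s) : ℝ) =
      2 * inner ℝ (rho Δ) (rhoCheck Δ) - (Nat.card {i : ι // Δ.IsPos i} : ℝ) ∧
    -- `𝔗` is well defined: it is the operator of every reduced decomposition of `π_ρ`
    (∃ r L, IsReducedDecomp Δ s (piRho Δ s) r L) ∧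
    (∀ r L, IsReducedDecomp Δ s (piRho Δ s) r L → tWord Δ s r L = frakT Δ s) ∧
    -- the extremal dag-polynomials
    ∀ b ∈ Pminus Δ, ∃ e : V → ℕ,
      extremalDag Δ s b =
        ∑ c ∈ (finite_orbit (R := R) b).toFinset, qPow (-(e c : ℝ)) • X c ∧
      ∀ c ∈ MulAction.orbit R.weylGroup b, (e c = 0 ↔ c = b) := by
  obtain ⟨t, ht⟩ := exists_isTheta (Δ := Δ) (s := s) hR
  exact ⟨(strictlyDominant_rhoEps hR).u_eq_w0 hR, piRho_eq' hR, piRho_eq hR, affLength_piRho hR,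
    exists_isReducedDecomp hR ht (piRho_mem_extGroup hR),
    fun r L h => (tOf_eq hR ht h).symm, fun b hb => extremalDag_eq hR ht hb⟩
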